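/- Let $\mathbb T=[-\pi,\pi]$ be the torus (functions on $\mathbb T$ are $2\pi$-periodic and real-valued), let $$Hf(\theta)=\frac1{2\pi}\,\mathrm{p.v.}\!\int_{-\pi}^{\pi}\cot\Big(\frac{\theta-\vartheta}2\Big)f(\vartheta)\,d\vartheta$$ be the Hilbert transform on $\mathbb T$, and let $\{f,g\}=f\,\partial_\theta g-g\,\partial_\theta f$. Consider the system for $\eta^+,\eta^-$ $$\begin{cases}\partial_t\eta^+=\{\tfrac12\eta^++v^+,\ \sin(2\theta)\},\\ \partial_t\eta^-=\{\tfrac12\eta^--v^-,\ \sin(2\theta)\},\end{cases}\qquad \partial_\theta v^\pm=H\eta^\pm,\quad v^\pm(t,0)=0,\qquad t>0,\ \theta\in\mathbb T. \tag{1}$$ **Theorem (global well-posedness of the linearized problem).** Let $m>3$ be an integer and let $\eta_0^+,\eta_0^-\in H^m(\mathbb T)$ (not necessarily odd). Then for every $T>0$ there is a unique classical solution $(\eta^+,\eta^-)$ of (1) on $[0,T]$ with $\eta^\pm(0,\cdot)=\eta_0^\pm$, and it satisfies $$\eta^\pm\in C([0,T];H^m(\mathbb T))\cap C^2([0,T];H^{m-2}(\mathbb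 T)).$$ Here a classical solution on $[0,T]$ is a pair of functions that are continuous on $[0,T]\times\mathbb T$, of class $C^1$ on $(0,T]\times\mathbb T$, and satisfy (1) at every point of $(0,T]\times\mathbb T$ (with the left time derivative at $t=T$); uniqueness holds among all such pairs with the given initial data. -/

import Mathlib

open Set Filter Topology MeasureTheory
open scoped Real ENNReal ContDiff

namespace LinMHD

/-! Functions on the torus `[-π, π]` are represented by `2π`-periodic functions `ℝ → ℝ`. -/

/-- Lebesgue measure on one period `(-π, π]`. -/
noncomputable abbrev torusMeasure : Measure ℝ := volume.restrict (Ioc (-π) π)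

/-- The real Hilbert space `L²(-π, π)`. -/
abbrev L2 : Type := Lp ℝ 2 torusMeasure

/-- `g` is the weak derivative of `f` on the torus: the test functions are the smooth
`2π`-periodic functions, so that a jump across the end points `±π` is not allowed. -/
def HasWeakDeriv (f g : L2) : Prop :=
  ∀ φ : ℝ → ℝ, ContDiff ℝ ∞ φ → Function.Periodic φ (2 * π) →
    ∫ x, f x * deriv φ x ∂torusMeasure = -∫ x, g x * φ x ∂torusMeasure

lemma integrable_L2_mul (f : L2) {ψ : ℝ → ℝ} (hψ : Continuous ψ) :
    Integrable (fun x => f x * ψ x) torusMeasure := by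
  have h2 : MemLp ψ 2 torusMeasure := by
    have hb : ∃ C, ∀ x ∈ Icc (-π) π, ‖ψ x‖ ≤ C :=
      isCompact_Icc.exists_bound_of_continuousOn hψ.continuousOn
    obtain ⟨C, hC⟩ := hb
    refine MemLp.of_bound hψ.aestronglyMeasurable C ?_
    filter_upwards [ae_restrict_mem measurableSet_Ioc] with x hx
    exact hC x (Ioc_subset_Icc_self hx)
  exact (Lp.memLp f).integrable_mul h2

lemma integral_add_mul (f g : L2) {ψ : ℝ → ℝ} (hψ : Continuous ψ) :
    ∫ x, (f + g : L2) x * ψ x ∂torusMeasure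
      = ∫ x, f x * ψ x ∂torusMeasure + ∫ x, g x * ψ x ∂torusMeasure := by
  rw [← integral_add (integrable_L2_mul f hψ) (integrable_L2_mul g hψ)]
  refine integral_congr_ae ?_
  filter_upwards [Lp.coeFn_add f g] with x hx
  rw [hx, Pi.add_apply, add_mul]

lemma integral_smul_mul (c : ℝ) (f : L2) (ψ : ℝ → ℝ) :
    ∫ x, (c • f : L2) x * ψ x ∂torusMeasure = c * ∫ x, f x * ψ x ∂torusMeasure := by
  rw [← integral_const_mul]
  refine integral_congr_ae ?_
  filter_upwards [Lp.coeFn_smul c f] with x hx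
  rw [hx, Pi.smul_apply, smul_eq_mul, mul_assoc]

/-- The Sobolev space `H^m` of the torus. An element is the tuple `(f, f', …, f^(m))` of a function
in `L²` and its weak derivatives (which `f` determines); the norm inherited from the `ℓ²`-product
is the usual one, `‖f‖² = ∑ k ≤ m, ‖f^(k)‖²_{L²}`. -/
noncomputable def Sobolev (m : ℕ) : Submodule ℝ (PiLp 2 (fun _ : Fin (m + 1) => L2)) where
  carrier := {F | ∀ k : Fin m, HasWeakDeriv (F k.castSucc) (F k.succ)}
  add_mem' := by
    intro F G hF hG k φ hφ hp
    have hd : Continuous (deriv φ) := hφ.continuous_deriv (by simp)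
    rw [PiLp.add_apply, PiLp.add_apply, integral_add_mul _ _ hd,
      integral_add_mul _ _ hφ.continuous, hF k φ hφ hp, hG k φ hφ hp]
    ring
  zero_mem' := by
    intro k φ _ _
    have h0 : ∀ ψ : ℝ → ℝ, ∫ x, (0 : L2) x * ψ x ∂torusMeasure = 0 := by
      intro ψ
      have := integral_smul_mul 0 (0 : L2) ψ
      simpa using this
    rw [PiLp.zero_apply, PiLp.zero_apply, h0, h0, neg_zero]
  smul_mem' := by
    intro c F hF k φ hφ hp
    rw [PiLp.smul_apply, PiLp.smul_apply, integral_smul_mul, integral_smul_mul, hF k φ hφ hp]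
    ring

/-- The periodic function `f` represents the element `u` of `H^m`. -/
def Represents {m : ℕ} (f : ℝ → ℝ) (u : Sobolev m) : Prop :=
  Function.Periodic f (2 * π) ∧ f =ᵐ[torusMeasure] (u : PiLp 2 (fun _ : Fin (m + 1) => L2)) 0

/-- `η ∈ C^k([0,T]; H^m)`. -/
def InTimeSobolev (k m : ℕ) (T : ℝ) (η : ℝ → ℝ → ℝ) : Prop :=
  ∃ u : ℝ → Sobolev m, ContDiffOn ℝ k u (Icc 0 T) ∧ ∀ t ∈ Icc 0 T, Represents (η t) (u t)

/-- `y` is the value at `θ` of the Hilbert transform of the `2π`-periodic function `f`, i.e. the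
principal value of `(2π)⁻¹ ∫ cot ((θ - ϑ) / 2) f(ϑ) dϑ` over a period, here the one centred at the
singularity `θ`. -/
def HasHilbertTransformAt (f : ℝ → ℝ) (y θ : ℝ) : Prop :=
  Tendsto
    (fun ε : ℝ => (1 / (2 * π)) *
      ((∫ ϑ in (θ - π)..(θ - ε), Real.cot ((θ - ϑ) / 2) * f ϑ) +
        ∫ ϑ in (θ + ε)..(θ + π), Real.cot ((θ - ϑ) / 2) * f ϑ))
    (𝓝[>] 0) (𝓝 y)

/-- `v` is the velocity generated by `f`: `∂_θ v = H f` and `v(0) = 0`. -/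
def IsVelocity (f v : ℝ → ℝ) : Prop :=
  v 0 = 0 ∧ ∀ θ, ∃ y, HasHilbertTransformAt f y θ ∧ HasDerivAt v y θ

/-- The Lie bracket `{f, g} = f ∂_θ g - g ∂_θ f`. -/
noncomputable def lieBracket (f g : ℝ → ℝ) (θ : ℝ) : ℝ :=
  f θ * deriv g θ - g θ * deriv f θ

/-- `(ηp, ηm) = (η⁺, η⁻)` is a classical solution on `[0, T]` of the linearized system
`∂ₜ η^± = {η^±/2 ± v^±, sin 2θ}`, `∂_θ v^± = H η^±`, `v^±(t, 0) = 0`: periodic in `θ`, continuous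
on `[0, T] × ℝ`, of class `C¹` for `0 < t ≤ T`, and satisfying the equations pointwise there (the
time derivative at `t = T` is the left one). -/
structure IsClassicalSolution (T : ℝ) (ηp ηm : ℝ → ℝ → ℝ) : Prop where
  periodic_p : ∀ t ∈ Icc 0 T, Function.Periodic (ηp t) (2 * π)
  periodic_m : ∀ t ∈ Icc 0 T, Function.Periodic (ηm t) (2 * π)
  continuousOn_p : ContinuousOn (fun z : ℝ × ℝ => ηp z.1 z.2) (Icc 0 T ×ˢ univ)
  continuousOn_m : ContinuousOn (fun z : ℝ × ℝ => ηm z.1 z.2) (Icc 0 T ×ˢ univ)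
  contDiffOn_p : ContDiffOn ℝ 1 (fun z : ℝ × ℝ => ηp z.1 z.2) (Ioc 0 T ×ˢ univ)
  contDiffOn_m : ContDiffOn ℝ 1 (fun z : ℝ × ℝ => ηm z.1 z.2) (Ioc 0 T ×ˢ univ)
  equation_p : ∀ t ∈ Ioc 0 T, ∃ v : ℝ → ℝ, IsVelocity (ηp t) v ∧ ∀ θ,
    HasDerivWithinAt (fun s => ηp s θ)
      (lieBracket (fun x => 1 / 2 * ηp t x + v x) (fun x => Real.sin (2 * x)) θ) (Icc 0 T) t
  equation_m : ∀ t ∈ Ioc 0 T, ∃ v : ℝ → ℝ, IsVelocity (ηm t) v ∧ ∀ θ,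
    HasDerivWithinAt (fun s => ηm s θ)
      (lieBracket (fun x => 1 / 2 * ηm t x - v x) (fun x => Real.sin (2 * x)) θ) (Icc 0 T) t

end LinMHD

/-! The two components decouple: both satisfy `∂ₜη = {η/2 + σv, sin 2θ}`, with `σ = 1` for `η⁺` and
`σ = -1` for `η⁻`, so existence (`exists_solution`) and uniqueness (`unique_solution`) are proved
once for `|σ| ≤ 1`.

Existence is proved on Fourier coefficients. The Hilbert transform is the multiplier `-i sgn k`,
hence `v` has the modes `-η_k / |k|`, up to the constant that enforces `v(0) = 0`. Since `{f, sin
2θ} = 2 cos(2θ) f - sin(2θ) f'`, the generator couples the mode `k` only to `k ± 2`, with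
coefficients growing like `|k|`; the constant of `v` contributes a bounded rank-one term
proportional to `cos 2θ`. In the coordinates `b_k = (1 + |k|)^s a_k` of `H^s`, the couplings `k - 2
→ k` and `k → k - 2` cancel up to a bounded sum (`exists_bound_coef_add`): the leading part is
antisymmetric, and the quadratic form of the generator is bounded on every `H^s`.

Truncating the couplings at frequency `N` gives bounded operators with the same form bounds,
uniformly in `N` (`galerkin_inner_bound`), and compatible with the passage between Sobolev scales
(`galerkin_comp_smoothing`). Their exponentials are uniformly bounded in `N` on bounded time
intervals and converge strongly, by Duhamel's formula on smoother data and density (`exists_flow`).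
The limit is continuous in `H^m`. Each time derivative costs one space derivative, which gives `C²`
in `H^(m-2)`.

To return to functions, point evaluation is written as the pairing with an `ℓ²` sequence depending
differentiably on `θ` (`evalSeq`). `evalR_evolOp` identifies the Fourier generator with the Lie
bracket; all its coefficients are real, so the real part of a complex solution is again a solution
and no Hermitian symmetry has to be propagated.

Uniqueness is an `L²` energy estimate for the difference of two classical solutions: the transport
term is integrated by parts, `H` is a contraction of `L²`, and `v` is bounded uniformly by the `L²`
norm of `Hη` (`energy_inequality`). Grönwall's argument concludes (`eq_zero_of_solution`). -/

namespace LinMHD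

/-! ### Limits of exponentials of bounded operators along a scale of Hilbert spaces -/

section AbstractFlow

variable {E : Type*} [NormedAddCommGroup E] [InnerProductSpace ℝ E] [CompleteSpace E]

lemma hasDerivAt_exp_apply (A : E →L[ℝ] E) (x : E) (t : ℝ) :
    HasDerivAt (fun t : ℝ => NormedSpace.exp (t • A) x) (A (NormedSpace.exp (t • A) x)) t := by
  have h := hasDerivAt_exp_smul_const' (𝕂 := ℝ) A t
  simpa using h.clm_apply (hasDerivAt_const t x)

lemma hasDerivAt_exp_apply' (A : E →L[ℝ] E) (x : E) (t : ℝ) :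
    HasDerivAt (fun t : ℝ => NormedSpace.exp (t • A) x) (NormedSpace.exp (t • A) (A x)) t := by
  have h := hasDerivAt_exp_smul_const (𝕂 := ℝ) A t
  simpa using h.clm_apply (hasDerivAt_const t x)

/-- Grönwall: `exp(-2Ct) ‖exp(tA)x‖²` has nonpositive derivative. Only the quadratic form of `A`
enters, not its norm, so the bound survives a limit in which the norms blow up. -/
lemma norm_exp_apply_le_of_nonneg (A : E →L[ℝ] E) {C : ℝ}
    (hA : ∀ x, inner ℝ (A x) x ≤ C * ‖x‖ ^ 2) (x : E) {t : ℝ} (ht : 0 ≤ t) :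
    ‖NormedSpace.exp (t • A) x‖ ≤ Real.exp (C * t) * ‖x‖ := by
  set u : ℝ → E := fun t => NormedSpace.exp (t • A) x with hu
  have hd : ∀ t, HasDerivAt (fun t => Real.exp (-(2 * C) * t) * ‖u t‖ ^ 2)
      (Real.exp (-(2 * C) * t) * (-(2 * C)) * ‖u t‖ ^ 2 +
        Real.exp (-(2 * C) * t) * (2 * inner ℝ (u t) (A (u t)))) t := by
    intro t
    have h1 : HasDerivAt (fun t => Real.exp (-(2 * C) * t))
        (Real.exp (-(2 * C) * t) * (-(2 * C))) t := by
      simpa using ((hasDerivAt_id t).const_mul (-(2 * C))).exp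
    exact h1.mul (hasDerivAt_exp_apply A x t).norm_sq
  have hanti : Antitone (fun t => Real.exp (-(2 * C) * t) * ‖u t‖ ^ 2) := by
    apply antitone_of_hasDerivAt_nonpos hd
    intro t
    have h := hA (u t)
    rw [real_inner_comm] at h
    have := Real.exp_pos (-(2 * C) * t)
    simp only [Pi.zero_apply]
    nlinarith
  have h0 := hanti ht
  simp only [hu, zero_smul, NormedSpace.exp_zero, mul_zero, Real.exp_zero, one_mul,
    one_apply_eq_self] at h0
  have hsq : ‖u t‖ ^ 2 ≤ (Real.exp (C * t) * ‖x‖) ^ 2 := by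
    have he : Real.exp (C * t) ^ 2 * Real.exp (-(2 * C) * t) = 1 := by
      rw [← Real.exp_nat_mul, ← Real.exp_add, Real.exp_eq_one_iff]; push_cast; ring
    calc ‖u t‖ ^ 2 = Real.exp (C * t) ^ 2 * (Real.exp (-(2 * C) * t) * ‖u t‖ ^ 2) := by
          rw [← mul_assoc, he, one_mul]
      _ ≤ Real.exp (C * t) ^ 2 * ‖x‖ ^ 2 := by gcongr
      _ = _ := by ring
  exact (sq_le_sq₀ (norm_nonneg _) (by positivity)).1 hsq

lemma norm_exp_apply_le (A : E →L[ℝ] E) {C : ℝ}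
    (hA : ∀ x, |inner ℝ (A x) x| ≤ C * ‖x‖ ^ 2) (x : E) (t : ℝ) :
    ‖NormedSpace.exp (t • A) x‖ ≤ Real.exp (C * |t|) * ‖x‖ := by
  rcases le_total 0 t with ht | ht
  · rw [abs_of_nonneg ht]
    exact norm_exp_apply_le_of_nonneg A (fun x => (le_abs_self _).trans (hA x)) x ht
  · rw [abs_of_nonpos ht]
    have := norm_exp_apply_le_of_nonneg (-A) (C := C) (fun x => by
      have := (neg_le_abs _).trans (hA x)
      simpa using this) x (neg_nonneg.2 ht)
    simpa using this

/-- The path `s ↦ exp((t-s)A) Λ exp(sA') x` has zero derivative and joins the two sides. -/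
lemma exp_smul_intertwine {A A' Λ : E →L[ℝ] E} (h : A ∘L Λ = Λ ∘L A') (t : ℝ) (x : E) :
    NormedSpace.exp (t • A) (Λ x) = Λ (NormedSpace.exp (t • A') x) := by
  have hd : ∀ s, HasDerivAt (fun s : ℝ => NormedSpace.exp ((t - s) • A)
      (Λ (NormedSpace.exp (s • A') x))) 0 s := by
    intro s
    have h1 : HasDerivAt (fun s : ℝ => NormedSpace.exp ((t - s) • A))
        (-(NormedSpace.exp ((t - s) • A) * A)) s := by
      have := (hasDerivAt_exp_smul_const (𝕂 := ℝ) A (t - s)).scomp s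
        ((hasDerivAt_id s).const_sub t)
      simpa [Function.comp_def] using this
    have h2 : HasDerivAt (fun s : ℝ => Λ (NormedSpace.exp (s • A') x))
        (Λ (A' (NormedSpace.exp (s • A') x))) s :=
      Λ.hasFDerivAt.comp_hasDerivAt s (hasDerivAt_exp_apply A' x s)
    have h3 := h1.clm_apply h2
    have h4 : Λ (A' (NormedSpace.exp (s • A') x)) = A (Λ (NormedSpace.exp (s • A') x)) :=
      (DFunLike.congr_fun h _).symm
    simpa [h4] using h3
  have hc := is_const_of_deriv_eq_zero (fun s => (hd s).differentiableAt)
    (fun s => (hd s).deriv) 0 t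
  simpa using hc

/-- Duhamel's comparison: differentiate `s ↦ exp((t-s)A) exp(sA') x` and bound the derivative. The
difference `A - A'` is only tested along the orbit of `x`, so it need not be small in operator norm.
-/
lemma norm_exp_sub_exp_apply_le (A A' : E →L[ℝ] E) {C M : ℝ} (hC : 0 ≤ C)
    (hA : ∀ x, |inner ℝ (A x) x| ≤ C * ‖x‖ ^ 2) (x : E) {T : ℝ}
    (hM : ∀ s ∈ Icc (-T) T, ‖(A - A') (NormedSpace.exp (s • A') x)‖ ≤ M) {t : ℝ}
    (ht : t ∈ Icc (-T) T) :
    ‖NormedSpace.exp (t • A) x - NormedSpace.exp (t • A') x‖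
      ≤ T * Real.exp (C * (2 * T)) * M := by
  have hT : 0 ≤ T := by linarith [ht.1, ht.2]
  have hM0 : 0 ≤ M := (norm_nonneg _).trans (hM 0 ⟨by linarith, hT⟩)
  set g : ℝ → E := fun s => NormedSpace.exp ((t - s) • A) (NormedSpace.exp (s • A') x) with hg
  have hd : ∀ s, HasDerivAt g (NormedSpace.exp ((t - s) • A)
      (-((A - A') (NormedSpace.exp (s • A') x)))) s := by
    intro s
    have h1 : HasDerivAt (fun s : ℝ => NormedSpace.exp ((t - s) • A))
        (-(NormedSpace.exp ((t - s) • A) * A)) s := by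
      have := (hasDerivAt_exp_smul_const (𝕂 := ℝ) A (t - s)).scomp s
        ((hasDerivAt_id s).const_sub t)
      simpa [Function.comp_def] using this
    have h3 := h1.clm_apply (hasDerivAt_exp_apply A' x s)
    convert h3 using 1
    simp [sub_eq_add_neg, add_comm]
  have hconv : Convex ℝ (Icc (-T) T) := convex_Icc _ _
  have hb : ∀ s ∈ Icc (-T) T, ‖NormedSpace.exp ((t - s) • A)
      (-((A - A') (NormedSpace.exp (s • A') x)))‖ ≤ Real.exp (C * (2 * T)) * M := by
    intro s hs
    refine (norm_exp_apply_le A hA _ _).trans ?_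
    rw [norm_neg]
    have : |t - s| ≤ 2 * T := by rw [abs_le]; constructor <;> linarith [ht.1, ht.2, hs.1, hs.2]
    gcongr
    exact hM s hs
  have := hconv.norm_image_sub_le_of_norm_hasDerivWithin_le
    (fun s hs => (hd s).hasDerivWithinAt) hb (x := t) (y := 0) ht ⟨by linarith, hT⟩
  simp only [hg, sub_zero, zero_smul, sub_self, NormedSpace.exp_zero,
    one_apply_eq_self] at this
  refine this.trans ?_
  have ht' : ‖(0:ℝ) - t‖ ≤ T := by
    rw [zero_sub, norm_neg, Real.norm_eq_abs, abs_le]; exact ht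
  calc _ ≤ Real.exp (C * (2 * T)) * M * T := by gcongr
    _ = _ := by ring

omit [CompleteSpace E] in
/-- Strong uniform Cauchy property extends from a dense set to the whole space. -/
lemma uniformCauchySeqOn_of_dense {ι : Type*} {F : ℕ → ι → E →L[ℝ] E} {I : Set ι} {B : ℝ}
    (hB : ∀ N, ∀ t ∈ I, ∀ x, ‖F N t x‖ ≤ B * ‖x‖) {S : Set E} (hS : Dense S)
    (hF : ∀ y ∈ S, UniformCauchySeqOn (fun N t => F N t y) atTop I) (x : E) :
    UniformCauchySeqOn (fun N t => F N t x) atTop I := by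
  rw [Metric.uniformCauchySeqOn_iff]
  intro ε hε
  obtain ⟨y, hyS, hy⟩ := Metric.dense_iff.1 hS x (ε / (3 * (|B| + 1))) (by positivity)
  have hxy : ‖x - y‖ < ε / (3 * (|B| + 1)) := by
    rw [← dist_eq_norm, dist_comm]; exact hyS
  obtain ⟨N, hN⟩ := Metric.uniformCauchySeqOn_iff.1 (hF y hy) (ε / 3) (by positivity)
  refine ⟨N, fun m hm n hn t ht => ?_⟩
  have h1 : ∀ k, ‖F k t x - F k t y‖ < ε / 3 := by
    intro k
    rw [← map_sub]
    calc ‖F k t (x - y)‖ ≤ B * ‖x - y‖ := hB k t ht _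
      _ ≤ (|B| + 1) * ‖x - y‖ := by gcongr; linarith [le_abs_self B]
      _ < (|B| + 1) * (ε / (3 * (|B| + 1))) := by gcongr
      _ = ε / 3 := by field_simp
  have h2 := hN m hm n hn t ht
  have a1 := h1 m
  have a2 := h1 n
  rw [← dist_eq_norm] at a1 a2
  rw [dist_comm] at a2
  have := dist_triangle4 (F m t x) (F m t y) (F n t y) (F n t x)
  linarith

/-- Limit evolution of a family of bounded operators along a scale of spaces. -/
theorem exists_flow (Λ : E →L[ℝ] E) (hΛ : DenseRange Λ) (A : ℕ → ℕ → E →L[ℝ] E)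
    (K : ℕ → E →L[ℝ] E)
    (hdiss : ∀ s, ∃ C, 0 ≤ C ∧ ∀ N x, |inner ℝ (A s N x) x| ≤ C * ‖x‖ ^ 2)
    (hinter : ∀ s N, A s N ∘L Λ = Λ ∘L A (s + 1) N)
    (hbd : ∀ s, ∃ B, ∀ N, ‖A s N ∘L Λ‖ ≤ B)
    (hlim : ∀ s, Tendsto (fun N => A s N ∘L Λ ∘L Λ) atTop (𝓝 (K s ∘L Λ))) :
    (∀ s, K s ∘L Λ = Λ ∘L K (s + 1)) ∧
    ∃ U : ℕ → ℝ → E → E, (∀ s x, U s 0 x = x) ∧ (∀ s x, Continuous fun t => U s t x) ∧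
      (∀ s t x, U s t (Λ x) = Λ (U (s + 1) t x)) ∧
      ∀ s t x, HasDerivAt (fun t => Λ (U (s + 1) t x)) (K s (U (s + 1) t x)) t := by
  choose C hC0 hC using hdiss
  choose B hB using hbd
  -- The hypothesis gives convergence on the range of `Λ`; density and the uniform bound on `A s N ∘
  -- Λ` extend it to every vector.
  have hKstrong : ∀ s x, Tendsto (fun N => A s N (Λ x)) atTop (𝓝 (K s x)) := by
    intro s x
    have hy : ∀ y, Tendsto (fun N => A s N (Λ (Λ y))) atTop (𝓝 (K s (Λ y))) := by
      intro y
      exact ((ContinuousLinearMap.apply ℝ E y).continuous.tendsto _).comp (hlim s)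
    rw [Metric.tendsto_atTop]
    intro ε hε
    set D := |B s| + ‖K s‖ + 1 with hD
    have hDpos : 0 < D := by positivity
    obtain ⟨z, hz, y, rfl⟩ := Metric.dense_iff.1 hΛ x (ε / (2 * D)) (by positivity)
    have hxy : ‖x - Λ y‖ < ε / (2 * D) := by
      rw [← dist_eq_norm, dist_comm]; exact hz
    obtain ⟨N, hN⟩ := Metric.tendsto_atTop.1 (hy y) (ε / 2) (by positivity)
    refine ⟨N, fun n hn => ?_⟩
    have h1 : ‖A s n (Λ (x - Λ y))‖ ≤ |B s| * ‖x - Λ y‖ :=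
      ((A s n ∘L Λ).le_opNorm _).trans (by gcongr; exact (hB s n).trans (le_abs_self _))
    have h2 : ‖K s (x - Λ y)‖ ≤ ‖K s‖ * ‖x - Λ y‖ := (K s).le_opNorm _
    have h3 := hN n hn
    rw [dist_eq_norm] at h3 ⊢
    have h4 : A s n (Λ x) - K s x = A s n (Λ (x - Λ y)) - K s (x - Λ y)
        + (A s n (Λ (Λ y)) - K s (Λ y)) := by simp only [map_sub]; abel
    have h5 : D * ‖x - Λ y‖ < ε / 2 := by
      calc D * ‖x - Λ y‖ < D * (ε / (2 * D)) := by gcongr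
        _ = ε / 2 := by field_simp
    rw [h4]
    have h6 := norm_add_le (A s n (Λ (x - Λ y)) - K s (x - Λ y))
      (A s n (Λ (Λ y)) - K s (Λ y))
    have h7 := norm_sub_le (A s n (Λ (x - Λ y))) (K s (x - Λ y))
    have h8 : D * ‖x - Λ y‖ = |B s| * ‖x - Λ y‖ + ‖K s‖ * ‖x - Λ y‖ + ‖x - Λ y‖ := by
      rw [hD]; ring
    have := norm_nonneg (x - Λ y)
    linarith
  have hKinter : ∀ s, K s ∘L Λ = Λ ∘L K (s + 1) := by
    intro s
    ext x
    refine tendsto_nhds_unique (hKstrong s (Λ x)) ?_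
    have h1 := (Λ.continuous.tendsto _).comp (hKstrong (s + 1) x)
    refine h1.congr fun N => ?_
    exact (DFunLike.congr_fun (hinter s N) (Λ x)).symm
  refine ⟨hKinter, ?_⟩
  set F : ℕ → ℕ → ℝ → E →L[ℝ] E := fun s N t => NormedSpace.exp (t • A s N) with hF
  have hFb : ∀ s N t x, ‖F s N t x‖ ≤ Real.exp (C s * |t|) * ‖x‖ := fun s N t x =>
    norm_exp_apply_le _ (hC s N) x t
  have hFb' : ∀ s (T : ℝ) N, ∀ t ∈ Icc (-T) T, ∀ x, ‖F s N t x‖ ≤ Real.exp (C s * T) * ‖x‖ := by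
    intro s T N t ht x
    refine (hFb s N t x).trans ?_
    have := abs_le.2 ht
    have := hC0 s
    gcongr
  have hFi : ∀ s N t x, F s N t (Λ x) = Λ (F (s + 1) N t x) := fun s N t x =>
    exp_smul_intertwine (hinter s N) t x
  have hcauchy : ∀ s x (T : ℝ), UniformCauchySeqOn (fun N t => F s N t x) atTop (Icc (-T) T) := by
    intro s x T
    -- Data in the range of `Λ²` have two orders of regularity to spare, exactly what convergence of
    -- `A s N ∘ Λ ∘ Λ` in norm requires.
    have hdense : Dense (range fun y => Λ (Λ y)) := hΛ.comp hΛ Λ.continuous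
    refine uniformCauchySeqOn_of_dense (hFb' s T) hdense ?_ x
    rintro _ ⟨y, rfl⟩
    rcases lt_or_ge T 0 with hT | hT
    · rw [Icc_eq_empty (by linarith), Metric.uniformCauchySeqOn_iff]
      intro ε _; exact ⟨0, by simp⟩
    have hcs : CauchySeq (fun N => A s N ∘L Λ ∘L Λ) := (hlim s).cauchySeq
    rw [Metric.uniformCauchySeqOn_iff]
    intro ε hε
    set Q := T * Real.exp (C s * (2 * T)) * (Real.exp (C (s + 2) * T) * ‖y‖) with hQ
    have hQ0 : 0 ≤ Q := by positivity
    obtain ⟨N, hN⟩ := Metric.cauchySeq_iff.1 hcs (ε / (Q + 1)) (by positivity)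
    refine ⟨N, fun m hm n hn t ht => ?_⟩
    rw [dist_eq_norm]
    have hnm := hN m hm n hn
    rw [dist_eq_norm] at hnm
    have h1 := norm_exp_sub_exp_apply_le (A s m) (A s n) (hC0 s) (hC s m) (Λ (Λ y)) (T := T)
      (M := ε / (Q + 1) * (Real.exp (C (s + 2) * T) * ‖y‖)) (t := t) (fun r hr => by
        -- The orbit stays in the range of `Λ²`, with preimages controlled by the energy bound at
        -- level `s + 2`.
        have e1 : NormedSpace.exp (r • A s n) (Λ (Λ y)) = Λ (Λ (F (s + 2) n r y)) := by
          rw [← hFi (s + 1), ← hFi s]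
        rw [e1]
        have e2 := (A s m ∘L Λ ∘L Λ - A s n ∘L Λ ∘L Λ).le_opNorm (F (s + 2) n r y)
        refine e2.trans ?_
        gcongr
        exact hFb' (s + 2) T n r hr y) ht
    refine h1.trans_lt ?_
    calc T * Real.exp (C s * (2 * T)) * (ε / (Q + 1) * (Real.exp (C (s + 2) * T) * ‖y‖))
        = Q / (Q + 1) * ε := by rw [hQ]; ring
      _ < 1 * ε := by
          gcongr
          rw [div_lt_one (by positivity)]; linarith
      _ = ε := one_mul _
  have hex : ∀ s t x, ∃ y, Tendsto (fun N => F s N t x) atTop (𝓝 y) := by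
    intro s t x
    exact cauchySeq_tendsto_of_complete
      ((hcauchy s x |t|).cauchySeq (abs_le.1 le_rfl))
  choose U hU using hex
  have hUu : ∀ s x (T : ℝ), TendstoUniformlyOn (fun N t => F s N t x) (fun t => U s t x) atTop
      (Icc (-T) T) := fun s x T =>
    (hcauchy s x T).tendstoUniformlyOn_of_tendsto fun t _ => hU s t x
  have hUi : ∀ s t x, U s t (Λ x) = Λ (U (s + 1) t x) := by
    intro s t x
    refine tendsto_nhds_unique (hU s t (Λ x)) ?_
    exact ((Λ.continuous.tendsto _).comp (hU (s + 1) t x)).congr fun N => (hFi s N t x).symm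
  refine ⟨U, ?_, ?_, hUi, ?_⟩
  · intro s x
    refine tendsto_nhds_unique (hU s 0 x) ?_
    simp [hF]
  · intro s x
    rw [continuous_iff_continuousAt]
    intro t
    have hnhds : Icc (-(|t| + 1)) (|t| + 1) ∈ 𝓝 t :=
      Icc_mem_nhds (by linarith [neg_abs_le t]) (by linarith [le_abs_self t])
    refine ContinuousOn.continuousAt ?_ hnhds
    refine (hUu s x (|t| + 1)).continuousOn (Frequently.of_forall fun N => ?_)
    exact (continuous_iff_continuousAt.2 fun r =>
      (hasDerivAt_exp_apply (A s N) x r).continuousAt).continuousOn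
  · intro s t x
    -- Each truncated generator commutes with its own exponential; both orders of composition
    -- converge strongly.
    have hUK : U s t (K s x) = K s (U (s + 1) t x) := by
      have h1 : Tendsto (fun N => F s N t (A s N (Λ x))) atTop (𝓝 (U s t (K s x))) := by
        have h2 : Tendsto (fun N => F s N t (A s N (Λ x) - K s x)) atTop (𝓝 0) := by
          refine squeeze_zero_norm (fun N => hFb s N t _) ?_
          have h3 := ((hKstrong s x).sub_const (K s x)).norm.const_mul (Real.exp (C s * |t|))
          simpa using h3
        have h4 := h2.add (hU s t (K s x))
        simpa using h4
      have h5 : Tendsto (fun N => A s N (Λ (F (s + 1) N t x))) atTop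
          (𝓝 (K s (U (s + 1) t x))) := by
        have h6 : Tendsto (fun N => A s N (Λ (F (s + 1) N t x - U (s + 1) t x))) atTop (𝓝 0) := by
          refine squeeze_zero_norm (fun N => ((A s N ∘L Λ).le_opNorm _).trans
            (mul_le_mul_of_nonneg_right (hB s N) (norm_nonneg _))) ?_
          have h3 := ((hU (s + 1) t x).sub_const (U (s + 1) t x)).norm.const_mul (B s)
          simpa using h3
        have h4 := h6.add (hKstrong s (U (s + 1) t x))
        simpa using h4
      refine tendsto_nhds_unique h1 (h5.congr fun N => ?_)
      rw [← hFi]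
      exact ((hasDerivAt_exp_apply (A s N) (Λ x) t).unique
        (hasDerivAt_exp_apply' (A s N) (Λ x) t))
    rw [← hUK]
    have hfun : (fun t => Λ (U (s + 1) t x)) = fun t => U s t (Λ x) := by
      funext t; rw [hUi]
    rw [hfun]
    set T := |t| + 1 with hT
    have ht : t ∈ Ioo (-T) T := ⟨by linarith [neg_abs_le t], by linarith [le_abs_self t]⟩
    -- The derivatives of the approximate orbits converge uniformly on a neighbourhood of `t`, so
    -- the limit may be differentiated.
    refine hasDerivAt_of_tendstoUniformlyOn (𝕜 := ℝ) (l := atTop) isOpen_Ioo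
      (f := fun N t => F s N t (Λ x)) (f' := fun N t => F s N t (A s N (Λ x)))
      (g := fun t => U s t (Λ x)) (g' := fun t => U s t (K s x)) ?_
      (Eventually.of_forall fun N r _ => hasDerivAt_exp_apply' (A s N) (Λ x) r)
      (fun r _ => hU s r (Λ x)) ht
    have hk := ((hUu s (K s x) T).mono Ioo_subset_Icc_self)
    rw [Metric.tendstoUniformlyOn_iff] at hk ⊢
    intro ε hε
    have h3 := ((hKstrong s x).sub_const (K s x)).norm.const_mul (Real.exp (C s * T))
    simp only [sub_self, norm_zero, mul_zero] at h3
    filter_upwards [hk (ε / 2) (by positivity), h3.eventually_lt_const (half_pos hε)] with N h1 h2 r hr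
    have h4 := hFb' s T N r (Ioo_subset_Icc_self hr) (A s N (Λ x) - K s x)
    rw [map_sub, ← dist_eq_norm] at h4
    have h5 := dist_triangle_right (U s r (K s x)) (F s N r (A s N (Λ x))) (F s N r (K s x))
    linarith [h1 r hr]

end AbstractFlow

/-! ### Square summable sequences and weighted shifts -/

/-- Square summable complex sequences indexed by `ℤ`. -/
abbrev Seq2 : Type := lp (fun _ : ℤ => ℂ) 2

lemma memℓp_two_iff {f : ℤ → ℂ} : Memℓp f 2 ↔ Summable fun k => ‖f k‖ ^ 2 := by
  rw [memℓp_gen_iff (by norm_num)]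
  simp

lemma Seq2.summable_sq (x : Seq2) : Summable fun k => ‖x k‖ ^ 2 := memℓp_two_iff.1 x.2

lemma Seq2.norm_sq (x : Seq2) : ‖x‖ ^ 2 = ∑' k, ‖x k‖ ^ 2 := by
  have := lp.norm_rpow_eq_tsum (p := 2) (by norm_num) x
  simpa using this

lemma summable_sq_weighted {c : ℤ → ℂ} {B : ℝ} (hc : ∀ k, ‖c k‖ ≤ B) (n : ℤ) (x : Seq2) :
    Summable fun k => ‖c k * x (k + n)‖ ^ 2 := by
  have h := (((Equiv.addRight n).summable_iff).2 x.summable_sq).mul_left (B ^ 2)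
  refine Summable.of_nonneg_of_le (fun k => by positivity) (fun k => ?_) h
  simp only [Function.comp_apply, Equiv.coe_addRight, norm_mul, mul_pow]
  gcongr
  exact hc k

open Classical in
/-- The weighted shift `x ↦ (c k * x (k + n))ₖ` for a bounded weight `c`. -/
noncomputable def wshift (c : ℤ → ℂ) (n : ℤ) : Seq2 →L[ℝ] Seq2 :=
  -- The value `0` for an unbounded weight makes the definition total; the formula `wshift_apply`
  -- asks for a bound.
  if h : ∃ B, ∀ k, ‖c k‖ ≤ B then
    LinearMap.mkContinuous
      { toFun := fun x => ⟨fun k => c k * x (k + n),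
          memℓp_two_iff.2 (summable_sq_weighted h.choose_spec n x)⟩
        map_add' := fun x y => by
          ext k
          exact mul_add _ _ _
        map_smul' := fun r x => by
          ext k
          simp only [lp.coeFn_smul, Pi.smul_apply, RingHom.id_apply, Complex.real_smul]
          ring }
      |h.choose| (fun x => by
        have hB := h.choose_spec
        set B := h.choose
        refine (sq_le_sq₀ (norm_nonneg _) (by positivity)).1 ?_
        rw [mul_pow, Seq2.norm_sq, Seq2.norm_sq, sq_abs, ← tsum_mul_left]
        rw [← (Equiv.addRight n).tsum_eq (fun k => B ^ 2 * ‖x k‖ ^ 2)]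
        refine Summable.tsum_le_tsum (fun k => ?_) (summable_sq_weighted hB n x) ?_
        · simp only [LinearMap.coe_mk, AddHom.coe_mk, norm_mul, mul_pow, Equiv.coe_addRight]
          gcongr
          exact hB k
        · exact ((Equiv.addRight n).summable_iff
            (f := fun k => B ^ 2 * ‖x k‖ ^ 2)).2 (x.summable_sq.mul_left _))
  else 0

lemma wshift_apply {c : ℤ → ℂ} (hc : ∃ B, ∀ k, ‖c k‖ ≤ B) (n : ℤ) (x : Seq2) (k : ℤ) :
    wshift c n x k = c k * x (k + n) := by
  rw [wshift, dif_pos hc]; rfl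

lemma norm_wshift_apply_le {c : ℤ → ℂ} {B : ℝ} (hc : ∀ k, ‖c k‖ ≤ B) (n : ℤ) (x : Seq2) :
    ‖wshift c n x‖ ≤ B * ‖x‖ := by
  have hB : 0 ≤ B := (norm_nonneg _).trans (hc 0)
  refine (sq_le_sq₀ (norm_nonneg _) (by positivity)).1 ?_
  rw [mul_pow, Seq2.norm_sq, Seq2.norm_sq, ← tsum_mul_left,
    ← (Equiv.addRight n).tsum_eq (fun k => B ^ 2 * ‖x k‖ ^ 2)]
  simp only [wshift_apply ⟨B, hc⟩]
  refine Summable.tsum_le_tsum (fun k => ?_) (summable_sq_weighted hc n x) ?_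
  · simp only [norm_mul, mul_pow, Equiv.coe_addRight]
    gcongr
    exact hc k
  · exact ((Equiv.addRight n).summable_iff
      (f := fun k => B ^ 2 * ‖x k‖ ^ 2)).2 (x.summable_sq.mul_left _)

lemma norm_wshift_le {c : ℤ → ℂ} {B : ℝ} (hc : ∀ k, ‖c k‖ ≤ B) (n : ℤ) :
    ‖wshift c n‖ ≤ B :=
  ContinuousLinearMap.opNorm_le_bound _ ((norm_nonneg _).trans (hc 0))
    (norm_wshift_apply_le hc n)

/-- Reindexing `k ↦ k + n` gives the adjoint of a shift with real weights. It turns the downward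
coupling into an upward one, so that the two can be added. -/
lemma inner_wshift {c : ℤ → ℝ} (hc : ∃ B, ∀ k, ‖(c k : ℂ)‖ ≤ B) (n : ℤ) (x y : Seq2) :
    inner ℝ (wshift (fun k => (c k : ℂ)) n x) y
      = inner ℝ x (wshift (fun k => (c (k - n) : ℂ)) (-n) y) := by
  obtain ⟨B, hB⟩ := hc
  rw [lp.inner_eq_tsum, lp.inner_eq_tsum, ← (Equiv.addRight n).tsum_eq (fun k =>
    inner ℝ (x k) (wshift (fun k => (c (k - n) : ℂ)) (-n) y k))]
  refine tsum_congr fun k => ?_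
  rw [wshift_apply ⟨B, hB⟩, wshift_apply ⟨B, fun k => hB (k - n)⟩]
  simp only [Equiv.coe_addRight, add_sub_cancel_right, add_neg_cancel_right]
  rw [← Complex.real_smul, ← Complex.real_smul, real_inner_smul_left, real_inner_smul_right]

/-! ### Sobolev weights and the smoothing operator -/

/-- The weight `1 + |k|`. -/
noncomputable def wt (k : ℤ) : ℝ := 1 + |(k : ℝ)|

lemma wt_pos (k : ℤ) : 0 < wt k := by unfold wt; positivity

lemma one_le_wt (k : ℤ) : 1 ≤ wt k := by unfold wt; linarith [abs_nonneg (k : ℝ)]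

lemma abs_wt_sub_le (k : ℤ) : |wt k - wt (k - 2)| ≤ 2 := by
  unfold wt
  push_cast
  have := abs_abs_sub_abs_le_abs_sub (k : ℝ) (k - 2)
  rw [show (k : ℝ) - (k - 2) = 2 by ring, abs_two] at this
  rwa [show 1 + |(k : ℝ)| - (1 + |(k : ℝ) - 2|) = |(k : ℝ)| - |(k : ℝ) - 2| by ring]

lemma wt_le (k : ℤ) : wt k ≤ 3 * wt (k - 2) := by
  have := abs_le.1 (abs_wt_sub_le k)
  linarith [one_le_wt (k - 2)]

lemma wt_le' (k : ℤ) : wt (k - 2) ≤ 3 * wt k := by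
  have := abs_le.1 (abs_wt_sub_le k)
  linarith [one_le_wt k]

lemma exists_bound_wt_inv : ∃ B : ℝ, ∀ k, ‖(((wt k)⁻¹ : ℝ) : ℂ)‖ ≤ B :=
  ⟨1, fun k => by
    rw [Complex.norm_real, Real.norm_eq_abs, abs_of_pos (inv_pos.2 (wt_pos k))]
    exact inv_le_one_of_one_le₀ (one_le_wt k)⟩

/-- The smoothing operator dividing by the weight `1 + |k|`. -/
noncomputable def smoothing : Seq2 →L[ℝ] Seq2 := wshift (fun k => (((wt k)⁻¹ : ℝ) : ℂ)) 0

lemma smoothing_apply (x : Seq2) (k : ℤ) : smoothing x k = (((wt k)⁻¹ : ℝ) : ℂ) * x k := by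
  rw [smoothing, wshift_apply exists_bound_wt_inv, add_zero]

/-- Finitely supported sequences lie in the range and are dense. -/
lemma denseRange_smoothing : DenseRange smoothing := by
  intro x
  have h := lp.hasSum_single (E := fun _ : ℤ => ℂ) (p := 2) (by norm_num) x
  refine mem_closure_of_tendsto h (Eventually.of_forall fun s => ?_)
  refine ⟨∑ k ∈ s, lp.single 2 k ((wt k : ℂ) * x k), ?_⟩
  rw [map_sum]
  refine Finset.sum_congr rfl fun k _ => ?_
  ext j
  rw [smoothing_apply, lp.single_apply, lp.single_apply]
  rcases eq_or_ne j k with rfl | hjk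
  · have : (wt j : ℂ) ≠ 0 := by exact_mod_cast (wt_pos j).ne'
    simp only [Pi.single_eq_same]
    push_cast
    field_simp
  · simp [Pi.single_eq_of_ne hjk]

lemma summable_wt_inv_sq : Summable fun k : ℤ => (wt k)⁻¹ ^ 2 := by
  have h : Summable fun k : ℤ => |(k : ℝ)| ^ (-2 : ℝ) :=
    Real.summable_abs_int_rpow (by norm_num)
  -- The real power vanishes by convention at `k = 0`, where the weight is `1`; the extra term
  -- covers this mode.
  have h2 : Summable fun k : ℤ => |(k : ℝ)| ^ (-2 : ℝ) + (if k = 0 then (1:ℝ) else 0) := by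
    refine h.add (summable_of_ne_finset_zero (s := {0}) fun b hb => ?_)
    simp at hb; simp [hb]
  refine Summable.of_nonneg_of_le (fun k => by positivity) (fun k => ?_) h2
  rcases eq_or_ne k 0 with rfl | hk
  · simp [wt]
  · have hk' : 0 < |(k : ℝ)| := by positivity
    rw [if_neg hk, add_zero, Real.rpow_neg hk'.le, inv_pow]
    norm_cast
    gcongr
    unfold wt; push_cast; linarith

/-- The sequence `((1 + |k|)⁻¹)ₖ`. -/
noncomputable def wtInv : Seq2 := ⟨fun k => (((wt k)⁻¹ : ℝ) : ℂ), memℓp_two_iff.2 (by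
  simpa [← Complex.ofReal_inv, Complex.norm_real, abs_of_pos, wt_pos] using summable_wt_inv_sq)⟩


/-! ### Coupling coefficients and their cancellation -/

section Coefficients

variable (σ : ℝ)

/-- Fourier symbol of `η ↦ η / 2 + σ v`, up to the constant mode of `v`. -/
noncomputable def symb (j : ℤ) : ℝ := 1 / 2 - σ / |(j : ℝ)|

/-- Coupling of the mode `k` to the mode `k - 2`, in the coordinates of `H^s`. -/
noncomputable def coefUp (s : ℕ) (k : ℤ) : ℝ :=
  (wt k / wt (k - 2)) ^ s * (symb σ (k - 2) * (2 - k / 2))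

/-- Coupling of the mode `k - 2` to the mode `k`, in the coordinates of `H^s`. -/
noncomputable def coefDown (s : ℕ) (k : ℤ) : ℝ :=
  (wt (k - 2) / wt k) ^ s * (symb σ k * (1 + k / 2))

lemma coefUp_succ (s : ℕ) (k : ℤ) :
    coefUp σ (s + 1) k = wt k / wt (k - 2) * coefUp σ s k := by
  unfold coefUp; ring

lemma coefDown_succ (s : ℕ) (k : ℤ) :
    coefDown σ (s + 1) k = wt (k - 2) / wt k * coefDown σ s k := by
  unfold coefDown; ring

variable {σ}

lemma abs_symb_le (hσ : |σ| ≤ 1) (j : ℤ) : |symb σ j| ≤ 3 / 2 := by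
  have h : |(σ / |(j : ℝ)|)| ≤ 1 := by
    rw [abs_div, abs_abs]
    -- Division by zero makes the symbol equal `1 / 2` at the zero mode; the mean of `v` is handled
    -- by the rank-one term.
    rcases eq_or_ne j 0 with rfl | hj
    · simp
    · have : (1 : ℝ) ≤ |(j : ℝ)| := by exact_mod_cast Int.one_le_abs hj
      exact div_le_one_of_le₀ (hσ.trans this) (by positivity)
  unfold symb
  rw [abs_le] at h ⊢
  constructor <;> linarith [h.1, h.2]

lemma abs_coefUp_le (hσ : |σ| ≤ 1) (s : ℕ) (k : ℤ) : |coefUp σ s k| ≤ 3 ^ (s + 1) * wt k := by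
  have h1 : wt k / wt (k - 2) ≤ 3 := (div_le_iff₀ (wt_pos _)).2 (wt_le k)
  have h2 : |(2 : ℝ) - k / 2| ≤ 2 * wt k := by
    unfold wt
    have := abs_le.1 (le_refl |(k : ℝ)|)
    rw [abs_le]; constructor <;> linarith [abs_nonneg (k : ℝ)]
  unfold coefUp
  rw [abs_mul, abs_mul, abs_of_nonneg (pow_nonneg (div_nonneg (wt_pos _).le (wt_pos _).le) s)]
  calc _ ≤ 3 ^ s * (3 / 2 * (2 * wt k)) := by
        gcongr
        · exact div_nonneg (wt_pos _).le (wt_pos _).le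
        · exact abs_symb_le hσ _
    _ = _ := by ring

lemma abs_coefDown_le (hσ : |σ| ≤ 1) (s : ℕ) (k : ℤ) :
    |coefDown σ s k| ≤ 3 ^ (s + 1) * wt k := by
  have h1 : wt (k - 2) / wt k ≤ 3 := (div_le_iff₀ (wt_pos _)).2 (wt_le' k)
  have h2 : |(1 : ℝ) + k / 2| ≤ 2 * wt k := by
    unfold wt
    have := abs_le.1 (le_refl |(k : ℝ)|)
    rw [abs_le]; constructor <;> linarith [abs_nonneg (k : ℝ)]
  unfold coefDown
  rw [abs_mul, abs_mul, abs_of_nonneg (pow_nonneg (div_nonneg (wt_pos _).le (wt_pos _).le) s)]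
  calc _ ≤ 3 ^ s * (3 / 2 * (2 * wt k)) := by
        gcongr
        · exact div_nonneg (wt_pos _).le (wt_pos _).le
        · exact abs_symb_le hσ _
    _ = _ := by ring

lemma abs_one_add_half_div_le (j : ℤ) : |((1 + (j : ℝ) / 2) / |(j : ℝ)|)| ≤ 3 / 2 := by
  rcases eq_or_ne j 0 with rfl | hj
  · norm_num
  · have : (1 : ℝ) ≤ |(j : ℝ)| := by exact_mod_cast Int.one_le_abs hj
    rw [abs_div, abs_abs, div_le_iff₀ (by positivity), abs_le]
    have := abs_le.1 (le_refl |(j : ℝ)|)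
    constructor <;> linarith

/-- The cancellation behind all energy estimates. Each coefficient grows like `|k|`, but for `s = 0`
the linear parts `-k/4` and `k/4` cancel. Raising `s` by one multiplies the coefficients by ratios
of neighbouring weights, which are `1 + O(1/|k|)`, and so changes each of them by a bounded amount.
-/
lemma exists_bound_coef_add (hσ : |σ| ≤ 1) (s : ℕ) :
    ∃ B, ∀ k, |coefUp σ s k + coefDown σ s k| ≤ B := by
  induction s with
  | zero =>
    -- The main parts of the symbols sum to `3/2`; the two quotients by `|k - 2|` and `|k|` are at
    -- most `3/2` each.
    refine ⟨9 / 2, fun k => ?_⟩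
    have h1 := abs_one_add_half_div_le k
    have h2 := abs_one_add_half_div_le (-(k - 2))
    push_cast at h2
    rw [abs_neg] at h2
    have h3 : coefUp σ 0 k + coefDown σ 0 k = 3 / 2 - σ * ((1 + -((k : ℝ) - 2) / 2) / |(k : ℝ) - 2|
        + (1 + (k : ℝ) / 2) / |(k : ℝ)|) := by
      unfold coefUp coefDown symb
      push_cast
      ring
    rw [h3]
    have h4 : |σ * ((1 + -((k : ℝ) - 2) / 2) / |(k : ℝ) - 2| + (1 + (k : ℝ) / 2) / |(k : ℝ)|)|
        ≤ 1 * 3 := by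
      rw [abs_mul]
      gcongr
      exact (abs_add_le _ _).trans (by linarith)
    have := abs_sub (3 / 2 : ℝ)
      (σ * ((1 + -((k : ℝ) - 2) / 2) / |(k : ℝ) - 2| + (1 + (k : ℝ) / 2) / |(k : ℝ)|))
    rw [abs_of_nonneg (by norm_num : (0:ℝ) ≤ 3 / 2)] at this
    linarith
  | succ s ih =>
    obtain ⟨B, hB⟩ := ih
    refine ⟨B + 3 ^ (s + 1) * 6 + 3 ^ (s + 1) * 2, fun k => ?_⟩
    have hp := wt_pos k
    have hp' := wt_pos (k - 2)
    have h1 : |coefUp σ (s + 1) k - coefUp σ s k| ≤ 3 ^ (s + 1) * 6 := by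
      have e : coefUp σ (s + 1) k - coefUp σ s k
          = coefUp σ s k * ((wt k - wt (k - 2)) / wt (k - 2)) := by
        rw [coefUp_succ]; field_simp
      rw [e, abs_mul, abs_div, abs_of_pos hp']
      calc _ ≤ 3 ^ (s + 1) * (3 * wt (k - 2)) * (2 / wt (k - 2)) := by
            gcongr
            · exact (abs_coefUp_le hσ s k).trans (by gcongr; exact wt_le k)
            · exact abs_wt_sub_le k
        _ = _ := by field_simp; ring
    have h2 : |coefDown σ (s + 1) k - coefDown σ s k| ≤ 3 ^ (s + 1) * 2 := by
      have e : coefDown σ (s + 1) k - coefDown σ s k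
          = -(coefDown σ s k * ((wt k - wt (k - 2)) / wt k)) := by
        rw [coefDown_succ]; field_simp; ring
      rw [e, abs_neg, abs_mul, abs_div, abs_of_pos hp]
      calc _ ≤ 3 ^ (s + 1) * wt k * (2 / wt k) := by
            gcongr
            · exact abs_coefDown_le hσ s k
            · exact abs_wt_sub_le k
        _ = _ := by field_simp
    have h3 := hB k
    rw [abs_le] at *
    constructor <;> linarith [h1.1, h1.2, h2.1, h2.2, h3.1, h3.2]

end Coefficients

/-! ### Truncated generators on the Sobolev scale and the Fourier flow -/

section Operators

lemma memℓp_lowMode (s : ℕ) :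
    Memℓp (fun k : ℤ => (((wt k)⁻¹ ^ s * |(k : ℝ)|⁻¹ : ℝ) : ℂ)) 2 := by
  refine memℓp_two_iff.2 (Summable.of_nonneg_of_le (fun k => by positivity) (fun k => ?_)
    (summable_wt_inv_sq.mul_left (2 ^ 2)))
  rw [Complex.norm_real, Real.norm_eq_abs, ← mul_pow]
  have hw : (wt k)⁻¹ ≤ 1 := inv_le_one_of_one_le₀ (one_le_wt k)
  have hw0 : 0 ≤ (wt k)⁻¹ := inv_nonneg.2 (wt_pos k).le
  rw [abs_of_nonneg (by positivity)]
  refine pow_le_pow_left₀ (by positivity) ?_ 2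
  rcases eq_or_ne k 0 with rfl | hk
  · simp [wt]
  · have h1 : (1 : ℝ) ≤ |(k : ℝ)| := by exact_mod_cast Int.one_le_abs hk
    calc (wt k)⁻¹ ^ s * |(k : ℝ)|⁻¹ ≤ 1 * |(k : ℝ)|⁻¹ := by
          gcongr; exact pow_le_one₀ hw0 hw
      _ ≤ 2 * (wt k)⁻¹ := by
          rw [one_mul, ← div_eq_mul_inv, inv_eq_one_div,
            div_le_div_iff₀ (by positivity) (wt_pos k)]
          unfold wt; linarith

/-- The coefficients of the functional `a ↦ ∑ a_k / |k|` in the coordinates of `H^s`. -/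
noncomputable def lowMode (s : ℕ) : Seq2 := ⟨_, memℓp_lowMode s⟩

lemma lowMode_apply (s : ℕ) (k : ℤ) :
    lowMode s k = (((wt k)⁻¹ ^ s * |(k : ℝ)|⁻¹ : ℝ) : ℂ) := rfl

/-- The sequence of `2 cos 2θ`, in the coordinates of `H^s`. -/
noncomputable def cosSeq (s : ℕ) : Seq2 :=
  ((3 : ℝ) ^ s) • (lp.single 2 2 1 + lp.single 2 (-2) 1)

lemma cosSeq_apply (s : ℕ) (k : ℤ) :
    cosSeq s k = ((3 : ℝ) ^ s : ℝ) * ((if k = 2 then 1 else 0) + (if k = -2 then 1 else 0) : ℂ) := by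
  simp only [cosSeq, lp.coeFn_smul, lp.coeFn_add, Pi.smul_apply, Pi.add_apply, lp.single_apply,
    Pi.single_apply, Complex.real_smul]

/-- The contribution of the constant mode of `v`. -/
noncomputable def rankOne (σ : ℝ) (s : ℕ) : Seq2 →L[ℝ] Seq2 :=
  σ • ((ContinuousLinearMap.toSpanSingleton ℂ (cosSeq s)) ∘L
    (innerSL ℂ (lowMode s))).restrictScalars ℝ

lemma rankOne_apply (σ : ℝ) (s : ℕ) (x : Seq2) :
    rankOne σ s x = σ • (inner ℂ (lowMode s) x • cosSeq s) := rfl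

/-- The weight equals `3` at `k = ±2`, which explains the factor `3 ^ s`. -/
lemma smoothing_cosSeq (s : ℕ) : smoothing (cosSeq (s + 1)) = cosSeq s := by
  ext k
  rw [smoothing_apply, cosSeq_apply, cosSeq_apply]
  have h : ∀ k : ℤ, (k = 2 ∨ k = -2) → wt k = 3 := by
    rintro k (rfl | rfl) <;> norm_num [wt]
  by_cases h2 : k = 2
  · rw [h k (Or.inl h2)]; push_cast; rw [pow_succ]; ring
  · by_cases h3 : k = -2
    · rw [h k (Or.inr h3)]; push_cast; rw [pow_succ]; ring
    · simp [h2, h3]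

lemma inner_lowMode (s : ℕ) (x : Seq2) :
    inner ℂ (lowMode s) x = ∑' k : ℤ, (((wt k)⁻¹ ^ s * |(k : ℝ)|⁻¹ : ℝ) : ℂ) * x k := by
  rw [lp.inner_eq_tsum]
  refine tsum_congr fun k => ?_
  rw [lowMode_apply]
  simp [mul_comm]

lemma rankOne_comp_smoothing (σ : ℝ) (s : ℕ) :
    rankOne σ s ∘L smoothing = smoothing ∘L rankOne σ (s + 1) := by
  ext1 x
  have h : smoothing (inner ℂ (lowMode (s + 1)) x • cosSeq (s + 1))
      = inner ℂ (lowMode (s + 1)) x • cosSeq s := by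
    ext k
    have hk := congrArg (fun y : Seq2 => y k) (smoothing_cosSeq s)
    simp only [smoothing_apply] at hk
    simp only [smoothing_apply, lp.coeFn_smul, Pi.smul_apply, smul_eq_mul, ← hk]
    ring
  rw [ContinuousLinearMap.comp_apply, ContinuousLinearMap.comp_apply, rankOne_apply,
    rankOne_apply, map_smul, h, inner_lowMode, inner_lowMode]
  congr 3
  funext k
  rw [smoothing_apply]
  push_cast; ring

variable (σ : ℝ)

/-- Truncation of a weight to the modes `|k| ≤ N`. -/
noncomputable def trunc (N : ℕ) (c : ℤ → ℝ) (k : ℤ) : ℝ := if |(k : ℝ)| ≤ N then c k else 0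

/-- The truncated evolution operator in the coordinates of `H^s`. -/
noncomputable def galerkin (s N : ℕ) : Seq2 →L[ℝ] Seq2 :=
  wshift (fun k => (trunc N (coefUp σ s) k : ℂ)) (-2)
    + wshift (fun k => (trunc N (coefDown σ s) (k + 2) : ℂ)) 2 + rankOne σ s

/-- The evolution operator, from the coordinates of `H^(s+1)` to those of `H^s`. -/
noncomputable def evolOp (s : ℕ) : Seq2 →L[ℝ] Seq2 :=
  wshift (fun k => ((coefUp σ s k / wt (k - 2) : ℝ) : ℂ)) (-2)
    + wshift (fun k => ((coefDown σ s (k + 2) / wt (k + 2) : ℝ) : ℂ)) 2 + rankOne σ s ∘L smoothing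

variable {σ}

lemma abs_trunc_le {c : ℤ → ℝ} {B : ℝ} (hB : 0 ≤ B) (hc : ∀ k, |c k| ≤ B * wt k) (N : ℕ) (k : ℤ) :
    ‖(trunc N c k : ℂ)‖ ≤ B * (1 + N) := by
  rw [Complex.norm_real, Real.norm_eq_abs, trunc]
  split_ifs with h
  · refine (hc k).trans ?_
    unfold wt; gcongr
  · simp; positivity

lemma exists_bound_up (hσ : |σ| ≤ 1) (s N : ℕ) :
    ∃ B, ∀ k, ‖(trunc N (coefUp σ s) k : ℂ)‖ ≤ B :=
  ⟨_, fun k => abs_trunc_le (by positivity) (abs_coefUp_le hσ s) N k⟩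

lemma exists_bound_down (hσ : |σ| ≤ 1) (s N : ℕ) :
    ∃ B, ∀ k, ‖(trunc N (coefDown σ s) (k + 2) : ℂ)‖ ≤ B :=
  ⟨_, fun k => abs_trunc_le (by positivity) (abs_coefDown_le hσ s) N (k + 2)⟩

lemma abs_coefUp_div_le (hσ : |σ| ≤ 1) (s : ℕ) (k : ℤ) :
    |coefUp σ s k / wt (k - 2)| ≤ 3 ^ (s + 2) := by
  rw [abs_div, abs_of_pos (wt_pos _), div_le_iff₀ (wt_pos _)]
  calc _ ≤ 3 ^ (s + 1) * wt k := abs_coefUp_le hσ s k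
    _ ≤ 3 ^ (s + 1) * (3 * wt (k - 2)) := by gcongr; exact wt_le k
    _ = _ := by ring

lemma abs_coefDown_div_le (hσ : |σ| ≤ 1) (s : ℕ) (k : ℤ) :
    |coefDown σ s k / wt k| ≤ 3 ^ (s + 2) := by
  rw [abs_div, abs_of_pos (wt_pos _), div_le_iff₀ (wt_pos _)]
  have := wt_pos k
  calc _ ≤ 3 ^ (s + 1) * wt k := abs_coefDown_le hσ s k
    _ ≤ 3 ^ (s + 2) * wt k := by gcongr <;> norm_num

lemma norm_ofReal_le_iff {x B : ℝ} : ‖(x : ℂ)‖ ≤ B ↔ |x| ≤ B := by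
  rw [Complex.norm_real, Real.norm_eq_abs]

lemma evolOp_apply (hσ : |σ| ≤ 1) (s : ℕ) (x : Seq2) (k : ℤ) :
    evolOp σ s x k = ((coefUp σ s k / wt (k - 2) : ℝ) : ℂ) * x (k - 2)
      + ((coefDown σ s (k + 2) / wt (k + 2) : ℝ) : ℂ) * x (k + 2)
      + (σ : ℂ) * (inner ℂ (lowMode s) (smoothing x) * cosSeq s k) := by
  have h1 : ∃ B, ∀ k, ‖((coefUp σ s k / wt (k - 2) : ℝ) : ℂ)‖ ≤ B :=
    ⟨_, fun k => norm_ofReal_le_iff.2 (abs_coefUp_div_le hσ s k)⟩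
  have h2 : ∃ B, ∀ k, ‖((coefDown σ s (k + 2) / wt (k + 2) : ℝ) : ℂ)‖ ≤ B :=
    ⟨_, fun k => norm_ofReal_le_iff.2 (abs_coefDown_div_le hσ s (k + 2))⟩
  simp only [evolOp, add_apply, ContinuousLinearMap.comp_apply, lp.coeFn_add,
    Pi.add_apply, wshift_apply h1, wshift_apply h2, rankOne_apply, lp.coeFn_smul, Pi.smul_apply,
    Complex.real_smul, smul_eq_mul, ← sub_eq_add_neg]

/-- After taking one adjoint, both couplings become the same shift and only the sum of their weights
matters, which `exists_bound_coef_add` bounds. The rank-one part is bounded and independent of `N`.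
-/
lemma galerkin_inner_bound (hσ : |σ| ≤ 1) (s : ℕ) :
    ∃ C, 0 ≤ C ∧ ∀ N x, |inner ℝ (galerkin σ s N x) x| ≤ C * ‖x‖ ^ 2 := by
  obtain ⟨B, hB⟩ := exists_bound_coef_add hσ s
  have hB0 : 0 ≤ B := (abs_nonneg _).trans (hB 0)
  refine ⟨B + ‖rankOne σ s‖, by positivity, fun N x => ?_⟩
  have hb1 := exists_bound_up hσ s N
  obtain ⟨D, hD⟩ := exists_bound_down hσ s N
  have e1 : inner ℝ (wshift (fun k => (trunc N (coefDown σ s) (k + 2) : ℂ)) 2 x) x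
      = inner ℝ (wshift (fun k => (trunc N (coefDown σ s) k : ℂ)) (-2) x) x := by
    rw [inner_wshift (c := fun k => trunc N (coefDown σ s) (k + 2)) ⟨D, hD⟩, real_inner_comm]
    simp only [sub_add_cancel]
  have hb2 : ∃ B, ∀ k, ‖(trunc N (coefDown σ s) k : ℂ)‖ ≤ B :=
    ⟨D, fun k => by simpa using hD (k - 2)⟩
  have hb3 : ∀ k, ‖((trunc N (coefUp σ s) k + trunc N (coefDown σ s) k : ℝ) : ℂ)‖ ≤ B := by
    intro k
    rw [norm_ofReal_le_iff]
    unfold trunc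
    split_ifs
    · exact hB k
    · simpa using hB0
  -- Both couplings of the pair `(k - 2, k)` are cut off by the same condition on `k`; truncation
  -- therefore preserves the cancellation.
  have e2 : wshift (fun k => (trunc N (coefUp σ s) k : ℂ)) (-2) x
      + wshift (fun k => (trunc N (coefDown σ s) k : ℂ)) (-2) x
      = wshift (fun k => ((trunc N (coefUp σ s) k + trunc N (coefDown σ s) k : ℝ) : ℂ)) (-2) x := by
    ext k
    rw [lp.coeFn_add, Pi.add_apply, wshift_apply hb1, wshift_apply hb2, wshift_apply ⟨B, hb3⟩]
    push_cast; ring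
  have e3 : inner ℝ (galerkin σ s N x) x = inner ℝ (wshift (fun k =>
      ((trunc N (coefUp σ s) k + trunc N (coefDown σ s) k : ℝ) : ℂ)) (-2) x) x
      + inner ℝ (rankOne σ s x) x := by
    rw [← e2, inner_add_left, ← e1]
    simp only [galerkin, add_apply, inner_add_left]
  rw [e3]
  refine (abs_add_le _ _).trans ?_
  have h1 := (abs_real_inner_le_norm (wshift (fun k =>
      ((trunc N (coefUp σ s) k + trunc N (coefDown σ s) k : ℝ) : ℂ)) (-2) x) x).trans
      (mul_le_mul_of_nonneg_right (norm_wshift_apply_le hb3 (-2) x) (norm_nonneg x))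
  have h2 := (abs_real_inner_le_norm (rankOne σ s x) x).trans
      (mul_le_mul_of_nonneg_right ((rankOne σ s).le_opNorm x) (norm_nonneg x))
  calc _ ≤ B * ‖x‖ * ‖x‖ + ‖rankOne σ s‖ * ‖x‖ * ‖x‖ := add_le_add h1 h2
    _ = _ := by ring

lemma galerkin_apply (hσ : |σ| ≤ 1) (s N : ℕ) (x : Seq2) (k : ℤ) :
    galerkin σ s N x k = (trunc N (coefUp σ s) k : ℂ) * x (k - 2)
      + (trunc N (coefDown σ s) (k + 2) : ℂ) * x (k + 2) + rankOne σ s x k := by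
  simp only [galerkin, add_apply, lp.coeFn_add, Pi.add_apply,
    wshift_apply (exists_bound_up hσ s N), wshift_apply (exists_bound_down hσ s N),
    ← sub_eq_add_neg]

/-- The cutoff does not depend on `s`, and the weight ratios in the coefficients are exactly those
produced by conjugation with the smoothing, so no commutator error appears. -/
lemma galerkin_comp_smoothing (hσ : |σ| ≤ 1) (s N : ℕ) :
    galerkin σ s N ∘L smoothing = smoothing ∘L galerkin σ (s + 1) N := by
  ext x k
  have hr : rankOne σ s (smoothing x) k = (((wt k)⁻¹ : ℝ) : ℂ) * rankOne σ (s + 1) x k := by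
    rw [← smoothing_apply]
    exact congrArg (fun y : Seq2 => y k)
      (DFunLike.congr_fun (rankOne_comp_smoothing σ s) x)
  rw [ContinuousLinearMap.comp_apply, ContinuousLinearMap.comp_apply, galerkin_apply hσ,
    smoothing_apply, smoothing_apply, smoothing_apply, galerkin_apply hσ, hr]
  have h1 : trunc N (coefUp σ s) k * (wt (k - 2))⁻¹
      = (wt k)⁻¹ * trunc N (coefUp σ (s + 1)) k := by
    unfold trunc
    split_ifs
    · rw [coefUp_succ]
      have := (wt_pos k).ne'
      field_simp
    · simp
  have h2 : trunc N (coefDown σ s) (k + 2) * (wt (k + 2))⁻¹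
      = (wt k)⁻¹ * trunc N (coefDown σ (s + 1)) (k + 2) := by
    unfold trunc
    split_ifs
    · rw [coefDown_succ, add_sub_cancel_right]
      have := (wt_pos k).ne'
      field_simp
    · simp
  rw [mul_add, mul_add, ← mul_assoc, ← mul_assoc, ← mul_assoc, ← mul_assoc]
  congr 2
  · congr 1; exact_mod_cast h1
  · congr 1; exact_mod_cast h2

/-- The generator has order one: a single division by the weight absorbs the linear growth of the
coefficients, uniformly in the cutoff. -/
lemma norm_galerkin_comp_smoothing_le (hσ : |σ| ≤ 1) (s : ℕ) :
    ∃ B, ∀ N, ‖galerkin σ s N ∘L smoothing‖ ≤ B := by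
  refine ⟨3 ^ (s + 2) + 3 ^ (s + 2) + ‖rankOne σ s ∘L smoothing‖, fun N => ?_⟩
  have h1 : ∀ k : ℤ, ‖((trunc N (coefUp σ s) k / wt (k - 2) : ℝ) : ℂ)‖ ≤ 3 ^ (s + 2) := by
    intro k
    rw [norm_ofReal_le_iff, trunc]
    split_ifs
    · exact abs_coefUp_div_le hσ s k
    · simp
  have h2 : ∀ k : ℤ, ‖((trunc N (coefDown σ s) (k + 2) / wt (k + 2) : ℝ) : ℂ)‖
      ≤ 3 ^ (s + 2) := by
    intro k
    rw [norm_ofReal_le_iff, trunc]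
    split_ifs
    · exact abs_coefDown_div_le hσ s (k + 2)
    · simp
  have e : galerkin σ s N ∘L smoothing
      = wshift (fun k => ((trunc N (coefUp σ s) k / wt (k - 2) : ℝ) : ℂ)) (-2)
        + wshift (fun k => ((trunc N (coefDown σ s) (k + 2) / wt (k + 2) : ℝ) : ℂ)) 2
        + rankOne σ s ∘L smoothing := by
    ext x k
    simp only [ContinuousLinearMap.comp_apply, add_apply, lp.coeFn_add,
      Pi.add_apply, galerkin_apply hσ, wshift_apply ⟨_, h1⟩, wshift_apply ⟨_, h2⟩,
      smoothing_apply, ← sub_eq_add_neg]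
    push_cast; ring
  rw [e]
  exact (norm_add₃_le).trans (add_le_add (add_le_add (norm_wshift_le h1 _)
    (norm_wshift_le h2 _)) le_rfl)

/-- One smoothing bounds the generator; the second gains a factor `O(1/N)` on the discarded
couplings, hence convergence in operator norm. The rank-one part cancels in the difference. -/
lemma tendsto_galerkin (hσ : |σ| ≤ 1) (s : ℕ) :
    Tendsto (fun N => galerkin σ s N ∘L smoothing ∘L smoothing) atTop
      (𝓝 (evolOp σ s ∘L smoothing)) := by
  rw [tendsto_iff_norm_sub_tendsto_zero]
  have hlim : Tendsto (fun N : ℕ => 2 * 3 ^ (s + 3) * ((N : ℝ) + 1)⁻¹) atTop (𝓝 0) := by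
    have := (tendsto_one_div_add_atTop_nhds_zero_nat (𝕜 := ℝ)).const_mul (2 * 3 ^ (s + 3))
    simpa using this
  refine squeeze_zero (fun _ => norm_nonneg _) (fun N => ?_) hlim
  have hN : (0 : ℝ) < N + 1 := by positivity
  have key : ∀ k : ℤ, ¬ |(k : ℝ)| ≤ N → (N : ℝ) + 1 ≤ wt k := by
    intro k hk
    unfold wt; linarith
  have h1 : ∀ k : ℤ, ‖(((trunc N (coefUp σ s) k - coefUp σ s k) / wt (k - 2) * (wt (k - 2))⁻¹ : ℝ)
      : ℂ)‖ ≤ 3 ^ (s + 3) * ((N : ℝ) + 1)⁻¹ := by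
    intro k
    rw [norm_ofReal_le_iff, trunc]
    split_ifs with h
    · simp; positivity
    · rw [abs_mul, zero_sub, neg_div, abs_neg, abs_of_pos (inv_pos.2 (wt_pos (k - 2)))]
      have h3 : (wt (k - 2))⁻¹ ≤ 3 * (wt k)⁻¹ := by
        rw [← div_eq_mul_inv, inv_eq_one_div, div_le_div_iff₀ (wt_pos _) (wt_pos _)]
        linarith [wt_le k]
      calc _ ≤ 3 ^ (s + 2) * (3 * ((N : ℝ) + 1)⁻¹) := by
            gcongr
            · exact (inv_pos.2 (wt_pos (k - 2))).le
            · exact abs_coefUp_div_le hσ s k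
            · exact h3.trans (by gcongr; exact key k h)
        _ = _ := by ring
  have h2 : ∀ k : ℤ, ‖(((trunc N (coefDown σ s) (k + 2) - coefDown σ s (k + 2)) / wt (k + 2)
      * (wt (k + 2))⁻¹ : ℝ) : ℂ)‖ ≤ 3 ^ (s + 3) * ((N : ℝ) + 1)⁻¹ := by
    intro k
    rw [norm_ofReal_le_iff, trunc]
    split_ifs with h
    · simp; positivity
    · rw [abs_mul, zero_sub, neg_div, abs_neg, abs_of_pos (inv_pos.2 (wt_pos (k + 2)))]
      calc _ ≤ 3 ^ (s + 2) * (((N : ℝ) + 1)⁻¹) := by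
            gcongr
            · exact (inv_pos.2 (wt_pos (k + 2))).le
            · exact abs_coefDown_div_le hσ s (k + 2)
            · exact key (k + 2) h
        _ ≤ _ := by gcongr <;> norm_num
  have e : galerkin σ s N ∘L smoothing ∘L smoothing - evolOp σ s ∘L smoothing
      = wshift (fun k => (((trunc N (coefUp σ s) k - coefUp σ s k) / wt (k - 2)
          * (wt (k - 2))⁻¹ : ℝ) : ℂ)) (-2)
        + wshift (fun k => (((trunc N (coefDown σ s) (k + 2) - coefDown σ s (k + 2)) / wt (k + 2)
      * (wt (k + 2))⁻¹ : ℝ) : ℂ)) 2 := by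
    ext x k
    simp only [ContinuousLinearMap.comp_apply, add_apply, lp.coeFn_add,
      sub_apply, lp.coeFn_sub, Pi.sub_apply,
      Pi.add_apply, galerkin_apply hσ, evolOp_apply hσ, wshift_apply ⟨_, h1⟩, wshift_apply ⟨_, h2⟩,
      smoothing_apply, ← sub_eq_add_neg, rankOne_apply, lp.coeFn_smul, Pi.smul_apply,
      Complex.real_smul, smul_eq_mul]
    push_cast; ring
  rw [e]
  refine (norm_add_le _ _).trans ?_
  calc _ ≤ _ := add_le_add (norm_wshift_le h1 _) (norm_wshift_le h2 _)
    _ = _ := by ring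

/-- The flow of the linearized equation on sequences of Fourier coefficients. -/
theorem exists_fourier_flow (hσ : |σ| ≤ 1) :
    (∀ s, evolOp σ s ∘L smoothing = smoothing ∘L evolOp σ (s + 1)) ∧
    ∃ U : ℕ → ℝ → Seq2 → Seq2, (∀ s x, U s 0 x = x) ∧ (∀ s x, Continuous fun t => U s t x) ∧
      (∀ s t x, U s t (smoothing x) = smoothing (U (s + 1) t x)) ∧
      ∀ s t x, HasDerivAt (fun t => smoothing (U (s + 1) t x)) (evolOp σ s (U (s + 1) t x)) t :=
  exists_flow smoothing denseRange_smoothing (galerkin σ) (evolOp σ)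
    (galerkin_inner_bound hσ) (galerkin_comp_smoothing hσ)
    (norm_galerkin_comp_smoothing_le hσ) (tendsto_galerkin hσ)

end Operators

/-! ### Fourier analysis on the torus -/

section FourierBasis

/-- The exponential `x ↦ exp (i k x)`. -/
noncomputable def ek (k : ℤ) (x : ℝ) : ℂ := Complex.exp ((k * x : ℝ) * Complex.I)

lemma norm_ek (k : ℤ) (x : ℝ) : ‖ek k x‖ = 1 := Complex.norm_exp_ofReal_mul_I _

@[fun_prop]
lemma continuous_ek (k : ℤ) : Continuous (ek k) := by unfold ek; fun_prop

lemma ek_eq (k : ℤ) (x : ℝ) : ek k x = (Real.cos (k * x) : ℂ) + (Real.sin (k * x) : ℂ) * Complex.I := by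
  rw [ek, Complex.exp_mul_I, Complex.ofReal_cos, Complex.ofReal_sin]

lemma ek_zero (x : ℝ) : ek 0 x = 1 := by simp [ek]

lemma ek_mul (j k : ℤ) (x : ℝ) : ek j x * ek k x = ek (j + k) x := by
  unfold ek; rw [← Complex.exp_add]; push_cast; ring_nf

lemma ek_add (k : ℤ) (x y : ℝ) : ek k (x + y) = ek k x * ek k y := by
  unfold ek; rw [← Complex.exp_add]; push_cast; ring_nf

lemma conj_ek (k : ℤ) (x : ℝ) : (starRingEnd ℂ) (ek k x) = ek (-k) x := by
  simp [ek, ← Complex.exp_conj]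

lemma ek_periodic (k : ℤ) : Function.Periodic (ek k) (2 * π) := by
  intro x
  unfold ek
  rw [Complex.exp_eq_exp_iff_exists_int]
  exact ⟨k, by push_cast; ring⟩

lemma hasDerivAt_ek (k : ℤ) (x : ℝ) : HasDerivAt (ek k) (Complex.I * k * ek k x) x := by
  have h : HasDerivAt (fun x : ℝ => ((k * x : ℝ) : ℂ) * Complex.I) (k * Complex.I) x := by
    have := ((hasDerivAt_id x).const_mul (k : ℝ)).ofReal_comp.mul_const Complex.I
    simpa using this
  exact h.cexp.congr_deriv (by unfold ek; ring)

lemma neg_pi_lt_pi : -π < π := by linarith [Real.pi_pos]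

lemma integral_torus_eq {F : Type*} [NormedAddCommGroup F] [NormedSpace ℝ F] (f : ℝ → F) :
    ∫ x, f x ∂torusMeasure = ∫ x in (-π)..π, f x :=
  (intervalIntegral.integral_of_le neg_pi_lt_pi.le).symm

lemma integral_ek (k : ℤ) : ∫ x in (-π)..π, ek k x = if k = 0 then (2 * π : ℂ) else 0 := by
  split_ifs with hk
  · subst hk; simp [ek_zero]; norm_cast; ring
  · have hc : Complex.I * (k : ℂ) ≠ 0 := by simp [hk]
    have h : ∀ x ∈ uIcc (-π) π, HasDerivAt (fun x => (Complex.I * k)⁻¹ * ek k x) (ek k x) x := by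
      intro x _
      have := (hasDerivAt_ek k x).const_mul (Complex.I * (k : ℂ))⁻¹
      rwa [← mul_assoc, inv_mul_cancel₀ hc, one_mul] at this
    rw [intervalIntegral.integral_eq_sub_of_hasDerivAt h
      ((continuous_ek k).intervalIntegrable _ _)]
    have : ek k π = ek k (-π) := by
      have := ek_periodic k (-π)
      rwa [show -π + 2 * π = π by ring] at this
    rw [this, sub_self]

/-- Unnormalized Fourier coefficient of a `2π`-periodic function. -/
noncomputable def fc (f : ℝ → ℂ) (k : ℤ) : ℂ := ∫ x in (-π)..π, ek (-k) x * f x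

lemma fourierCoeffOn_eq_fc (f : ℝ → ℂ) (k : ℤ) :
    fourierCoeffOn neg_pi_lt_pi f k = (1 / (2 * π) : ℝ) • fc f k := by
  rw [fourierCoeffOn_eq_integral, fc]
  congr 1
  · ring
  · refine intervalIntegral.integral_congr fun x _ => ?_
    simp only [fourier_coe_apply, smul_eq_mul, ek]
    congr 2
    have : (π : ℂ) ≠ 0 := by exact_mod_cast Real.pi_ne_zero
    push_cast
    field_simp
    ring

/-- Parseval's identity for the unnormalized coefficients. -/
lemma hasSum_sq_fc {f : ℝ → ℂ} (hf : MemLp f 2 torusMeasure) :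
    HasSum (fun k => ‖fc f k‖ ^ 2) (2 * π * ∫ x in (-π)..π, ‖f x‖ ^ 2) := by
  have h := (hasSum_sq_fourierCoeffOn neg_pi_lt_pi hf).mul_left ((2 * π) ^ 2)
  have hpi := Real.pi_pos
  have e1 : (fun k => ‖fc f k‖ ^ 2)
      = fun k => (2 * π) ^ 2 * ‖fourierCoeffOn neg_pi_lt_pi f k‖ ^ 2 := by
    funext k
    rw [fourierCoeffOn_eq_fc, norm_smul, Real.norm_eq_abs, abs_of_pos (by positivity)]
    field_simp
  have e2 : 2 * π * ∫ x in (-π)..π, ‖f x‖ ^ 2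
      = (2 * π) ^ 2 * (π - -π)⁻¹ • ∫ x in (-π)..π, ‖f x‖ ^ 2 := by
    rw [smul_eq_mul, show π - -π = 2 * π by ring]
    field_simp
  rwa [e1, e2]

lemma fc_deriv {f f' : ℝ → ℂ} (hf : ∀ x, HasDerivAt f (f' x) x)
    (hf' : IntervalIntegrable f' volume (-π) π) (hp : f π = f (-π)) (k : ℤ) :
    fc f' k = Complex.I * k * fc f k := by
  unfold fc
  have h := intervalIntegral.integral_mul_deriv_eq_deriv_mul (a := -π) (b := π)
    (fun x _ => hasDerivAt_ek (-k) x) (fun x _ => hf x)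
    ((by fun_prop : Continuous fun x => Complex.I * ((-k : ℤ) : ℂ) * ek (-k) x).intervalIntegrable
      _ _) hf'
  have he : ek (-k) π = ek (-k) (-π) := by
    have := ek_periodic (-k) (-π)
    rwa [show -π + 2 * π = π by ring] at this
  rw [h, hp, he, sub_self, zero_sub, ← intervalIntegral.integral_neg,
    ← intervalIntegral.integral_const_mul]
  refine intervalIntegral.integral_congr fun x _ => ?_
  push_cast; ring

/-- The normalization `1 / √(2π)`. -/
noncomputable def nrm : ℝ := (Real.sqrt (2 * π))⁻¹

lemma nrm_sq : nrm ^ 2 = (2 * π)⁻¹ := by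
  rw [nrm, inv_pow, Real.sq_sqrt (by positivity)]

lemma memLp_of_continuous {f : ℝ → ℂ} (hf : Continuous f) : MemLp f 2 torusMeasure := by
  obtain ⟨C, hC⟩ := (isCompact_Icc (a := -π) (b := π)).exists_bound_of_continuousOn hf.continuousOn
  refine MemLp.of_bound hf.aestronglyMeasurable C ?_
  filter_upwards [ae_restrict_mem measurableSet_Ioc] with x hx
  exact hC x (Ioc_subset_Icc_self hx)

/-- The normalized exponentials in `L²`. -/
noncomputable def expLp (k : ℤ) : Lp ℂ 2 torusMeasure :=
  (memLp_of_continuous (f := fun x => nrm * ek k x) (by fun_prop)).toLp _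

lemma inner_expLp (k : ℤ) (f : Lp ℂ 2 torusMeasure) :
    inner ℂ (expLp k) f = nrm * fc f k := by
  rw [L2.inner_def, fc, ← intervalIntegral.integral_const_mul, ← integral_torus_eq]
  refine integral_congr_ae ?_
  filter_upwards [(memLp_of_continuous (f := fun x => nrm * ek k x) (by fun_prop)).coeFn_toLp]
    with x hx
  rw [expLp, hx]
  simp only [RCLike.inner_apply, map_mul, Complex.conj_ofReal, conj_ek]
  ring

lemma fc_congr_ae {f g : ℝ → ℂ} (h : f =ᵐ[torusMeasure] g) (k : ℤ) : fc f k = fc g k := by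
  rw [fc, fc, ← integral_torus_eq, ← integral_torus_eq]
  refine integral_congr_ae ?_
  filter_upwards [h] with x hx
  rw [hx]

lemma fc_ek (j k : ℤ) : fc (ek j) k = if j = k then (2 * π : ℂ) else 0 := by
  rw [fc]
  simp only [ek_mul, integral_ek]
  congr 1
  rw [neg_add_eq_zero]
  exact propext eq_comm

lemma fc_const_mul (c : ℂ) (f : ℝ → ℂ) (k : ℤ) : fc (fun x => c * f x) k = c * fc f k := by
  rw [fc, fc, ← intervalIntegral.integral_const_mul]
  refine intervalIntegral.integral_congr fun x _ => ?_
  ring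

lemma orthonormal_expLp : Orthonormal ℂ expLp := by
  rw [orthonormal_iff_ite]
  intro i j
  rw [inner_expLp, expLp, fc_congr_ae (memLp_of_continuous
    (f := fun x => nrm * ek j x) (by fun_prop)).coeFn_toLp, fc_const_mul, fc_ek]
  by_cases h : i = j
  · subst h
    simp only [if_true]
    have h1 := nrm_sq
    have h2 : nrm * (nrm * (2 * π)) = 1 := by
      rw [← mul_assoc, ← sq, h1]
      have := Real.pi_pos
      field_simp
    exact_mod_cast h2
  · rw [if_neg (Ne.symm h), if_neg h]; simp

lemma eq_zero_of_fc_eq_zero {f : ℝ → ℂ} (hf : MemLp f 2 torusMeasure) (h : ∀ k, fc f k = 0) :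
    f =ᵐ[torusMeasure] 0 := by
  have h1 := hasSum_sq_fc hf
  simp only [h, norm_zero, ne_eq, OfNat.ofNat_ne_zero, not_false_eq_true, zero_pow] at h1
  have h2 := h1.unique hasSum_zero
  have h3 : ∫ x, ‖f x‖ ^ 2 ∂torusMeasure = 0 := by
    rw [integral_torus_eq]
    have := Real.pi_pos
    rcases mul_eq_zero.1 h2 with h | h
    · linarith
    · exact h
  rw [integral_eq_zero_iff_of_nonneg (fun x => by positivity)
    ((memLp_two_iff_integrable_sq_norm hf.1).1 hf)] at h3
  filter_upwards [h3] with x hx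
  simpa using hx

/-- The Fourier basis of `L²(-π, π)`. -/
noncomputable def torusBasis : HilbertBasis ℤ ℂ (Lp ℂ 2 torusMeasure) :=
  HilbertBasis.mkOfOrthogonalEqBot orthonormal_expLp (by
    rw [Submodule.eq_bot_iff]
    intro f hf
    rw [Submodule.mem_orthogonal] at hf
    have h : ∀ k, fc f k = 0 := by
      intro k
      have := hf (expLp k) (Submodule.subset_span ⟨k, rfl⟩)
      rw [inner_expLp] at this
      have hn : (nrm : ℂ) ≠ 0 := by
        have : nrm ≠ 0 := by unfold nrm; positivity
        exact_mod_cast this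
      exact (mul_eq_zero.1 this).resolve_left hn
    exact (Lp.eq_zero_iff_ae_eq_zero).2 (eq_zero_of_fc_eq_zero (Lp.memLp f) h))

lemma torusBasis_repr (f : Lp ℂ 2 torusMeasure) (k : ℤ) :
    torusBasis.repr f k = nrm * fc f k := by
  rw [HilbertBasis.repr_apply_apply, ← inner_expLp]
  congr 1
  exact congrFun (HilbertBasis.coe_mkOfOrthogonalEqBot _ _) k

/-- The real function with given Fourier coefficients. -/
noncomputable def synth : Seq2 →L[ℝ] L2 :=
  (ContinuousLinearMap.compLpL 2 torusMeasure Complex.reCLM) ∘L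
    ((torusBasis.repr.symm.toContinuousLinearEquiv : Seq2 →L[ℂ] Lp ℂ 2 torusMeasure).restrictScalars
      ℝ)

/-- The Fourier coefficients of a real function. -/
noncomputable def ana (f : L2) : Seq2 :=
  torusBasis.repr (ContinuousLinearMap.compLpL 2 torusMeasure Complex.ofRealCLM f)

lemma synth_ae (c : Seq2) :
    synth c =ᵐ[torusMeasure] fun x => (torusBasis.repr.symm c x).re :=
  ContinuousLinearMap.coeFn_compLpL (μ := torusMeasure) Complex.reCLM (torusBasis.repr.symm c)

lemma ana_apply (f : L2) (k : ℤ) : ana f k = nrm * fc (fun x => (f x : ℂ)) k := by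
  rw [ana, torusBasis_repr]
  congr 1
  exact fc_congr_ae (ContinuousLinearMap.coeFn_compLpL Complex.ofRealCLM f) k

lemma synth_ana (f : L2) : synth (ana f) = f := by
  apply Lp.ext
  refine (synth_ae _).trans ?_
  rw [ana, LinearIsometryEquiv.symm_apply_apply]
  filter_upwards [ContinuousLinearMap.coeFn_compLpL (μ := torusMeasure) Complex.ofRealCLM f]
    with x hx
  rw [hx]; simp

lemma integral_synth_mul (c : Seq2) (g : L2) :
    ∫ x, synth c x * g x ∂torusMeasure = (inner ℂ (ana g) c).re := by
  have h : inner ℂ (ana g) c = inner ℂ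
      (ContinuousLinearMap.compLpL 2 torusMeasure Complex.ofRealCLM g) (torusBasis.repr.symm c) := by
    rw [ana, LinearIsometryEquiv.inner_map_eq_flip]
  rw [h, L2.inner_def]
  have hi := L2.integrable_inner (𝕜 := ℂ)
    (ContinuousLinearMap.compLpL 2 torusMeasure Complex.ofRealCLM g) (torusBasis.repr.symm c)
  have := integral_re hi
  simp only [RCLike.re_to_complex] at this
  rw [← this]
  refine integral_congr_ae ?_
  filter_upwards [ContinuousLinearMap.coeFn_compLpL (μ := torusMeasure) Complex.ofRealCLM g,
    synth_ae c] with x hx hx'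
  rw [hx, hx']
  simp

/-- By Parseval both pairings become sums over modes, and the derivative of the periodic test
function is the multiplier `ik`. No symmetry of `c` is needed, because pairing with a real function
commutes with real parts. -/
lemma hasWeakDeriv_synth {c c' : Seq2} (h : ∀ k : ℤ, c' k = Complex.I * k * c k) :
    HasWeakDeriv (synth c) (synth c') := by
  intro φ hφ hper
  have hd : Continuous (deriv φ) := hφ.continuous_deriv (by simp)
  have hm : ∀ {ψ : ℝ → ℝ}, Continuous ψ → MemLp ψ 2 torusMeasure := by
    intro ψ hψ
    simpa using (memLp_of_continuous (f := fun x => (ψ x : ℂ)) (by fun_prop)).re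
  have e : ∀ (c : Seq2) {ψ : ℝ → ℝ} (hψ : Continuous ψ),
      ∫ x, synth c x * ψ x ∂torusMeasure = (inner ℂ (ana ((hm hψ).toLp ψ)) c).re := by
    intro c ψ hψ
    rw [← integral_synth_mul]
    refine integral_congr_ae ?_
    filter_upwards [(hm hψ).coeFn_toLp] with x hx
    rw [hx]
  rw [e c hd, e c' hφ.continuous, ← Complex.neg_re]
  congr 1
  rw [lp.inner_eq_tsum, lp.inner_eq_tsum, ← tsum_neg]
  refine tsum_congr fun k => ?_
  have hk : ana ((hm hd).toLp (deriv φ)) k = Complex.I * k * ana ((hm hφ.continuous).toLp φ) k := by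
    have a1 : ∀ {ψ : ℝ → ℝ} (hψ : Continuous ψ),
        ana ((hm hψ).toLp ψ) k = nrm * fc (fun x => (ψ x : ℂ)) k := by
      intro ψ hψ
      rw [ana_apply]
      congr 1
      apply fc_congr_ae
      filter_upwards [(hm hψ).coeFn_toLp] with x hx
      rw [hx]
    have hφc : Continuous φ := hφ.continuous
    rw [a1 hd, a1 hφc, fc_deriv (f := fun x => (φ x : ℂ))
      (fun x => ((hφ.differentiable (by simp)) x).hasDerivAt.ofReal_comp)
      ((by fun_prop : Continuous fun x => ((deriv φ x : ℝ) : ℂ)).intervalIntegrable _ _)]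
    · ring
    · have := hper (-π)
      rw [show -π + 2 * π = π by ring] at this
      simp [this]
  rw [hk, h]
  simp only [RCLike.inner_apply, map_mul, Complex.conj_I, map_intCast]
  ring

/-- Test the weak derivative against `cos(kx)` and `sin(kx)`, the real and imaginary parts of the
exponentials. -/
lemma ana_of_hasWeakDeriv {F G : L2} (h : HasWeakDeriv F G) (k : ℤ) :
    ana G k = Complex.I * k * ana F k := by
  have key : ∀ H : L2, fc (fun x => (H x : ℂ)) k
      = ((∫ x, H x * Real.cos (k * x) ∂torusMeasure : ℝ) : ℂ)
        - ((∫ x, H x * Real.sin (k * x) ∂torusMeasure : ℝ) : ℂ) * Complex.I := by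
    intro H
    rw [fc, ← integral_torus_eq, ← integral_complex_ofReal, ← integral_complex_ofReal,
      ← integral_mul_const, ← integral_sub]
    · refine integral_congr_ae (Eventually.of_forall fun x => ?_)
      simp only [ek_eq]
      push_cast
      rw [neg_mul, Complex.cos_neg, Complex.sin_neg]
      ring
    · exact (integrable_L2_mul H (by fun_prop)).ofReal
    · exact (integrable_L2_mul H (by fun_prop)).ofReal.mul_const _
  have hc := h (fun x => Real.cos (k * x)) (by fun_prop) (fun x => by
    simp only; rw [mul_add, ← mul_assoc, mul_comm (k : ℝ) 2]
    have := Real.cos_add_int_mul_two_pi (k * x) k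
    rw [← this]; congr 1; ring)
  have hs := h (fun x => Real.sin (k * x)) (by fun_prop) (fun x => by
    simp only; rw [mul_add, ← mul_assoc, mul_comm (k : ℝ) 2]
    have := Real.sin_add_int_mul_two_pi (k * x) k
    rw [← this]; congr 1; ring)
  have dc : deriv (fun x : ℝ => Real.cos (k * x)) = fun x => -k * Real.sin (k * x) := by
    funext x
    have := ((hasDerivAt_id x).const_mul (k : ℝ)).cos.deriv
    simp only [id, mul_one] at this
    rw [this]; ring
  have ds : deriv (fun x : ℝ => Real.sin (k * x)) = fun x => k * Real.cos (k * x) := by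
    funext x
    have := ((hasDerivAt_id x).const_mul (k : ℝ)).sin.deriv
    simp only [id, mul_one] at this
    rw [this]; ring
  rw [dc] at hc
  rw [ds] at hs
  have hc' : ∫ x, G x * Real.cos (k * x) ∂torusMeasure
      = k * ∫ x, F x * Real.sin (k * x) ∂torusMeasure := by
    rw [← neg_eq_iff_eq_neg] at hc
    rw [← hc, ← integral_neg, ← integral_const_mul]
    refine integral_congr_ae (Eventually.of_forall fun x => ?_)
    ring
  have hs' : ∫ x, G x * Real.sin (k * x) ∂torusMeasure
      = -(k * ∫ x, F x * Real.cos (k * x) ∂torusMeasure) := by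
    rw [← neg_eq_iff_eq_neg] at hs
    rw [← hs, ← integral_const_mul]
    congr 1
    refine integral_congr_ae (Eventually.of_forall fun x => ?_)
    ring
  rw [ana_apply, ana_apply, key, key, hc', hs']
  push_cast
  linear_combination (nrm : ℂ) * k * (∫ x, F x * Real.sin (k * x) ∂torusMeasure : ℝ) * Complex.I_sq

end FourierBasis

/-! ### The periodic Hilbert transform and its Fourier multiplier -/

section HilbertTransform

lemma cot_half_nonneg {s : ℝ} (hs : s ∈ Ioc 0 π) : 0 ≤ Real.cot (s / 2) := by
  rw [Real.cot_eq_cos_div_sin]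
  have hs1 := hs.1
  have hs2 := hs.2
  exact div_nonneg (Real.cos_nonneg_of_neg_pi_div_two_le_of_le (by linarith) (by linarith))
    (Real.sin_nonneg_of_nonneg_of_le_pi (by linarith) (by linarith))

/-- This is `x < tan x` at `x = s/2`; at `s = π` the cotangent vanishes. -/
lemma cot_half_mul_le {s : ℝ} (hs : s ∈ Ioc 0 π) : Real.cot (s / 2) * s ≤ 2 := by
  obtain ⟨hs1, hs2⟩ := hs
  have hsin : 0 < Real.sin (s / 2) := Real.sin_pos_of_pos_of_lt_pi (by linarith) (by linarith)
  rw [Real.cot_eq_cos_div_sin]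
  rcases hs2.lt_or_eq with h | h
  · have hcos : 0 < Real.cos (s / 2) :=
      Real.cos_pos_of_mem_Ioo ⟨by linarith, by linarith⟩
    have ht := Real.lt_tan (x := s / 2) (by linarith) (by linarith)
    rw [Real.tan_eq_sin_div_cos, lt_div_iff₀ hcos] at ht
    rw [div_mul_eq_mul_div, div_le_iff₀ hsin]
    linarith
  · rw [h, Real.cos_pi_div_two]; simp

/-- The Hilbert transform as an absolutely convergent integral. -/
noncomputable def hilbert (f : ℝ → ℝ) (θ : ℝ) : ℝ :=
  (1 / (2 * π)) * ∫ s in (0 : ℝ)..π, Real.cot (s / 2) * (f (θ - s) - f (θ + s))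

variable {f : ℝ → ℝ} {C : ℝ}

/-- The increment of a Lipschitz function over a distance `2s` compensates the singularity `2/s` of
the cotangent; this makes the folded integral absolutely convergent. -/
lemma abs_hilbert_kernel_le (hf : ∀ x y, |f x - f y| ≤ C * |x - y|) (θ : ℝ) {s : ℝ}
    (hs : s ∈ Ioc 0 π) : |Real.cot (s / 2) * (f (θ - s) - f (θ + s))| ≤ 4 * C := by
  have hC : 0 ≤ C := by
    have := (abs_nonneg _).trans (hf 1 0)
    simpa using this
  rw [abs_mul, abs_of_nonneg (cot_half_nonneg hs)]
  have h1 := hf (θ - s) (θ + s)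
  rw [show θ - s - (θ + s) = -(2 * s) by ring, abs_neg, abs_of_pos (show 0 < 2 * s by linarith [hs.1])] at h1
  calc _ ≤ Real.cot (s / 2) * (C * (2 * s)) :=
        mul_le_mul_of_nonneg_left h1 (cot_half_nonneg hs)
    _ = 2 * C * (Real.cot (s / 2) * s) := by ring
    _ ≤ 2 * C * 2 := by gcongr; exact cot_half_mul_le hs
    _ = _ := by ring

lemma measurable_cot : Measurable Real.cot := by
  have : Real.cot = fun x => Real.cos x / Real.sin x := by
    funext x; exact Real.cot_eq_cos_div_sin x
  rw [this]
  exact Real.measurable_cos.div Real.measurable_sin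

lemma measurable_hilbert_kernel (hc : Continuous f) :
    Measurable (fun z : ℝ × ℝ => Real.cot (z.2 / 2) * (f (z.1 - z.2) - f (z.1 + z.2))) := by
  refine (measurable_cot.comp (by fun_prop)).mul (Continuous.measurable ?_)
  fun_prop

lemma intervalIntegrable_hilbert_kernel (hc : Continuous f)
    (hf : ∀ x y, |f x - f y| ≤ C * |x - y|) (θ : ℝ) :
    IntervalIntegrable (fun s => Real.cot (s / 2) * (f (θ - s) - f (θ + s))) volume 0 π := by
  rw [intervalIntegrable_iff_integrableOn_Ioc_of_le Real.pi_pos.le]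
  refine Measure.integrableOn_of_bounded (M := 4 * C) (by simp) ?_ ?_
  · exact ((measurable_hilbert_kernel hc).comp (measurable_const.prodMk
      measurable_id)).aestronglyMeasurable
  · filter_upwards [ae_restrict_mem measurableSet_Ioc] with s hs
    exact abs_hilbert_kernel_le hf θ hs

lemma hasHilbertTransformAt_hilbert (hc : Continuous f)
    (hf : ∀ x y, |f x - f y| ≤ C * |x - y|) (θ : ℝ) :
    HasHilbertTransformAt f (hilbert f θ) θ := by
  unfold HasHilbertTransformAt hilbert
  refine Tendsto.const_mul _ ?_
  set h : ℝ → ℝ := fun s => Real.cot (s / 2) * (f (θ - s) - f (θ + s)) with hh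
  -- Oddness of the cotangent folds the two sides of the singularity onto `(ε, π)`; the missing
  -- piece over `(0, ε)` is `O(ε)`.
  have e : ∀ ε ∈ Ioo (0 : ℝ) π, (∫ ϑ in (θ - π)..(θ - ε), Real.cot ((θ - ϑ) / 2) * f ϑ) +
        ∫ ϑ in (θ + ε)..(θ + π), Real.cot ((θ - ϑ) / 2) * f ϑ
        = (∫ s in (0 : ℝ)..π, h s) - ∫ s in (0 : ℝ)..ε, h s := by
    intro ε hε
    have hcot : ContinuousOn (fun s : ℝ => Real.cot (s / 2)) (uIcc ε π) := by
      rw [uIcc_of_le hε.2.le]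
      simp only [Real.cot_eq_cos_div_sin]
      refine ContinuousOn.div (by fun_prop) (by fun_prop) fun s hs => ?_
      exact (Real.sin_pos_of_pos_of_lt_pi (by linarith [hs.1, hε.1])
        (by linarith [hs.2, Real.pi_pos])).ne'
    have h1 := intervalIntegral.integral_comp_sub_left (a := ε) (b := π)
      (fun ϑ => Real.cot ((θ - ϑ) / 2) * f ϑ) θ
    have h2 := intervalIntegral.integral_comp_add_left (a := ε) (b := π)
      (fun ϑ => Real.cot ((θ - ϑ) / 2) * f ϑ) θ
    rw [← h1, ← h2, ← intervalIntegral.integral_add]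
    · have hi := intervalIntegrable_hilbert_kernel hc hf θ
      rw [intervalIntegral.integral_interval_sub_left hi
        (hi.mono_set (by rw [uIcc_of_le hε.1.le, uIcc_of_le Real.pi_pos.le]
                         exact Icc_subset_Icc_right hε.2.le))]
      refine intervalIntegral.integral_congr fun s _ => ?_
      show Real.cot ((θ - (θ - s)) / 2) * f (θ - s) + Real.cot ((θ - (θ + s)) / 2) * f (θ + s)
        = Real.cot (s / 2) * (f (θ - s) - f (θ + s))
      rw [show (θ - (θ - s)) / 2 = s / 2 by ring, show (θ - (θ + s)) / 2 = -(s / 2) by ring,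
        show Real.cot (-(s / 2)) = - Real.cot (s / 2) by
          rw [Real.cot_eq_cos_div_sin, Real.cot_eq_cos_div_sin, Real.cos_neg, Real.sin_neg, div_neg]]
      ring
    · refine ContinuousOn.intervalIntegrable ?_
      have : (fun s => Real.cot ((θ - (θ - s)) / 2) * f (θ - s))
          = fun s => Real.cot (s / 2) * f (θ - s) := by
        funext s; congr 2; ring
      rw [this]
      exact hcot.mul (by fun_prop)
    · refine ContinuousOn.intervalIntegrable ?_
      have : (fun s => Real.cot ((θ - (θ + s)) / 2) * f (θ + s))
          = fun s => -Real.cot (s / 2) * f (θ + s) := by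
        funext s
        rw [show (θ - (θ + s)) / 2 = -(s / 2) by ring,
        show Real.cot (-(s / 2)) = - Real.cot (s / 2) by
          rw [Real.cot_eq_cos_div_sin, Real.cot_eq_cos_div_sin, Real.cos_neg, Real.sin_neg, div_neg]]
      rw [this]
      exact hcot.neg.mul (by fun_prop)
  have hlim : Tendsto (fun ε => (∫ s in (0 : ℝ)..π, h s) - ∫ s in (0 : ℝ)..ε, h s) (𝓝[>] 0)
      (𝓝 ((∫ s in (0 : ℝ)..π, h s) - 0)) := by
    refine Tendsto.const_sub _ (squeeze_zero_norm' (a := fun ε => 4 * C * |ε - 0|) ?_ ?_)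
    · filter_upwards [Ioo_mem_nhdsGT Real.pi_pos] with ε hε
      refine intervalIntegral.norm_integral_le_of_norm_le_const fun s hs => ?_
      rw [uIoc_of_le hε.1.le] at hs
      exact abs_hilbert_kernel_le hf θ ⟨hs.1, hs.2.trans hε.2.le⟩
    · refine tendsto_nhdsWithin_of_tendsto_nhds ?_
      have : Continuous fun ε : ℝ => 4 * C * |ε - 0| := by fun_prop
      simpa using this.tendsto 0
  rw [sub_zero] at hlim
  refine hlim.congr' ?_
  filter_upwards [Ioo_mem_nhdsGT Real.pi_pos] with ε hε
  exact (e ε hε).symm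

lemma continuous_hilbert (hc : Continuous f) (hf : ∀ x y, |f x - f y| ≤ C * |x - y|) :
    Continuous (hilbert f) := by
  unfold hilbert
  refine continuous_const.mul ?_
  refine intervalIntegral.continuous_of_dominated_interval (bound := fun _ => 4 * C) ?_ ?_ ?_ ?_
  · intro θ
    exact ((measurable_hilbert_kernel hc).comp (measurable_const.prodMk
      measurable_id)).aestronglyMeasurable
  · intro θ
    refine Eventually.of_forall fun s hs => ?_
    rw [uIoc_of_le Real.pi_pos.le] at hs
    exact abs_hilbert_kernel_le hf θ hs
  · exact intervalIntegrable_const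
  · refine Eventually.of_forall fun s _ => ?_
    fun_prop

lemma integral_cot_mul_sin_nat (n : ℕ) :
    IntervalIntegrable (fun s => Real.cot (s / 2) * Real.sin ((n + 1 : ℕ) * s)) volume 0 π ∧
    ∫ s in (0 : ℝ)..π, Real.cot (s / 2) * Real.sin ((n + 1 : ℕ) * s) = π := by
  -- A telescoping identity: passing from `n` to `n + 1` adds cosines whose integrals over `(0, π)`
  -- vanish, except for the constant `cos 0`, which contributes `π` at the first step.
  have step : ∀ n : ℕ, ∀ s ∈ Ioc 0 π, Real.cot (s / 2) * Real.sin ((n + 1 : ℕ) * s)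
      = Real.cot (s / 2) * Real.sin (n * s) + (Real.cos ((n + 1 : ℕ) * s) + Real.cos (n * s)) := by
    intro n s hs
    have hsin : Real.sin (s / 2) ≠ 0 :=
      (Real.sin_pos_of_pos_of_lt_pi (by linarith [hs.1]) (by linarith [hs.2, hs.1])).ne'
    rw [Real.cot_eq_cos_div_sin]
    have e1 : ((n + 1 : ℕ) : ℝ) * s = (n * s + s / 2) + s / 2 := by push_cast; ring
    have e2 : (n : ℝ) * s = (n * s + s / 2) - s / 2 := by ring
    generalize (n : ℝ) * s + s / 2 = a at e1 e2
    rw [e1, e2, Real.sin_add, Real.sin_sub, Real.cos_add, Real.cos_sub]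
    field_simp
    ring
  have hcosint : ∀ n : ℕ, ∫ s in (0 : ℝ)..π, Real.cos ((n + 1 : ℕ) * s) = 0 := by
    intro n
    have hn : ((n + 1 : ℕ) : ℝ) ≠ 0 := by positivity
    rw [intervalIntegral.integral_comp_mul_left (fun x => Real.cos x) hn, integral_cos]
    rw [Real.sin_nat_mul_pi (n + 1)]
    simp
  have hci : ∀ n : ℕ, IntervalIntegrable (fun s => Real.cos ((n + 1 : ℕ) * s) + Real.cos (n * s))
      volume 0 π := fun n => Continuous.intervalIntegrable (by fun_prop) _ _
  induction n with
  | zero =>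
    have hi := hci 0
    have e : EqOn (fun s => Real.cos ((0 + 1 : ℕ) * s) + Real.cos ((0 : ℕ) * s))
        (fun s => Real.cot (s / 2) * Real.sin ((0 + 1 : ℕ) * s)) (uIoc 0 π) := by
      intro s hs
      rw [uIoc_of_le Real.pi_pos.le] at hs
      have := step 0 s hs
      simp only [this]
      simp
    refine ⟨hi.congr e, ?_⟩
    rw [← intervalIntegral.integral_congr_ae (Eventually.of_forall e),
      intervalIntegral.integral_add (Continuous.intervalIntegrable (by fun_prop) _ _)
        (Continuous.intervalIntegrable (by fun_prop) _ _), hcosint]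
    simp
  | succ n ih =>
    obtain ⟨ih1, ih2⟩ := ih
    have e : EqOn (fun s => Real.cot (s / 2) * Real.sin ((n + 1 : ℕ) * s)
          + (Real.cos ((n + 1 + 1 : ℕ) * s) + Real.cos ((n + 1 : ℕ) * s)))
        (fun s => Real.cot (s / 2) * Real.sin ((n + 1 + 1 : ℕ) * s)) (uIoc 0 π) := by
      intro s hs
      rw [uIoc_of_le Real.pi_pos.le] at hs
      exact (step (n + 1) s hs).symm
    refine ⟨(ih1.add (hci (n + 1))).congr e, ?_⟩
    rw [← intervalIntegral.integral_congr_ae (Eventually.of_forall e),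
      intervalIntegral.integral_add ih1 (hci (n + 1)), ih2,
      intervalIntegral.integral_add (Continuous.intervalIntegrable (by fun_prop) _ _)
        (Continuous.intervalIntegrable (by fun_prop) _ _), hcosint, hcosint]
    simp

lemma integral_cot_mul_sin (k : ℤ) :
    ∫ s in (0 : ℝ)..π, Real.cot (s / 2) * Real.sin (k * s) = π * k.sign := by
  rcases lt_trichotomy k 0 with hk | rfl | hk
  · obtain ⟨n, hn⟩ := Int.exists_eq_neg_ofNat hk.le
    obtain ⟨m, rfl⟩ : ∃ m, n = m + 1 := Nat.exists_eq_succ_of_ne_zero (by rintro rfl; simp at hn; omega)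
    have := (integral_cot_mul_sin_nat m).2
    rw [Int.sign_eq_neg_one_of_neg hk, hn]
    have e : ∀ s : ℝ, Real.cot (s / 2) * Real.sin (((-((m + 1 : ℕ) : ℤ) : ℤ) : ℝ) * s)
        = -(Real.cot (s / 2) * Real.sin ((m + 1 : ℕ) * s)) := by
      intro s
      rw [Int.cast_neg, Int.cast_natCast, neg_mul, Real.sin_neg]; ring
    simp only [e, intervalIntegral.integral_neg, this]
    simp
  · simp
  · obtain ⟨n, hn⟩ := Int.eq_ofNat_of_zero_le hk.le
    obtain ⟨m, rfl⟩ : ∃ m, n = m + 1 := Nat.exists_eq_succ_of_ne_zero (by rintro rfl; simp at hn; omega)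
    have := (integral_cot_mul_sin_nat m).2
    rw [Int.sign_eq_one_of_pos hk, hn]
    simpa using this

lemma integral_ek_mul_shift (hp : Function.Periodic f (2 * π)) (k : ℤ) (s : ℝ) :
    ∫ θ in (-π)..π, ek (-k) θ * f (θ + s) = ek k s * fc (fun x => (f x : ℂ)) k := by
  have hG : Function.Periodic (fun θ => ek (-k) θ * (f θ : ℂ)) (2 * π) := by
    intro θ
    simp only
    rw [ek_periodic (-k) θ, hp θ]
  have h1 : ∀ θ, ek (-k) θ * (f (θ + s) : ℂ) = ek k s * (ek (-k) (θ + s) * (f (θ + s) : ℂ)) := by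
    intro θ
    rw [ek_add, ← mul_assoc, ← mul_assoc, mul_comm (ek k s), mul_assoc (ek (-k) θ), ek_mul,
      add_neg_cancel, ek_zero, mul_one]
  simp only [h1]
  rw [intervalIntegral.integral_const_mul, fc,
    intervalIntegral.integral_comp_add_right (fun θ => ek (-k) θ * (f θ : ℂ))]
  congr 1
  have := hG.intervalIntegral_add_eq (-π + s) (-π)
  rwa [show -π + s + 2 * π = π + s by ring, show -π + 2 * π = π by ring] at this

/-- Fubini applies because the folded kernel is bounded. The inner integral is the coefficient of a
difference of translates, `-2i sin(ks)` times that of `f`, and the remaining integral is `π sgn k`.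
-/
lemma fc_hilbert (hc : Continuous f) (hf : ∀ x y, |f x - f y| ≤ C * |x - y|)
    (hp : Function.Periodic f (2 * π)) (k : ℤ) :
    fc (fun x => (hilbert f x : ℂ)) k = -Complex.I * k.sign * fc (fun x => (f x : ℂ)) k := by
  have hpi : (π : ℂ) ≠ 0 := by exact_mod_cast Real.pi_ne_zero
  set G : ℝ → ℝ → ℂ := fun θ s =>
    ek (-k) θ * ((Real.cot (s / 2) * (f (θ - s) - f (θ + s)) : ℝ) : ℂ) with hG
  have hint : Integrable (Function.uncurry G)
      ((volume.restrict (Ioc (-π) π)).prod (volume.restrict (Ioc 0 π))) := by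
    refine Integrable.of_bound (C := 4 * C) ?_ ?_
    · refine Measurable.aestronglyMeasurable ?_
      exact ((continuous_ek (-k)).measurable.comp measurable_fst).mul
        (Complex.measurable_ofReal.comp (measurable_hilbert_kernel hc))
    · rw [Measure.prod_restrict]
      filter_upwards [ae_restrict_mem (measurableSet_Ioc.prod measurableSet_Ioc)] with z hz
      simp only [Function.uncurry, hG]
      rw [norm_mul, norm_ek, one_mul, Complex.norm_real]
      exact abs_hilbert_kernel_le hf z.1 hz.2
  have e1 : fc (fun x => (hilbert f x : ℂ)) k
      = (1 / (2 * π) : ℂ) * ∫ θ in (-π)..π, ∫ s in (0 : ℝ)..π, G θ s := by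
    rw [fc, ← intervalIntegral.integral_const_mul]
    refine intervalIntegral.integral_congr fun θ _ => ?_
    simp only [hG, hilbert, intervalIntegral.integral_const_mul, intervalIntegral.integral_ofReal]
    push_cast
    ring
  have e2 : ∫ θ in (-π)..π, ∫ s in (0 : ℝ)..π, G θ s
      = ∫ s in (0 : ℝ)..π, ∫ θ in (-π)..π, G θ s := by
    simp only [intervalIntegral.integral_of_le neg_pi_lt_pi.le,
      intervalIntegral.integral_of_le Real.pi_pos.le]
    exact integral_integral_swap hint
  have e3 : ∀ s : ℝ, ∫ θ in (-π)..π, G θ s = (-2 * Complex.I * fc (fun x => (f x : ℂ)) k)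
      * ((Real.cot (s / 2) * Real.sin (k * s) : ℝ) : ℂ) := by
    intro s
    have i1 : ∀ r : ℝ, IntervalIntegrable (fun θ => ek (-k) θ * (f (θ + r) : ℂ)) volume (-π) π :=
      fun r => Continuous.intervalIntegrable (by fun_prop) _ _
    have h1 : ∀ θ, G θ s = (Real.cot (s / 2) : ℂ) * (ek (-k) θ * (f (θ + -s) : ℂ)
        - ek (-k) θ * (f (θ + s) : ℂ)) := by
      intro θ
      simp only [hG, sub_eq_add_neg]
      push_cast; ring
    simp only [h1]
    rw [intervalIntegral.integral_const_mul, intervalIntegral.integral_sub (i1 _) (i1 _),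
      integral_ek_mul_shift hp, integral_ek_mul_shift hp, ek_eq, ek_eq, mul_neg, Real.cos_neg,
      Real.sin_neg]
    push_cast; ring
  rw [e1, e2]
  simp only [e3]
  rw [intervalIntegral.integral_const_mul, intervalIntegral.integral_ofReal, integral_cot_mul_sin]
  push_cast
  field_simp

end HilbertTransform

/-! ### Point evaluation on Sobolev coordinates -/

section Evaluation

lemma Seq2.norm_le_of_le {x y : Seq2} {r : ℝ} (hr : 0 ≤ r) (h : ∀ k, ‖x k‖ ≤ r * ‖y k‖) :
    ‖x‖ ≤ r * ‖y‖ := by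
  refine (sq_le_sq₀ (norm_nonneg _) (by positivity)).1 ?_
  rw [mul_pow, Seq2.norm_sq, Seq2.norm_sq, ← tsum_mul_left]
  refine Summable.tsum_le_tsum (fun k => ?_) x.summable_sq (y.summable_sq.mul_left _)
  rw [← mul_pow]
  exact pow_le_pow_left₀ (norm_nonneg _) (h k) 2

lemma nrm_nonneg : 0 ≤ nrm := by unfold nrm; positivity

lemma wt_inv_pow_le (k : ℤ) (n : ℕ) : (wt k)⁻¹ ^ n ≤ 1 :=
  pow_le_one₀ (inv_nonneg.2 (wt_pos k).le) (inv_le_one_of_one_le₀ (one_le_wt k))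

lemma abs_intCast_le_wt (k : ℤ) : |(k : ℝ)| ≤ wt k := by unfold wt; linarith

lemma abs_pow_mul_wt_inv_pow_le (k : ℤ) {i n : ℕ} (h : i ≤ n) :
    |(k : ℝ)| ^ i * (wt k)⁻¹ ^ n ≤ 1 := by
  have h0 := wt_pos k
  obtain ⟨j, rfl⟩ := Nat.exists_eq_add_of_le h
  calc |(k : ℝ)| ^ i * (wt k)⁻¹ ^ (i + j) ≤ wt k ^ i * (wt k)⁻¹ ^ (i + j) := by
        gcongr; exact abs_intCast_le_wt k
    _ = (wt k)⁻¹ ^ j := by rw [pow_add, ← mul_assoc, ← mul_pow, mul_inv_cancel₀ h0.ne', one_pow, one_mul]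
    _ ≤ 1 := wt_inv_pow_le k j

lemma norm_wt_inv_pow (k : ℤ) (n : ℕ) : ‖(((wt k)⁻¹ ^ n : ℝ) : ℂ)‖ = (wt k)⁻¹ ^ n := by
  rw [Complex.norm_real, Real.norm_eq_abs, abs_of_pos (pow_pos (inv_pos.2 (wt_pos k)) n)]

lemma norm_mult_le (k : ℤ) {i n : ℕ} (h : i ≤ n) :
    ‖(Complex.I * k) ^ i * (((wt k)⁻¹ ^ n : ℝ) : ℂ)‖ ≤ 1 := by
  rw [norm_mul, norm_wt_inv_pow, norm_pow, norm_mul, Complex.norm_I, one_mul, Complex.norm_intCast]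
  exact abs_pow_mul_wt_inv_pow_le k h

/-- Representer of the evaluation at `θ` of the `i`-th derivative, on the coordinates of
`H^(n+1)`. -/
noncomputable def evalSeq (i n : ℕ) (θ : ℝ) : Seq2 :=
  wshift (fun k => nrm * ek (-k) θ * (starRingEnd ℂ) ((Complex.I * k) ^ i * (((wt k)⁻¹ ^ n : ℝ) : ℂ))) 0
    wtInv

/-- For `i ≤ n` the factor `k^i` is absorbed by `n` weights; the one left over, `wtInv`, supplies
square summability. This is the Sobolev embedding. -/
lemma evalSeq_bound {i n : ℕ} (h : i ≤ n) (θ : ℝ) : ∃ B, ∀ k : ℤ, ‖nrm * ek (-k) θ *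
    (starRingEnd ℂ) ((Complex.I * k) ^ i * (((wt k)⁻¹ ^ n : ℝ) : ℂ))‖ ≤ B := by
  refine ⟨nrm, fun k => ?_⟩
  rw [norm_mul, norm_mul, norm_ek, mul_one, Complex.norm_real, Real.norm_eq_abs,
    abs_of_nonneg nrm_nonneg, RCLike.norm_conj]
  exact mul_le_of_le_one_right nrm_nonneg (norm_mult_le k h)

lemma wtInv_apply (k : ℤ) : wtInv k = (((wt k)⁻¹ : ℝ) : ℂ) := rfl

lemma evalSeq_apply {i n : ℕ} (h : i ≤ n) (θ : ℝ) (k : ℤ) :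
    evalSeq i n θ k = nrm * ek (-k) θ * (starRingEnd ℂ) ((Complex.I * k) ^ i *
      (((wt k)⁻¹ ^ (n + 1) : ℝ) : ℂ)) := by
  rw [evalSeq, wshift_apply (evalSeq_bound h θ), add_zero, wtInv_apply, pow_succ]
  simp only [map_mul, map_pow, Complex.conj_ofReal]
  push_cast; ring

lemma norm_exp_sub_one_sub_le (x : ℝ) :
    ‖Complex.exp (x * Complex.I) - 1 - x * Complex.I‖ ≤ 3 * x ^ 2 := by
  have hx : ‖(x : ℂ) * Complex.I‖ = |x| := by simp
  rcases le_or_gt |x| 1 with h | h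
  · have := Complex.norm_exp_sub_one_sub_id_le (x := x * Complex.I) (by rw [hx]; exact h)
    rw [hx, sq_abs] at this
    nlinarith [sq_nonneg x]
  · calc _ ≤ ‖Complex.exp (x * Complex.I)‖ + ‖(1 : ℂ)‖ + ‖(x : ℂ) * Complex.I‖ :=
          (norm_sub_le _ _).trans (add_le_add_left (norm_sub_le _ _) _)
      _ = 1 + 1 + |x| := by rw [Complex.norm_exp_ofReal_mul_I, norm_one, hx]
      _ ≤ 3 * x ^ 2 := by rw [← sq_abs x]; nlinarith

lemma norm_ek_sub_le (k : ℤ) (x y : ℝ) : ‖ek k x - ek k y‖ ≤ |(k : ℝ)| * |x - y| := by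
  have h : ek k x - ek k y = ek k y * (ek k (x - y) - 1) := by
    rw [mul_sub, mul_one, ← ek_add]; congr 2; ring
  rw [h, norm_mul, norm_ek, one_mul, ek, mul_comm _ Complex.I]
  refine (Real.norm_exp_I_mul_ofReal_sub_one_le).trans ?_
  rw [Real.norm_eq_abs, abs_mul]

/-- A Lipschitz bound in `θ` costs one more power of `k`, hence the condition `i + 1 ≤ n`. -/
lemma norm_evalSeq_sub_le {i n : ℕ} (h : i + 1 ≤ n) (θ θ' : ℝ) :
    ‖evalSeq i n θ - evalSeq i n θ'‖ ≤ |θ - θ'| * nrm * ‖wtInv‖ := by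
  refine Seq2.norm_le_of_le (mul_nonneg (abs_nonneg _) nrm_nonneg) fun k => ?_
  have h1 : i ≤ n := by omega
  rw [lp.coeFn_sub, Pi.sub_apply, evalSeq_apply h1, evalSeq_apply h1, ← sub_mul, ← mul_sub,
    norm_mul, norm_mul, RCLike.norm_conj, norm_mul, norm_pow, norm_mul, Complex.norm_I, one_mul,
    Complex.norm_intCast, norm_wt_inv_pow, Complex.norm_real, Real.norm_eq_abs,
    abs_of_nonneg nrm_nonneg, wtInv_apply, Complex.norm_real, Real.norm_eq_abs,
    abs_of_pos (inv_pos.2 (wt_pos k))]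
  have h2 := norm_ek_sub_le (-k) θ θ'
  rw [Int.cast_neg, abs_neg] at h2
  have h3 := abs_pow_mul_wt_inv_pow_le k h
  have h4 := inv_pos.2 (wt_pos k)
  have h5 := nrm_nonneg
  calc _ ≤ nrm * (|(k : ℝ)| * |θ - θ'|) * (|(k : ℝ)| ^ i * (wt k)⁻¹ ^ (n + 1)) := by gcongr
    _ = |θ - θ'| * nrm * (|(k : ℝ)| ^ (i + 1) * (wt k)⁻¹ ^ n) * (wt k)⁻¹ := by ring
    _ ≤ |θ - θ'| * nrm * 1 * (wt k)⁻¹ := by gcongr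
    _ = _ := by ring

lemma continuous_evalSeq {i n : ℕ} (h : i + 1 ≤ n) : Continuous (evalSeq i n) := by
  refine (LipschitzWith.of_dist_le_mul (K := ⟨nrm * ‖wtInv‖, mul_nonneg nrm_nonneg
    (norm_nonneg _)⟩) fun x y => ?_).continuous
  rw [dist_eq_norm, Real.dist_eq]
  refine (norm_evalSeq_sub_le h x y).trans (le_of_eq ?_)
  change _ = nrm * ‖wtInv‖ * |x - y|
  ring

/-- The quadratic Taylor remainder of the exponential costs `k²`, which two weights absorb, so the
derivative exists in the `ℓ²` norm and not just mode by mode. -/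
lemma hasDerivAt_evalSeq {n : ℕ} (h : 2 ≤ n) (θ : ℝ) :
    HasDerivAt (evalSeq 0 n) (evalSeq 1 n θ) θ := by
  rw [hasDerivAt_iff_isLittleO]
  have hO : (fun x' => evalSeq 0 n x' - evalSeq 0 n θ - (x' - θ) • evalSeq 1 n θ)
      =O[𝓝 θ] fun x' => ‖x' - θ‖ ^ 2 := by
    refine Asymptotics.IsBigO.of_bound (3 * nrm * ‖wtInv‖) (Eventually.of_forall fun x' => ?_)
    rw [norm_pow, norm_norm]
    have hb : ‖evalSeq 0 n x' - evalSeq 0 n θ - (x' - θ) • evalSeq 1 n θ‖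
        ≤ (3 * nrm * ‖x' - θ‖ ^ 2) * ‖wtInv‖ := by
      have h5 := nrm_nonneg
      refine Seq2.norm_le_of_le (by positivity) fun k => ?_
      have e : (evalSeq 0 n x' - evalSeq 0 n θ - (x' - θ) • evalSeq 1 n θ) k
          = nrm * ek (-k) θ * (Complex.exp ((((-k : ℤ) * (x' - θ) : ℝ) : ℂ) * Complex.I) - 1
            - (((-k : ℤ) * (x' - θ) : ℝ) : ℂ) * Complex.I)
            * (((wt k)⁻¹ ^ (n + 1) : ℝ) : ℂ) := by
        rw [lp.coeFn_sub, Pi.sub_apply, lp.coeFn_sub, Pi.sub_apply, lp.coeFn_smul, Pi.smul_apply,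
          evalSeq_apply (by omega), evalSeq_apply (by omega), evalSeq_apply (by omega)]
        have : ek (-k) x' = ek (-k) θ * Complex.exp ((((-k : ℤ) * (x' - θ) : ℝ) : ℂ) * Complex.I) := by
          change _ = ek (-k) θ * ek (-k) (x' - θ)
          rw [← ek_add]; congr 1; ring
        rw [this]
        simp only [map_mul, map_pow, Complex.conj_ofReal, Complex.conj_I, map_intCast,
          Complex.real_smul]
        push_cast; ring
      rw [e, norm_mul, norm_mul, norm_mul, norm_ek, norm_wt_inv_pow, mul_one, Complex.norm_real,
        Real.norm_eq_abs, abs_of_nonneg nrm_nonneg, wtInv_apply, Complex.norm_real,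
        Real.norm_eq_abs, sq_abs, Real.norm_eq_abs, abs_of_pos (inv_pos.2 (wt_pos k))]
      have h2 := norm_exp_sub_one_sub_le ((-k : ℤ) * (x' - θ))
      have h3 := abs_pow_mul_wt_inv_pow_le k h
      have h4 := inv_pos.2 (wt_pos k)
      calc _ ≤ nrm * (3 * ((-k : ℤ) * (x' - θ)) ^ 2) * (wt k)⁻¹ ^ (n + 1) := by gcongr
        _ = 3 * nrm * (x' - θ) ^ 2 * (|(k : ℝ)| ^ 2 * (wt k)⁻¹ ^ n) * (wt k)⁻¹ := by
          rw [sq_abs]; push_cast; ring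
        _ ≤ 3 * nrm * (x' - θ) ^ 2 * 1 * (wt k)⁻¹ := by gcongr
        _ = _ := by ring
    refine hb.trans (le_of_eq (by ring))
  exact hO.trans_isLittleO (Asymptotics.isLittleO_pow_sub_sub θ (by norm_num))

lemma contDiff_evalSeq {n : ℕ} (h : 2 ≤ n) : ContDiff ℝ 1 (evalSeq 0 n) := by
  rw [contDiff_one_iff_deriv]
  have : deriv (evalSeq 0 n) = evalSeq 1 n := funext fun θ => (hasDerivAt_evalSeq h θ).deriv
  rw [this]
  exact ⟨fun θ => (hasDerivAt_evalSeq h θ).differentiableAt, continuous_evalSeq h⟩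

/-- Complex value at `θ` of the `i`-th derivative of the function whose coordinates in `H^(n+1)`
are `b`. -/
noncomputable def evalC (i n : ℕ) (b : Seq2) (θ : ℝ) : ℂ := inner ℂ (evalSeq i n θ) b

/-- Real part of `evalC`. -/
noncomputable def evalR (i n : ℕ) (b : Seq2) (θ : ℝ) : ℝ := inner ℝ (evalSeq i n θ) b

lemma evalC_term {i n : ℕ} (h : i ≤ n) (b : Seq2) (θ : ℝ) (k : ℤ) :
    inner ℂ (evalSeq i n θ k) (b k)
      = nrm * ek k θ * ((Complex.I * k) ^ i * (((wt k)⁻¹ ^ (n + 1) : ℝ) : ℂ)) * b k := by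
  rw [evalSeq_apply h, RCLike.inner_apply]
  simp only [map_mul, conj_ek, neg_neg, Complex.conj_conj, Complex.conj_ofReal, map_pow]
  ring

lemma hasSum_evalC {i n : ℕ} (h : i ≤ n) (b : Seq2) (θ : ℝ) :
    HasSum (fun k : ℤ => nrm * ek k θ * ((Complex.I * k) ^ i *
      (((wt k)⁻¹ ^ (n + 1) : ℝ) : ℂ)) * b k) (evalC i n b θ) := by
  have := lp.hasSum_inner (𝕜 := ℂ) (evalSeq i n θ) b
  simp only [evalC_term h] at this
  exact this

lemma evalR_eq_re (i n : ℕ) (b : Seq2) (θ : ℝ) : evalR i n b θ = (evalC i n b θ).re := by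
  have h1 := lp.hasSum_inner (𝕜 := ℝ) (evalSeq i n θ) b
  have h2 := Complex.hasSum_re (lp.hasSum_inner (𝕜 := ℂ) (evalSeq i n θ) b)
  exact h1.unique h2

lemma evalR_periodic {i n : ℕ} (h : i ≤ n) (b : Seq2) :
    Function.Periodic (evalR i n b) (2 * π) := by
  intro θ
  have : evalSeq i n (θ + 2 * π) = evalSeq i n θ := by
    ext k
    rw [evalSeq_apply h, evalSeq_apply h, ek_periodic (-k) θ]
  rw [evalR, this, evalR]

lemma hasDerivAt_evalR {n : ℕ} (h : 2 ≤ n) (b : Seq2) (θ : ℝ) :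
    HasDerivAt (evalR 0 n b) (evalR 1 n b θ) θ := by
  have := (hasDerivAt_evalSeq h θ).inner ℝ (hasDerivAt_const θ b)
  rw [inner_zero_right, zero_add] at this
  exact this

lemma continuous_evalR {i n : ℕ} (h : i + 1 ≤ n) (b : Seq2) : Continuous (evalR i n b) :=
  (continuous_evalSeq h).inner continuous_const

lemma continuous_evalC {i n : ℕ} (h : i + 1 ≤ n) (b : Seq2) : Continuous (evalC i n b) :=
  (continuous_evalSeq h).inner continuous_const

lemma abs_evalR_sub_le {n : ℕ} (h : 1 ≤ n) (b : Seq2) (x y : ℝ) :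
    |evalR 0 n b x - evalR 0 n b y| ≤ (nrm * ‖wtInv‖ * ‖b‖) * |x - y| := by
  rw [evalR, evalR, ← inner_sub_left]
  refine (abs_real_inner_le_norm _ _).trans ?_
  calc _ ≤ |x - y| * nrm * ‖wtInv‖ * ‖b‖ := by gcongr; exact norm_evalSeq_sub_le h x y
    _ = _ := by ring

lemma fc_evalC {n : ℕ} (b : Seq2) (k : ℤ) :
    nrm * fc (evalC 0 n b) k = (((wt k)⁻¹ ^ (n + 1) : ℝ) : ℂ) * b k := by
  -- The moduli of the terms do not depend on `θ`; absolute convergence of the pairing at `θ = 0`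
  -- therefore allows integration term by term.
  have hs : Summable fun j : ℤ => ‖(((wt j)⁻¹ ^ (n + 1) : ℝ) : ℂ) * b j‖ := by
    have h1 := (lp.summable_inner (𝕜 := ℂ) (evalSeq 0 n 0) b).norm
    simp only [evalC_term (Nat.zero_le n)] at h1
    have hn : nrm ≠ 0 := by unfold nrm; positivity
    have h2 := h1.mul_left nrm⁻¹
    refine h2.congr fun j => ?_
    simp only [norm_mul, norm_ek, Complex.norm_real, Real.norm_eq_abs, abs_of_nonneg nrm_nonneg,
      pow_zero, norm_one]
    field_simp
  have h := intervalIntegral.hasSum_intervalIntegral_of_summable_norm (a := -π) (b := π)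
    (f := fun j : ℤ => (⟨fun θ => ek (-k) θ * (nrm * ek j θ * ((Complex.I * j) ^ 0 *
      (((wt j)⁻¹ ^ (n + 1) : ℝ) : ℂ)) * b j), by fun_prop⟩ : C(ℝ, ℂ))) (by
      refine Summable.of_nonneg_of_le (fun _ => norm_nonneg _) (fun j => ?_) (hs.mul_left nrm)
      rw [ContinuousMap.norm_le _ (mul_nonneg nrm_nonneg (norm_nonneg _))]
      intro x
      simp only [ContinuousMap.restrict_apply, ContinuousMap.coe_mk, norm_mul, norm_ek,
        Complex.norm_real, Real.norm_eq_abs, abs_of_nonneg nrm_nonneg, pow_zero,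
        one_mul, mul_one]
      rw [mul_assoc])
  simp only [ContinuousMap.coe_mk] at h
  have e1 : ∀ θ, ∑' j : ℤ, ek (-k) θ * (nrm * ek j θ * ((Complex.I * j) ^ 0 *
      (((wt j)⁻¹ ^ (n + 1) : ℝ) : ℂ)) * b j) = ek (-k) θ * evalC 0 n b θ := by
    intro θ
    rw [tsum_mul_left, (hasSum_evalC (Nat.zero_le n) b θ).tsum_eq]
  simp only [e1] at h
  have e2 : ∀ j : ℤ, ∫ θ in (-π)..π, ek (-k) θ * (nrm * ek j θ * ((Complex.I * j) ^ 0 *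
      (((wt j)⁻¹ ^ (n + 1) : ℝ) : ℂ)) * b j)
      = nrm * ((((wt j)⁻¹ ^ (n + 1) : ℝ) : ℂ) * b j) * if j = k then (2 * π : ℂ) else 0 := by
    intro j
    rw [← fc_ek, ← fc_const_mul, fc]
    refine intervalIntegral.integral_congr fun x _ => ?_
    simp only [pow_zero]
    ring
  simp only [e2] at h
  have h3 := h.unique (hasSum_single k fun j hj => by rw [if_neg hj, mul_zero])
  rw [fc, h3, if_pos rfl]
  have h4 : (nrm : ℂ) * nrm * (2 * π) = 1 := by
    have h1 := nrm_sq
    have : nrm * nrm * (2 * π) = 1 := by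
      rw [← sq, h1]
      have := Real.pi_pos
      field_simp
    exact_mod_cast this
  linear_combination ((((wt k)⁻¹ ^ (n + 1) : ℝ) : ℂ) * b k) * h4

lemma synth_ae_evalR {n : ℕ} (hn : 1 ≤ n) {b c : Seq2}
    (hc : ∀ k, c k = (((wt k)⁻¹ ^ (n + 1) : ℝ) : ℂ) * b k) :
    evalR 0 n b =ᵐ[torusMeasure] synth c := by
  have hm := memLp_of_continuous (continuous_evalC (i := 0) hn b)
  have h : torusBasis.repr (hm.toLp _) = c := by
    ext k
    rw [torusBasis_repr, hc, ← fc_evalC]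
    congr 1
    exact fc_congr_ae hm.coeFn_toLp k
  have h2 : torusBasis.repr.symm c = hm.toLp _ := by
    rw [← h, LinearIsometryEquiv.symm_apply_apply]
  have h3 := synth_ae c
  rw [h2] at h3
  filter_upwards [h3, hm.coeFn_toLp] with x hx hx'
  rw [hx, hx', evalR_eq_re]

lemma fc_conj (f : ℝ → ℂ) (k : ℤ) :
    fc (fun x => (starRingEnd ℂ) (f x)) k = (starRingEnd ℂ) (fc f (-k)) := by
  unfold fc
  rw [← integral_torus_eq, ← integral_torus_eq, ← integral_conj]
  refine integral_congr_ae (Eventually.of_forall fun x => ?_)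
  simp only [map_mul, conj_ek, neg_neg]

lemma fc_re {f : ℝ → ℂ} (hf : Continuous f) (k : ℤ) :
    fc (fun x => ((f x).re : ℂ)) k = (fc f k + (starRingEnd ℂ) (fc f (-k))) / 2 := by
  rw [← fc_conj, fc, fc, fc, ← intervalIntegral.integral_add, ← intervalIntegral.integral_div]
  · refine intervalIntegral.integral_congr fun x _ => ?_
    rw [Complex.re_eq_add_conj]; ring
  · exact Continuous.intervalIntegrable (by fun_prop) _ _
  · exact Continuous.intervalIntegrable (by fun_prop) _ _

lemma eq_of_ae_eq {f g : ℝ → ℝ} (hf : Continuous f) (hg : Continuous g)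
    (hfp : Function.Periodic f (2 * π)) (hgp : Function.Periodic g (2 * π))
    (h : f =ᵐ[torusMeasure] g) : f = g := by
  have h1 : EqOn f g (Icc (-π) π) := by
    refine Measure.eqOn_Icc_of_ae_eq volume neg_pi_lt_pi.ne ?_ hf.continuousOn hg.continuousOn
    rwa [← restrict_Ioc_eq_restrict_Icc]
  funext x
  have hper : Function.Periodic (fun x => f x - g x) (2 * π) := fun x => by
    simp only; rw [hfp, hgp]
  obtain ⟨y, hy, hxy⟩ := hper.exists_mem_Ico (by positivity) x (-π)
  have := h1 (x := y) ⟨hy.1, by linarith [hy.2]⟩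
  linarith

lemma eq_of_fc_eq {f g : ℝ → ℝ} (hf : Continuous f) (hg : Continuous g)
    (hfp : Function.Periodic f (2 * π)) (hgp : Function.Periodic g (2 * π))
    (h : ∀ k, fc (fun x => (f x : ℂ)) k = fc (fun x => (g x : ℂ)) k) : f = g := by
  have hc : Continuous fun x => ((f x - g x : ℝ) : ℂ) := by fun_prop
  have h0 := eq_zero_of_fc_eq_zero (memLp_of_continuous hc) (fun k => by
    have := h k
    unfold fc at this ⊢
    rw [← sub_eq_zero, ← intervalIntegral.integral_sub] at this
    · rw [← this]
      refine intervalIntegral.integral_congr fun x _ => ?_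
      push_cast; ring
    · exact Continuous.intervalIntegrable (by fun_prop) _ _
    · exact Continuous.intervalIntegrable (by fun_prop) _ _)
  refine eq_of_ae_eq hf hg hfp hgp ?_
  filter_upwards [h0] with x hx
  exact sub_eq_zero.1 (Complex.ofReal_eq_zero.1 hx)

end Evaluation

/-! ### From the Fourier flow to classical solutions -/

section Existence

lemma hasSum_of_eq {f g : ℤ → ℂ} {a : ℂ} (h : HasSum f a) (e : ∀ k, f k = g k) : HasSum g a := by
  rwa [← funext e]

/-- Fourier multiplier of the Hilbert transform. -/
noncomputable def hilbMult : Seq2 →L[ℝ] Seq2 := wshift (fun k => -Complex.I * k.sign) 0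

/-- Fourier multiplier `-1 / |k|` giving the velocity, up to a constant. -/
noncomputable def velMult : Seq2 →L[ℝ] Seq2 := wshift (fun k => ((-|(k : ℝ)|⁻¹ : ℝ) : ℂ)) 0

lemma hilbMult_apply (b : Seq2) (k : ℤ) : hilbMult b k = -Complex.I * k.sign * b k := by
  rw [hilbMult, wshift_apply, add_zero]
  refine ⟨1, fun k => ?_⟩
  rw [norm_mul, norm_neg, Complex.norm_I, one_mul, Complex.norm_intCast]
  rcases lt_trichotomy k 0 with h | h | h
  · rw [Int.sign_eq_neg_one_of_neg h]; simp
  · rw [h]; simp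
  · rw [Int.sign_eq_one_of_pos h]; simp

lemma velMult_apply (b : Seq2) (k : ℤ) :
    velMult b k = ((-|(k : ℝ)|⁻¹ : ℝ) : ℂ) * b k := by
  rw [velMult, wshift_apply, add_zero]
  refine ⟨1, fun k => ?_⟩
  rw [norm_ofReal_le_iff, abs_neg, abs_inv, abs_abs]
  rcases eq_or_ne k 0 with rfl | hk
  · simp
  · exact inv_le_one_of_one_le₀ (by exact_mod_cast Int.one_le_abs hk)

lemma fc_evalR {n : ℕ} (hn : 1 ≤ n) (b : Seq2) (k : ℤ) :
    nrm * fc (fun x => (evalR 0 n b x : ℂ)) k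
      = (((wt k)⁻¹ ^ (n + 1) : ℝ) : ℂ) * (b k + (starRingEnd ℂ) (b (-k))) / 2 := by
  simp only [evalR_eq_re]
  rw [fc_re (continuous_evalC hn b)]
  have h1 := fc_evalC (n := n) b k
  have h2 := congrArg (starRingEnd ℂ) (fc_evalC (n := n) b (-k))
  have hw : wt (-k) = wt k := by simp [wt]
  rw [map_mul, map_mul, Complex.conj_ofReal, Complex.conj_ofReal, hw] at h2
  linear_combination h1 / 2 + h2 / 2

/-- Both sides are continuous and periodic, so it suffices to compare Fourier coefficients. The
multiplier `-i sgn k` respects the symmetrization `b k + conj (b (-k))` caused by the real part. -/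
lemma hilbert_evalR {n : ℕ} (hn : 1 ≤ n) (b : Seq2) :
    hilbert (evalR 0 n b) = evalR 0 n (hilbMult b) := by
  have hc := continuous_evalR (i := 0) hn b
  have hl := abs_evalR_sub_le hn b
  have hp := evalR_periodic (Nat.zero_le n) b
  refine eq_of_fc_eq (continuous_hilbert hc hl) (continuous_evalR hn _) ?_
    (evalR_periodic (Nat.zero_le n) _) fun k => ?_
  · intro θ
    unfold hilbert
    congr 1
    refine intervalIntegral.integral_congr fun s _ => ?_
    have h1 := hp (θ - s)
    have h2 := hp (θ + s)
    rw [← h1, ← h2]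
    congr 3 <;> ring
  · have hnz : (nrm : ℂ) ≠ 0 := by
      have : nrm ≠ 0 := by unfold nrm; positivity
      exact_mod_cast this
    refine mul_left_cancel₀ hnz ?_
    rw [fc_hilbert hc hl hp, fc_evalR hn, hilbMult_apply, hilbMult_apply]
    have h := fc_evalR hn b k
    simp only [map_mul, map_neg, Complex.conj_I, map_intCast, Int.sign_neg, Int.cast_neg]
    linear_combination (-Complex.I * (k.sign : ℂ)) * h

lemma evalR_velMult {n : ℕ} (hn : 1 ≤ n) (b : Seq2) (θ : ℝ) :
    evalR 1 n (velMult b) θ = evalR 0 n (hilbMult b) θ := by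
  rw [evalR_eq_re, evalR_eq_re]
  congr 1
  refine (hasSum_evalC hn (velMult b) θ).unique ?_
  convert hasSum_evalC (Nat.zero_le n) (hilbMult b) θ using 2 with k
  rw [velMult_apply, hilbMult_apply]
  have : (k : ℂ) * ((-|(k : ℝ)|⁻¹ : ℝ) : ℂ) = -k.sign := by
    rcases lt_trichotomy k 0 with h | h | h
    · have h' : (k : ℝ) < 0 := by exact_mod_cast h
      have h2 : (k : ℂ) ≠ 0 := by exact_mod_cast h.ne
      rw [Int.sign_eq_neg_one_of_neg h, abs_of_neg h']
      push_cast
      field_simp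
    · rw [h]; simp
    · have h' : (0 : ℝ) < k := by exact_mod_cast h
      have h2 : (k : ℂ) ≠ 0 := by exact_mod_cast h.ne'
      rw [Int.sign_eq_one_of_pos h, abs_of_pos h']
      push_cast
      field_simp
  linear_combination (nrm * ek k θ * Complex.I * (((wt k)⁻¹ ^ (n + 1) : ℝ) : ℂ) * b k) * this

lemma isVelocity_evalR {n : ℕ} (hn : 2 ≤ n) (b : Seq2) :
    IsVelocity (evalR 0 n b)
      (fun θ => evalR 0 n (velMult b) θ - evalR 0 n (velMult b) 0) := by
  refine ⟨sub_self _, fun θ => ⟨_, hasHilbertTransformAt_hilbert (continuous_evalR (by omega) b)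
    (abs_evalR_sub_le (by omega) b) θ, ?_⟩⟩
  rw [hilbert_evalR (by omega), ← evalR_velMult (by omega)]
  exact (hasDerivAt_evalR hn _ θ).sub_const _

/-- Write `2 cos 2θ` and `sin 2θ` through `e^{±2iθ}` and shift the summation index by `±2`: the mode
`j` feeds `j + 2` with factor `1 - j/2` and `j - 2` with factor `1 + j/2`, the couplings of
`evolOp`. -/
lemma evalC_evolOp {σ : ℝ} (hσ : |σ| ≤ 1) (n : ℕ) (b : Seq2) (θ : ℝ) :
    evalC 0 n (evolOp σ (n + 1) b) θ
      = 2 * Real.cos (2 * θ) * (evalC 0 (n + 1) ((1 / 2 : ℝ) • b + σ • velMult b) θ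
          - σ * evalC 0 (n + 1) (velMult b) 0)
        - Real.sin (2 * θ) * evalC 1 (n + 1) ((1 / 2 : ℝ) • b + σ • velMult b) θ := by
  set b' := (1 / 2 : ℝ) • b + σ • velMult b with hb'
  have hb'k : ∀ j, b' j = (symb σ j : ℂ) * b j := by
    intro j
    rw [hb', lp.coeFn_add, Pi.add_apply, lp.coeFn_smul, lp.coeFn_smul, Pi.smul_apply,
      Pi.smul_apply, velMult_apply, Complex.real_smul, Complex.real_smul, symb]
    push_cast; ring
  set S0 := evalC 0 (n + 1) b' θ
  set S1 := evalC 1 (n + 1) b' θ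
  set X : ℤ → ℂ := fun j => nrm * ek j θ * (((wt j)⁻¹ ^ (n + 2) : ℝ) : ℂ) * b' j with hX
  have h0 : HasSum X S0 := by
    have := hasSum_evalC (Nat.zero_le (n + 1)) b' θ
    simpa only [pow_zero, one_mul] using! this
  have h1 : HasSum (fun j : ℤ => Complex.I * j * X j) S1 := by
    have := hasSum_evalC (i := 1) (n := n + 1) (by omega) b' θ
    refine hasSum_of_eq this fun j => ?_
    simp only [hX, pow_one]; ring
  have hup : HasSum (fun k : ℤ => ek 2 θ * ((1 - ((k - 2 : ℤ) : ℂ) / 2) * X (k - 2)))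
      (ek 2 θ * (S0 + Complex.I / 2 * S1)) := by
    have h := (h0.add (h1.mul_left (Complex.I / 2))).mul_left (ek 2 θ)
    have h' := ((Equiv.subRight (2 : ℤ)).hasSum_iff).2 h
    refine hasSum_of_eq h' fun k => ?_
    simp only [Function.comp_apply, Equiv.subRight_apply]
    linear_combination (ek 2 θ * (k - 2 : ℤ) * X (k - 2) / 2) * Complex.I_sq
  have hdown : HasSum (fun k : ℤ => ek (-2) θ * ((1 + ((k + 2 : ℤ) : ℂ) / 2) * X (k + 2)))
      (ek (-2) θ * (S0 - Complex.I / 2 * S1)) := by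
    have h := (h0.sub (h1.mul_left (Complex.I / 2))).mul_left (ek (-2) θ)
    have h' := ((Equiv.addRight (2 : ℤ)).hasSum_iff).2 h
    refine hasSum_of_eq h' fun k => ?_
    simp only [Function.comp_apply, Equiv.coe_addRight]
    linear_combination (-(ek (-2) θ * (k + 2 : ℤ) * X (k + 2) / 2)) * Complex.I_sq
  set ell := inner ℂ (lowMode (n + 1)) (smoothing b) with hell
  -- The value at `0` that must be subtracted from `v` is the functional `∑ a_k / |k|`, up to sign
  -- and normalization; this is the origin of the rank-one term.
  have hlow : evalC 0 (n + 1) (velMult b) 0 = -(nrm * ell) := by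
    have h := hasSum_evalC (Nat.zero_le (n + 1)) (velMult b) 0
    have h' := (lp.hasSum_inner (𝕜 := ℂ) (lowMode (n + 1)) (smoothing b)).mul_left (-(nrm : ℂ))
    rw [← hell, neg_mul] at h'
    refine h.unique (hasSum_of_eq h' fun k => ?_)
    have : ek k 0 = 1 := by simp [ek]
    rw [this, velMult_apply, RCLike.inner_apply, lowMode_apply, smoothing_apply,
      Complex.conj_ofReal]
    push_cast; ring
  have hrank : HasSum (fun k : ℤ => (σ * nrm * ell) * ((if k = 2 then ek 2 θ else 0)
      + (if k = -2 then ek (-2) θ else 0))) ((σ * nrm * ell) * (ek 2 θ + ek (-2) θ)) :=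
    ((hasSum_ite_eq 2 _).add (hasSum_ite_eq (-2) _)).mul_left _
  have htot := (hup.add hdown).add hrank
  have hmain := hasSum_evalC (Nat.zero_le n) (evolOp σ (n + 1) b) θ
  have heq := hmain.unique (hasSum_of_eq htot fun k => ?_)
  · rw [heq, hlow]
    have e1 : ek 2 θ + ek (-2) θ = 2 * Real.cos (2 * θ) := by
      rw [ek_eq, ek_eq]; push_cast
      rw [neg_mul, Complex.cos_neg, Complex.sin_neg]; ring
    have e2 : ek 2 θ - ek (-2) θ = 2 * Complex.I * Real.sin (2 * θ) := by
      rw [ek_eq, ek_eq]; push_cast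
      rw [neg_mul, Complex.cos_neg, Complex.sin_neg]; ring
    linear_combination (S0 + σ * nrm * ell) * e1 + Complex.I / 2 * S1 * e2
      + Real.sin (2 * θ) * S1 * Complex.I_sq
  · rw [evolOp_apply hσ]
    have hek1 : ek k θ = ek 2 θ * ek (k - 2) θ := by rw [ek_mul]; congr 1; ring
    have hek2 : ek k θ = ek (-2) θ * ek (k + 2) θ := by rw [ek_mul]; congr 1; ring
    have hw := (wt_pos k).ne'
    -- Leaving the `H^(n+1)` coordinates removes the weight of `k` and leaves the factor `(1 + |k -
    -- 2|)^(-(n+2))` of the input mode.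
    have t1 : (wt k)⁻¹ ^ (n + 1) * (coefUp σ (n + 1) k / wt (k - 2))
        = (wt (k - 2))⁻¹ ^ (n + 2) * (symb σ (k - 2) * (1 - ((k - 2 : ℤ) : ℝ) / 2)) := by
      have hw2 := (wt_pos (k - 2)).ne'
      unfold coefUp
      rw [div_pow, inv_pow, inv_pow]
      push_cast
      field_simp
      ring
    have t2 : (wt k)⁻¹ ^ (n + 1) * (coefDown σ (n + 1) (k + 2) / wt (k + 2))
        = (wt (k + 2))⁻¹ ^ (n + 2) * (symb σ (k + 2) * (1 + ((k + 2 : ℤ) : ℝ) / 2)) := by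
      have hw2 := (wt_pos (k + 2)).ne'
      unfold coefDown
      rw [div_pow, inv_pow, inv_pow, add_sub_cancel_right]
      field_simp
      ring
    have t1' := congrArg (fun x : ℝ => (x : ℂ)) t1
    have t2' := congrArg (fun x : ℝ => (x : ℂ)) t2
    simp only [Complex.ofReal_mul] at t1' t2'
    have t3 : (((wt k)⁻¹ ^ (n + 1) : ℝ) : ℂ) * cosSeq (n + 1) k * ek k θ
        = (if k = 2 then ek 2 θ else 0) + (if k = -2 then ek (-2) θ else 0) := by
      rw [cosSeq_apply]
      have h3 : ∀ k : ℤ, (k = 2 ∨ k = -2) → (((wt k)⁻¹ ^ (n + 1) : ℝ) : ℂ) * ((3 : ℝ) ^ (n + 1) : ℝ)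
          = 1 := by
        intro k hk
        have : wt k = 3 := by rcases hk with rfl | rfl <;> norm_num [wt]
        rw [this, ← Complex.ofReal_mul, ← mul_pow]
        norm_num
      by_cases h2 : k = 2
      · subst h2
        have := h3 2 (Or.inl rfl)
        simp only [if_true, show ¬ ((2 : ℤ) = -2) by norm_num, if_false, add_zero, mul_one]
        rw [this, one_mul]
      · by_cases h4 : k = -2
        · subst h4
          have := h3 (-2) (Or.inr rfl)
          simp only [if_true, show ¬ ((-2 : ℤ) = 2) by norm_num, if_false, zero_add, mul_one]
          rw [this, one_mul]
        · simp [h2, h4]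
    have e1 : ek 2 θ * ((1 - ((k - 2 : ℤ) : ℂ) / 2) * X (k - 2)) = nrm * ek k θ *
        ((((wt k)⁻¹ ^ (n + 1) : ℝ) : ℂ) * ((coefUp σ (n + 1) k / wt (k - 2) : ℝ) : ℂ))
          * b (k - 2) := by
      simp only [hX, hb'k]
      rw [t1', hek1]
      push_cast; ring
    have e2 : ek (-2) θ * ((1 + ((k + 2 : ℤ) : ℂ) / 2) * X (k + 2)) = nrm * ek k θ *
        ((((wt k)⁻¹ ^ (n + 1) : ℝ) : ℂ) * ((coefDown σ (n + 1) (k + 2) / wt (k + 2) : ℝ) : ℂ))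
          * b (k + 2) := by
      simp only [hX, hb'k]
      rw [t2', hek2]
      push_cast; ring
    rw [e1, e2, ← t3, ← hell]
    ring

lemma evalR_evolOp {σ : ℝ} (hσ : |σ| ≤ 1) {n : ℕ} (hn : 1 ≤ n) (b : Seq2) (θ : ℝ) :
    evalR 0 n (evolOp σ (n + 1) b) θ
      = lieBracket (fun x => 1 / 2 * evalR 0 (n + 1) b x
          + σ * (evalR 0 (n + 1) (velMult b) x - evalR 0 (n + 1) (velMult b) 0))
        (fun x => Real.sin (2 * x)) θ := by
  have hR : ∀ i x, evalR i (n + 1) ((1 / 2 : ℝ) • b + σ • velMult b) x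
      = 1 / 2 * evalR i (n + 1) b x + σ * evalR i (n + 1) (velMult b) x := by
    intro i x
    simp only [evalR, inner_add_right, real_inner_smul_right]
  have hd : deriv (fun x => 1 / 2 * evalR 0 (n + 1) b x
      + σ * (evalR 0 (n + 1) (velMult b) x - evalR 0 (n + 1) (velMult b) 0)) θ
      = 1 / 2 * evalR 1 (n + 1) b θ + σ * evalR 1 (n + 1) (velMult b) θ :=
    (((hasDerivAt_evalR (by omega) b θ).const_mul _).add
      (((hasDerivAt_evalR (by omega) (velMult b) θ).sub_const _).const_mul _)).deriv
  have hs : deriv (fun x : ℝ => Real.sin (2 * x)) θ = 2 * Real.cos (2 * θ) := by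
    have := ((hasDerivAt_id θ).const_mul 2).sin.deriv
    simp only [id, mul_one] at this
    rw [this]; ring
  have h := congrArg Complex.re (evalC_evolOp hσ n b θ)
  rw [lieBracket, hd, hs, ← hR, evalR_eq_re 0 n, h]
  have e : (2 * (Real.cos (2 * θ) : ℂ) * (evalC 0 (n + 1) ((1 / 2 : ℝ) • b + σ • velMult b) θ
          - σ * evalC 0 (n + 1) (velMult b) 0)
        - Real.sin (2 * θ) * evalC 1 (n + 1) ((1 / 2 : ℝ) • b + σ • velMult b) θ).re
      = 2 * Real.cos (2 * θ) * ((evalC 0 (n + 1) ((1 / 2 : ℝ) • b + σ • velMult b) θ).re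
          - σ * (evalC 0 (n + 1) (velMult b) 0).re)
        - Real.sin (2 * θ) * (evalC 1 (n + 1) ((1 / 2 : ℝ) • b + σ • velMult b) θ).re := by
    rw [show (2 : ℂ) * (Real.cos (2 * θ) : ℂ) = ((2 * Real.cos (2 * θ) : ℝ) : ℂ) by push_cast; ring,
      Complex.sub_re, Complex.re_ofReal_mul, Complex.re_ofReal_mul, Complex.sub_re,
      Complex.re_ofReal_mul]
  rw [e, ← evalR_eq_re, ← evalR_eq_re, ← evalR_eq_re, hR 0]
  ring

lemma sobMult_bound {j m : ℕ} (h : j ≤ m) :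
    ∃ B, ∀ k : ℤ, ‖(Complex.I * k) ^ j * (((wt k)⁻¹ ^ m : ℝ) : ℂ)‖ ≤ B :=
  ⟨1, fun k => norm_mult_le k h⟩

/-- The element of `H^m` with given coordinates. -/
noncomputable def toSobolev (m : ℕ) : Seq2 →L[ℝ] Sobolev m :=
  ContinuousLinearMap.codRestrict
    ((PiLp.continuousLinearEquiv 2 ℝ (fun _ : Fin (m + 1) => L2)).symm.toContinuousLinearMap ∘L
      ContinuousLinearMap.pi fun j : Fin (m + 1) => synth ∘L
        wshift (fun k => (Complex.I * k) ^ (j : ℕ) * (((wt k)⁻¹ ^ m : ℝ) : ℂ)) 0)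
    (Sobolev m) (fun b j => by
      refine hasWeakDeriv_synth fun k => ?_
      have h1 : (j.succ : ℕ) ≤ m := by simp
      have h2 : (j.castSucc : ℕ) ≤ m := by simp
      refine ((wshift_apply (sobMult_bound h1) 0 b k).trans ?_).trans
        (congrArg (Complex.I * k * ·) (wshift_apply (sobMult_bound h2) 0 b k).symm)
      simp only [Fin.val_succ, Fin.val_castSucc]
      ring)

lemma toSobolev_zero (m : ℕ) (b : Seq2) :
    (toSobolev m b : PiLp 2 (fun _ : Fin (m + 1) => L2)) 0
      = synth (wshift (fun k => (Complex.I * k) ^ 0 * (((wt k)⁻¹ ^ m : ℝ) : ℂ)) 0 b) := rfl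

lemma represents_toSobolev {n m : ℕ} (hn : 1 ≤ n) {b c : Seq2}
    (h : ∀ k, (((wt k)⁻¹ ^ m : ℝ) : ℂ) * c k = (((wt k)⁻¹ ^ (n + 1) : ℝ) : ℂ) * b k) :
    Represents (evalR 0 n b) (toSobolev m c) := by
  refine ⟨evalR_periodic (Nat.zero_le n) b, ?_⟩
  rw [toSobolev_zero]
  refine synth_ae_evalR hn fun k => ?_
  rw [wshift_apply (sobMult_bound (Nat.zero_le m)), pow_zero, one_mul, add_zero, h]

lemma exists_sobolev_coords {m : ℕ} (F : Sobolev m) :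
    ∃ b : Seq2, ∀ k, (((wt k)⁻¹ ^ m : ℝ) : ℂ) * b k
      = ana ((F : PiLp 2 (fun _ : Fin (m + 1) => L2)) 0) k := by
  set G : Fin (m + 1) → L2 := fun j => (F : PiLp 2 (fun _ : Fin (m + 1) => L2)) j with hG
  have hj : ∀ j : ℕ, ∀ hj : j < m + 1, ∀ k : ℤ,
      ana (G ⟨j, hj⟩) k = (Complex.I * k) ^ j * ana (G 0) k := by
    intro j
    induction j with
    | zero => intro hj k; simp
    | succ j ih =>
      intro hj k
      have h := ana_of_hasWeakDeriv (F.2 ⟨j, by omega⟩) k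
      have h1 : (⟨j, by omega⟩ : Fin m).succ = ⟨j + 1, hj⟩ := rfl
      have h2 : (⟨j, by omega⟩ : Fin m).castSucc = ⟨j, by omega⟩ := rfl
      rw [h1, h2] at h
      refine h.trans ?_
      have := ih (by omega) k
      simp only [hG] at this ⊢
      rw [this]; ring
  have hm := hj m (by omega)
  -- Since `(1 + |k|)^m ≤ 2^m (1 + |k|^m)`, square summability for the function and its `m`-th weak
  -- derivative suffices.
  have hb : Memℓp (fun k : ℤ => ((wt k ^ m : ℝ) : ℂ) * ana (G 0) k) 2 := by
    refine memℓp_two_iff.2 (Summable.of_nonneg_of_le (fun k => by positivity) (fun k => ?_)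
      (((ana (G 0)).summable_sq.add (ana (G ⟨m, by omega⟩)).summable_sq).mul_left
        (2 * (2 ^ m) ^ 2)))
    have hmk : ‖ana (G ⟨m, by omega⟩) k‖ = |(k : ℝ)| ^ m * ‖ana (G 0) k‖ := by
      rw [hm, norm_mul, norm_pow, norm_mul, Complex.norm_I, one_mul, Complex.norm_intCast]
    have hw : wt k ^ m ≤ 2 ^ m * (1 + |(k : ℝ)| ^ m) := by
      unfold wt
      rcases le_total |(k : ℝ)| 1 with h | h
      · calc (1 + |(k : ℝ)|) ^ m ≤ 2 ^ m := by gcongr; linarith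
          _ ≤ _ := le_mul_of_one_le_right (by positivity) (by
            have : 0 ≤ |(k : ℝ)| ^ m := by positivity
            linarith)
      · calc (1 + |(k : ℝ)|) ^ m ≤ (2 * |(k : ℝ)|) ^ m := by gcongr; linarith
          _ = 2 ^ m * |(k : ℝ)| ^ m := mul_pow _ _ _
          _ ≤ _ := by gcongr; linarith
    rw [norm_mul, Complex.norm_real, Real.norm_eq_abs, abs_of_pos (pow_pos (wt_pos k) m)]
    have h3 : wt k ^ m * ‖ana (G 0) k‖
        ≤ 2 ^ m * (‖ana (G 0) k‖ + ‖ana (G ⟨m, by omega⟩) k‖) := by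
      rw [hmk]
      calc _ ≤ 2 ^ m * (1 + |(k : ℝ)| ^ m) * ‖ana (G 0) k‖ := by gcongr
        _ = _ := by ring
    have h4 : 0 ≤ wt k ^ m * ‖ana (G 0) k‖ :=
      mul_nonneg (pow_pos (wt_pos k) m).le (norm_nonneg _)
    calc _ ≤ (2 ^ m * (‖ana (G 0) k‖ + ‖ana (G ⟨m, by omega⟩) k‖)) ^ 2 := by gcongr
      _ = (2 ^ m) ^ 2 * (‖ana (G 0) k‖ + ‖ana (G ⟨m, by omega⟩) k‖) ^ 2 := mul_pow _ _ _
      _ ≤ (2 ^ m) ^ 2 * (2 * (‖ana (G 0) k‖ ^ 2 + ‖ana (G ⟨m, by omega⟩) k‖ ^ 2)) := by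
          gcongr; exact add_sq_le
      _ = _ := by ring
  refine ⟨⟨_, hb⟩, fun k => ?_⟩
  change (((wt k)⁻¹ ^ m : ℝ) : ℂ) * (((wt k ^ m : ℝ) : ℂ) * ana (G 0) k) = _
  rw [← mul_assoc, ← Complex.ofReal_mul, ← mul_pow, inv_mul_cancel₀ (wt_pos k).ne', one_pow]
  simp [hG]

/-- Existence for one component; `σ = ±1` is the sign of the velocity. -/
theorem exists_solution {σ : ℝ} (hσ : |σ| ≤ 1) {n : ℕ} (hn : 2 ≤ n) (F : Sobolev (n + 2)) (T : ℝ) :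
    ∃ η : ℝ → ℝ → ℝ, (∀ t, Function.Periodic (η t) (2 * π)) ∧
      ContDiff ℝ 1 (fun z : ℝ × ℝ => η z.1 z.2) ∧
      (∀ t, ∃ v, IsVelocity (η t) v ∧ ∀ θ, HasDerivAt (fun s => η s θ)
        (lieBracket (fun x => 1 / 2 * η t x + σ * v x) (fun x => Real.sin (2 * x)) θ) t) ∧
      Represents (η 0) F ∧ InTimeSobolev 0 (n + 2) T η ∧ InTimeSobolev 2 n T η := by
  obtain ⟨hK, U, hU0, hUc, hUi, hUd⟩ := exists_fourier_flow hσ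
  obtain ⟨b, hb⟩ := exists_sobolev_coords F
  -- `u` holds the `H^(n+2)` coordinates and is only continuous; one smoothing gives the `H^(n+1)`
  -- coordinates, of class `C¹`, and two give those of `H^n`, of class `C²`.
  set u : ℝ → Seq2 := fun t => U (n + 2) t b with hu
  have huc : Continuous u := hUc (n + 2) b
  have hu1 : ∀ t, HasDerivAt (fun t => smoothing (u t)) (evolOp σ (n + 1) (u t)) t := fun t =>
    hUd (n + 1) t b
  have hKa : ∀ x, smoothing (evolOp σ (n + 1) x) = evolOp σ n (smoothing x) := fun x =>
    (DFunLike.congr_fun (hK n) x).symm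
  have hu2 : ∀ t, HasDerivAt (fun t => smoothing (smoothing (u t)))
      (evolOp σ n (smoothing (u t))) t := by
    intro t
    have := smoothing.hasFDerivAt.comp_hasDerivAt t (hu1 t)
    rwa [hKa] at this
  have hC1 : ContDiff ℝ 1 (fun t => smoothing (u t)) := by
    rw [contDiff_one_iff_deriv, show deriv (fun t => smoothing (u t))
      = fun t => evolOp σ (n + 1) (u t) from funext fun t => (hu1 t).deriv]
    exact ⟨fun t => (hu1 t).differentiableAt, (evolOp σ (n + 1)).continuous.comp huc⟩
  have hC2 : ContDiff ℝ 2 (fun t => smoothing (smoothing (u t))) := by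
    rw [show (2 : WithTop ℕ∞) = 1 + 1 by norm_num, contDiff_succ_iff_deriv,
      show deriv (fun t => smoothing (smoothing (u t)))
      = fun t => evolOp σ n (smoothing (u t)) from funext fun t => (hu2 t).deriv]
    exact ⟨fun t => (hu2 t).differentiableAt, by simp, (evolOp σ n).contDiff.comp hC1⟩
  have heval : ∀ t, evalR 0 (n + 1) (u t) = evalR 0 n (smoothing (u t)) := by
    intro t; funext θ
    rw [evalR_eq_re, evalR_eq_re]
    congr 1
    refine (hasSum_evalC (Nat.zero_le _) _ θ).unique ?_
    refine hasSum_of_eq (hasSum_evalC (Nat.zero_le _) (smoothing (u t)) θ) fun k => ?_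
    rw [smoothing_apply]; push_cast; ring
  refine ⟨fun t => evalR 0 (n + 1) (u t), fun t => evalR_periodic (Nat.zero_le _) _, ?_, ?_, ?_,
    ?_, ?_⟩
  · simp only [heval]
    -- Joint `C¹` regularity holds because the solution is the inner product of a `C¹` curve in `θ`
    -- with a `C¹` curve in `t`.
    exact ContDiff.inner ℝ ((contDiff_evalSeq hn).comp contDiff_snd) (hC1.comp contDiff_fst)
  · intro t
    refine ⟨_, isVelocity_evalR (by omega) (u t), fun θ => ?_⟩
    rw [← evalR_evolOp hσ (by omega)]
    simp only [heval]
    have := (hasDerivAt_const t (evalSeq 0 n θ)).inner ℝ (hu1 t)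
    rw [inner_zero_left, add_zero] at this
    exact this
  · refine ⟨evalR_periodic (Nat.zero_le _) _, ?_⟩
    have h0 : u 0 = b := hU0 _ _
    change evalR 0 (n + 1) (u 0) =ᵐ[torusMeasure] _
    rw [h0, ← synth_ana ((F : PiLp 2 (fun _ : Fin (n + 2 + 1) => L2)) 0)]
    exact synth_ae_evalR (by omega) fun k => (hb k).symm
  · refine ⟨fun t => toSobolev (n + 2) (u t), ?_, fun t _ => ?_⟩
    · exact contDiffOn_zero.2 ((toSobolev (n + 2)).continuous.comp huc).continuousOn
    · exact represents_toSobolev (by omega) fun k => rfl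
  · refine ⟨fun t => toSobolev n (smoothing (smoothing (u t))), ?_, fun t _ => ?_⟩
    · exact ((toSobolev n).contDiff.comp hC2).contDiffOn
    · refine represents_toSobolev (by omega) fun k => ?_
      rw [smoothing_apply, smoothing_apply]; push_cast; ring

end Existence

/-! ### Uniqueness by the `L²` energy method -/

section Uniqueness

variable {f : ℝ → ℝ}

lemma exists_lipschitz_of_periodic (hf : ContDiff ℝ 1 f) (hp : Function.Periodic f (2 * π)) :
    ∃ C, ∀ x y, |f x - f y| ≤ C * |x - y| := by
  have hd : Continuous (deriv f) := hf.continuous_deriv le_rfl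
  have hdp : Function.Periodic (deriv f) (2 * π) := by
    intro x
    rw [← deriv_comp_add_const]
    congr 1
    funext y
    exact hp y
  obtain ⟨C, hC⟩ := (isCompact_Icc (a := -π) (b := π)).exists_bound_of_continuousOn
    hd.continuousOn
  refine ⟨C, fun x y => ?_⟩
  have hb : ∀ x, ‖deriv f x‖ ≤ C := by
    intro x
    obtain ⟨z, hz, hxz⟩ := hdp.exists_mem_Ico (by positivity) x (-π)
    rw [hxz]
    exact hC z ⟨hz.1, by linarith [hz.2]⟩
  have := convex_univ.norm_image_sub_le_of_norm_deriv_le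
    (fun x _ => (hf.differentiable (by norm_num)) x) (fun x _ => hb x) (mem_univ y) (mem_univ x)
  simpa using this

/-- By Parseval, since the multiplier has modulus at most one. -/
lemma integral_hilbert_sq_le (hf : ContDiff ℝ 1 f) (hp : Function.Periodic f (2 * π)) :
    ∫ x in (-π)..π, hilbert f x ^ 2 ≤ ∫ x in (-π)..π, f x ^ 2 := by
  obtain ⟨C, hC⟩ := exists_lipschitz_of_periodic hf hp
  have hh := continuous_hilbert hf.continuous hC
  have h1 := hasSum_sq_fc (memLp_of_continuous (f := fun x => (hilbert f x : ℂ)) (by fun_prop))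
  have h2 := hasSum_sq_fc (memLp_of_continuous (f := fun x => (f x : ℂ))
    (Complex.continuous_ofReal.comp hf.continuous))
  have hle := hasSum_le (fun k => ?_) h1 h2
  · have hpi := Real.pi_pos
    simp only [Complex.norm_real, Real.norm_eq_abs, sq_abs] at hle
    exact le_of_mul_le_mul_left hle (by positivity)
  · rw [fc_hilbert hf.continuous hC hp]
    gcongr
    rw [norm_mul]
    refine mul_le_of_le_one_left (norm_nonneg _) ?_
    rw [norm_mul, norm_neg, Complex.norm_I, one_mul, Complex.norm_intCast]
    rcases lt_trichotomy k 0 with h | h | h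
    · rw [Int.sign_eq_neg_one_of_neg h]; simp
    · rw [h]; simp
    · rw [Int.sign_eq_one_of_pos h]; simp

lemma sq_integral_abs_le {h : ℝ → ℝ} (hh : Continuous h) :
    (∫ x in (-π)..π, |h x|) ^ 2 ≤ 2 * π * ∫ x in (-π)..π, h x ^ 2 := by
  have hpi := Real.pi_pos
  set A := ∫ x in (-π)..π, |h x| with hA
  set M := A / (2 * π) with hM
  -- Cauchy–Schwarz through nonnegativity of a variance, with `M` the mean of `|h|`.
  have h0 : 0 ≤ ∫ x in (-π)..π, (|h x| - M) ^ 2 :=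
    intervalIntegral.integral_nonneg neg_pi_lt_pi.le fun x _ => sq_nonneg _
  have h1 : ∫ x in (-π)..π, (|h x| - M) ^ 2
      = (∫ x in (-π)..π, h x ^ 2) - 2 * M * A + 2 * π * M ^ 2 := by
    have e : ∀ x, (|h x| - M) ^ 2 = (h x ^ 2 - 2 * M * |h x|) + M ^ 2 := by
      intro x; rw [← sq_abs (h x)]; ring
    simp only [e]
    rw [intervalIntegral.integral_add, intervalIntegral.integral_sub,
      intervalIntegral.integral_const_mul, intervalIntegral.integral_const]
    · rw [smul_eq_mul]; ring
    all_goals exact Continuous.intervalIntegrable (by fun_prop) _ _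
  have hA' : A = 2 * π * M := by rw [hM]; field_simp
  rw [h1] at h0
  rw [hA'] at h0 ⊢
  have h2 : 2 * π * M ^ 2 ≤ ∫ x in (-π)..π, h x ^ 2 := by linarith
  calc (2 * π * M) ^ 2 = 2 * π * (2 * π * M ^ 2) := by ring
    _ ≤ _ := by gcongr

lemma velocity_sq_le {h v : ℝ → ℝ} (hh : Continuous h) (hv : ∀ θ, HasDerivAt v (h θ) θ)
    (hv0 : v 0 = 0) {θ : ℝ} (hθ : θ ∈ Icc (-π) π) :
    v θ ^ 2 ≤ 2 * π * ∫ x in (-π)..π, h x ^ 2 := by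
  refine le_trans ?_ (sq_integral_abs_le hh)
  have h1 : v θ = ∫ x in (0 : ℝ)..θ, h x := by
    rw [intervalIntegral.integral_eq_sub_of_hasDerivAt (fun x _ => hv x)
      (hh.intervalIntegrable _ _), hv0, sub_zero]
  rw [← sq_abs]
  refine pow_le_pow_left₀ (abs_nonneg _) ?_ 2
  rw [h1]
  refine (intervalIntegral.norm_integral_le_abs_integral_norm (f := h)).trans ?_
  simp only [Real.norm_eq_abs]
  have hpi := Real.pi_pos
  have hi : IntervalIntegrable (fun x => |h x|) volume (-π) π :=
    Continuous.intervalIntegrable (by fun_prop) _ _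
  have := intervalIntegral.abs_integral_mono_interval (μ := volume) (f := fun x => |h x|) (a := 0)
    (b := θ) (c := -π) (d := π) ?_ (Eventually.of_forall fun x => abs_nonneg _) hi
  · refine this.trans (le_of_eq (abs_of_nonneg ?_))
    exact intervalIntegral.integral_nonneg neg_pi_lt_pi.le fun x _ => abs_nonneg _
  · rw [uIoc_of_le neg_pi_lt_pi.le]
    rcases le_total 0 θ with h | h
    · rw [uIoc_of_le h]; exact Ioc_subset_Ioc (by linarith) hθ.2
    · rw [uIoc_of_ge h]; exact Ioc_subset_Ioc hθ.1 hpi.le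

lemma lieBracket_half_add {v : ℝ → ℝ} {f' v' θ : ℝ} (hf : HasDerivAt f f' θ)
    (hv : HasDerivAt v v' θ) (σ : ℝ) :
    lieBracket (fun x => 1 / 2 * f x + σ * v x) (fun x => Real.sin (2 * x)) θ
      = (1 / 2 * f θ + σ * v θ) * (2 * Real.cos (2 * θ))
        - Real.sin (2 * θ) * (1 / 2 * f' + σ * v') := by
  have h1 : deriv (fun x => 1 / 2 * f x + σ * v x) θ = 1 / 2 * f' + σ * v' :=
    ((hf.const_mul (1 / 2)).add (hv.const_mul σ)).deriv
  have h2 := ((hasDerivAt_id θ).const_mul 2).sin.deriv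
  simp only [id, mul_one] at h2
  rw [lieBracket, h1, h2]
  ring

/-- The `L²` energy inequality at a fixed time. -/
lemma energy_inequality {σ : ℝ} (hσ : |σ| ≤ 1) (hf : ContDiff ℝ 1 f)
    (hp : Function.Periodic f (2 * π)) {v g : ℝ → ℝ} (hg : Continuous g) (hv0 : v 0 = 0)
    (hv : ∀ θ, HasDerivAt v (hilbert f θ) θ)
    (heq : ∀ θ, g θ = lieBracket (fun x => 1 / 2 * f x + σ * v x) (fun x => Real.sin (2 * x)) θ) :
    ∫ θ in (-π)..π, 2 * f θ * g θ ≤ (7 + 8 * π ^ 2) * ∫ θ in (-π)..π, f θ ^ 2 := by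
  have hpi := Real.pi_pos
  obtain ⟨C, hC⟩ := exists_lipschitz_of_periodic hf hp
  have hh := continuous_hilbert hf.continuous hC
  have hfc := hf.continuous
  have hfd : Continuous (deriv f) := hf.continuous_deriv le_rfl
  have hvc : Continuous v := continuous_iff_continuousAt.2 fun θ => (hv θ).continuousAt
  have hd : ∀ θ, HasDerivAt (fun x => Real.sin (2 * x) * f x ^ 2)
      (2 * Real.cos (2 * θ) * f θ ^ 2 + Real.sin (2 * θ) * (2 * f θ * deriv f θ)) θ := by
    intro θ
    have h1 : HasDerivAt (fun x : ℝ => Real.sin (2 * x)) (2 * Real.cos (2 * θ)) θ := by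
      have := ((hasDerivAt_id θ).const_mul 2).sin
      simp only [id, mul_one] at this
      rwa [mul_comm] at this
    have h2 : HasDerivAt f (deriv f θ) θ := ((hf.differentiable (by norm_num)) θ).hasDerivAt
    have h3 := h1.mul (h2.pow 2)
    refine h3.congr_deriv ?_
    simp
  have hg' : ∀ θ, g θ = (1 / 2 * f θ + σ * v θ) * (2 * Real.cos (2 * θ))
      - Real.sin (2 * θ) * (1 / 2 * deriv f θ + σ * hilbert f θ) := by
    intro θ
    rw [heq]
    exact lieBracket_half_add ((hf.differentiable (by norm_num)) θ).hasDerivAt (hv θ) σ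
  -- The integration by parts: `sin(2θ) f²` takes the same value at both endpoints, and half of this
  -- identity removes the derivative `f'` from the energy.
  have hzero : ∫ θ in (-π)..π, (2 * Real.cos (2 * θ) * f θ ^ 2
      + Real.sin (2 * θ) * (2 * f θ * deriv f θ)) = 0 := by
    rw [intervalIntegral.integral_eq_sub_of_hasDerivAt (fun x _ => hd x)
      (Continuous.intervalIntegrable (by fun_prop) _ _)]
    have := hp (-π)
    rw [show -π + 2 * π = π by ring] at this
    rw [this, mul_neg, Real.sin_neg, Real.sin_two_pi]; ring
  set B := 2 * π * ∫ x in (-π)..π, hilbert f x ^ 2 with hB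
  -- The `6` collects `3` from the cosine terms, `2` from the product with `v` and `1` from the
  -- product with `Hf`. Integrating `2B` over the period produces `8π²`, and `6 + 1` gives the `7`.
  have hpt : ∀ θ ∈ Icc (-π) π, 2 * f θ * g θ ≤ (6 * f θ ^ 2 + 2 * B + hilbert f θ ^ 2)
      - 1 / 2 * (2 * Real.cos (2 * θ) * f θ ^ 2 + Real.sin (2 * θ) * (2 * f θ * deriv f θ)) := by
    intro θ hθ
    rw [hg']
    have hvB : v θ ^ 2 ≤ B := velocity_sq_le hh hv hv0 hθ
    have hc := Real.abs_cos_le_one (2 * θ)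
    have hs := Real.abs_sin_le_one (2 * θ)
    have key : ∀ c x y : ℝ, |c| ≤ 1 → 2 * c * (x * y) ≤ x ^ 2 + y ^ 2 := by
      intro c x y hc
      have h1 : 2 * c * (x * y) ≤ 2 * (|x| * |y|) := by
        calc 2 * c * (x * y) ≤ |2 * c * (x * y)| := le_abs_self _
          _ = 2 * (|c| * (|x| * |y|)) := by simp [abs_mul]; ring
          _ ≤ 2 * (1 * (|x| * |y|)) := by gcongr
          _ = _ := by ring
      have := two_mul_le_add_sq |x| |y|
      rw [sq_abs, sq_abs] at this
      linarith
    have k1 := key (σ * Real.cos (2 * θ)) (f θ) (v θ) (by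
      rw [abs_mul]; exact mul_le_one₀ hσ (abs_nonneg _) hc)
    have k2 := key (-(σ * Real.sin (2 * θ))) (f θ) (hilbert f θ) (by
      rw [abs_neg, abs_mul]; exact mul_le_one₀ hσ (abs_nonneg _) hs)
    have k3 : Real.cos (2 * θ) * f θ ^ 2 ≤ f θ ^ 2 :=
      mul_le_of_le_one_left (sq_nonneg _) (Real.cos_le_one _)
    linarith
  have hmono := intervalIntegral.integral_mono_on neg_pi_lt_pi.le
    (Continuous.intervalIntegrable (μ := volume) (by fun_prop : Continuous fun θ => 2 * f θ * g θ) _ _)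
    (Continuous.intervalIntegrable (μ := volume) (by fun_prop : Continuous fun θ =>
      (6 * f θ ^ 2 + 2 * B + hilbert f θ ^ 2)
      - 1 / 2 * (2 * Real.cos (2 * θ) * f θ ^ 2 + Real.sin (2 * θ) * (2 * f θ * deriv f θ))) _ _)
    hpt
  refine hmono.trans ?_
  rw [intervalIntegral.integral_sub (Continuous.intervalIntegrable (by fun_prop) _ _)
    (Continuous.intervalIntegrable (by fun_prop) _ _), intervalIntegral.integral_const_mul, hzero,
    intervalIntegral.integral_add (Continuous.intervalIntegrable (by fun_prop) _ _)
    (Continuous.intervalIntegrable (by fun_prop) _ _),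
    intervalIntegral.integral_add (Continuous.intervalIntegrable (by fun_prop) _ _)
    (Continuous.intervalIntegrable (by fun_prop) _ _), intervalIntegral.integral_const_mul,
    intervalIntegral.integral_const, smul_eq_mul]
  have hle := integral_hilbert_sq_le hf hp
  have : (π - -π) * (2 * B) = 8 * π ^ 2 * ∫ x in (-π)..π, hilbert f x ^ 2 := by rw [hB]; ring
  rw [this]
  have h8 : 8 * π ^ 2 * ∫ x in (-π)..π, hilbert f x ^ 2 ≤ 8 * π ^ 2 * ∫ x in (-π)..π, f x ^ 2 := by
    gcongr
  linarith

lemma hasDerivAt_energy {ζ : ℝ → ℝ → ℝ} {T : ℝ}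
    (hζ : ContDiffOn ℝ 1 (fun z : ℝ × ℝ => ζ z.1 z.2) (Ioo 0 T ×ˢ univ)) {t : ℝ}
    (ht : t ∈ Ioo 0 T) :
    Continuous (fun θ => deriv (fun s => ζ s θ) t) ∧
    HasDerivAt (fun t => ∫ θ in (-π)..π, ζ t θ ^ 2)
      (∫ θ in (-π)..π, 2 * ζ t θ * deriv (fun s => ζ s θ) t) t := by
  have hopen : IsOpen (Ioo 0 T ×ˢ (univ : Set ℝ)) := isOpen_Ioo.prod isOpen_univ
  have hcd : ContinuousOn (fderiv ℝ (fun z : ℝ × ℝ => ζ z.1 z.2)) (Ioo 0 T ×ˢ univ) :=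
    hζ.continuousOn_fderiv_of_isOpen hopen le_rfl
  have hder : ∀ s ∈ Ioo 0 T, ∀ θ, HasDerivAt (fun s => ζ s θ)
      (fderiv ℝ (fun z : ℝ × ℝ => ζ z.1 z.2) (s, θ) (1, 0)) s := by
    intro s hs θ
    have h1 : HasFDerivAt (fun z : ℝ × ℝ => ζ z.1 z.2)
        (fderiv ℝ (fun z : ℝ × ℝ => ζ z.1 z.2) (s, θ)) (s, θ) :=
      ((hζ.contDiffAt (hopen.mem_nhds ⟨hs, mem_univ _⟩)).differentiableAt (by norm_num)).hasFDerivAt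
    have h2 : HasDerivAt (fun s : ℝ => (s, θ)) (1, 0) s :=
      (hasDerivAt_id s).prodMk (hasDerivAt_const s θ)
    exact h1.comp_hasDerivAt s h2
  set D : ℝ → ℝ → ℝ := fun s θ => fderiv ℝ (fun z : ℝ × ℝ => ζ z.1 z.2) (s, θ) (1, 0) with hD
  have hDc : ContinuousOn (fun z : ℝ × ℝ => D z.1 z.2) (Ioo 0 T ×ˢ univ) :=
    hcd.clm_apply continuousOn_const
  have hslice : ∀ (F : ℝ → ℝ → ℝ), ContinuousOn (fun z : ℝ × ℝ => F z.1 z.2) (Ioo 0 T ×ˢ univ) →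
      ∀ s ∈ Ioo 0 T, Continuous (F s) := by
    intro F hF s hs
    exact hF.comp_continuous (f := fun θ => (s, θ)) (by fun_prop) fun θ => ⟨hs, mem_univ _⟩
  have hdt : (fun θ => deriv (fun s => ζ s θ) t) = D t := funext fun θ => (hder t ht θ).deriv
  refine ⟨hdt ▸ hslice D hDc t ht, ?_⟩
  have hdt' : ∀ θ, deriv (fun s => ζ s θ) t = D t θ := fun θ => congrFun hdt θ
  simp only [hdt']
  have hF' : ContinuousOn (fun z : ℝ × ℝ => 2 * ζ z.1 z.2 * D z.1 z.2) (Ioo 0 T ×ˢ univ) :=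
    (continuousOn_const.mul hζ.continuousOn).mul hDc
  obtain ⟨δ, hδ, hball⟩ := Metric.isOpen_iff.1 isOpen_Ioo t ht
  -- A compact time interval inside the open domain gives a constant dominating function on one
  -- period.
  have hsub : Icc (t - δ / 2) (t + δ / 2) ⊆ Ioo 0 T := by
    intro s hs
    refine hball ?_
    rw [Metric.mem_ball, Real.dist_eq, abs_lt]
    constructor <;> linarith [hs.1, hs.2]
  obtain ⟨M, hM⟩ := ((isCompact_Icc (a := t - δ / 2) (b := t + δ / 2)).prod
    (isCompact_Icc (a := -π) (b := π))).exists_bound_of_continuousOn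
    (hF'.mono (prod_mono hsub (subset_univ _)))
  have hnhds : Icc (t - δ / 2) (t + δ / 2) ∈ 𝓝 t := Icc_mem_nhds (by linarith) (by linarith)
  refine (intervalIntegral.hasDerivAt_integral_of_dominated_loc_of_deriv_le
    (F := fun s θ => ζ s θ ^ 2) (F' := fun s θ => 2 * ζ s θ * D s θ) (bound := fun _ => M)
    hnhds ?_ ?_ ?_ ?_ ?_ ?_).2
  · filter_upwards [isOpen_Ioo.mem_nhds ht] with s hs
    exact ((hslice ζ hζ.continuousOn s hs).pow 2).aestronglyMeasurable
  · exact ((hslice ζ hζ.continuousOn t ht).pow 2).intervalIntegrable _ _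
  · exact (hslice (fun s θ => 2 * ζ s θ * D s θ) hF' t ht).aestronglyMeasurable
  · refine Eventually.of_forall fun θ hθ s hs => ?_
    rw [uIoc_of_le neg_pi_lt_pi.le] at hθ
    exact hM (s, θ) ⟨hs, Ioc_subset_Icc_self hθ⟩
  · exact intervalIntegrable_const
  · refine Eventually.of_forall fun θ _ s hs => ?_
    refine ((hder s (hsub hs) θ).pow 2).congr_deriv ?_
    simp [hD]

/-- A solution of the homogeneous problem with zero initial value vanishes. -/
theorem eq_zero_of_solution {σ : ℝ} (hσ : |σ| ≤ 1) {T : ℝ} {ζ : ℝ → ℝ → ℝ}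
    (hper : ∀ t ∈ Icc 0 T, Function.Periodic (ζ t) (2 * π))
    (hc : ContinuousOn (fun z : ℝ × ℝ => ζ z.1 z.2) (Icc 0 T ×ˢ univ))
    (hζ : ContDiffOn ℝ 1 (fun z : ℝ × ℝ => ζ z.1 z.2) (Ioo 0 T ×ˢ univ))
    (heq : ∀ t ∈ Ioo 0 T, ∃ v : ℝ → ℝ, v 0 = 0 ∧ (∀ θ, HasDerivAt v (hilbert (ζ t) θ) θ) ∧
      ∀ θ, deriv (fun s => ζ s θ) t
        = lieBracket (fun x => 1 / 2 * ζ t x + σ * v x) (fun x => Real.sin (2 * x)) θ)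
    (h0 : ∀ θ, ζ 0 θ = 0) {t : ℝ} (ht : t ∈ Icc 0 T) (θ : ℝ) : ζ t θ = 0 := by
  have hT : 0 ≤ T := ht.1.trans ht.2
  set E : ℝ → ℝ := fun t => ∫ θ in (-π)..π, ζ t θ ^ 2 with hE
  set K : ℝ := 7 + 8 * π ^ 2
  have hEc : ContinuousOn E (Icc 0 T) := by
    -- Clamping time to `[0, T]` extends the integrand continuously to the whole plane, without
    -- changing it on the interval.
    have hproj : Continuous fun z : ℝ × ℝ => ζ (max 0 (min z.1 T)) z.2 ^ 2 := by
      refine Continuous.pow ?_ 2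
      exact hc.comp_continuous (f := fun z : ℝ × ℝ => (max 0 (min z.1 T), z.2)) (by fun_prop)
        fun z => ⟨⟨le_max_left _ _, max_le hT (min_le_right _ _)⟩, mem_univ _⟩
    have := intervalIntegral.continuous_parametric_intervalIntegral_of_continuous' (μ := volume)
      (f := fun s θ => ζ (max 0 (min s T)) θ ^ 2) hproj (-π) π
    refine this.continuousOn.congr fun s hs => ?_
    simp only [hE]
    rw [min_eq_left hs.2, max_eq_right hs.1]
  have hEd : ∀ s ∈ Ioo 0 T, ∃ E', HasDerivAt E E' s ∧ E' ≤ K * E s := by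
    intro s hs
    obtain ⟨hgc, hd⟩ := hasDerivAt_energy hζ hs
    refine ⟨_, hd, ?_⟩
    obtain ⟨v, hv0, hv, he⟩ := heq s hs
    have hfs : ContDiff ℝ 1 (ζ s) := by
      have : ContDiffOn ℝ 1 (fun θ : ℝ => ζ s θ) univ :=
        hζ.comp (f := fun θ : ℝ => (s, θ)) (by fun_prop) fun θ _ => ⟨hs, mem_univ _⟩
      exact contDiffOn_univ.1 this
    exact energy_inequality hσ hfs (hper s (Ioo_subset_Icc_self hs)) hgc hv0 hv he
  -- Grönwall: the differential inequality is needed only for `0 < s < T`; continuity of the energy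
  -- reaches the endpoints.
  have hanti : AntitoneOn (fun s => Real.exp (-K * s) * E s) (Icc 0 T) := by
    refine antitoneOn_of_deriv_nonpos (convex_Icc 0 T) ?_ ?_ ?_
    · exact (by fun_prop : Continuous fun s => Real.exp (-K * s)).continuousOn.mul hEc
    all_goals
      intro s hs
      rw [interior_Icc] at hs
      obtain ⟨E', hE', hle⟩ := hEd s hs
      have h1 : HasDerivAt (fun s => Real.exp (-K * s)) (Real.exp (-K * s) * (-K)) s := by
        simpa using ((hasDerivAt_id s).const_mul (-K)).exp
      have h2 := h1.mul hE'
    · exact h2.differentiableAt.differentiableWithinAt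
    · have h3 : deriv (fun s => Real.exp (-K * s) * E s) s = _ := h2.deriv
      rw [h3]
      have := Real.exp_pos (-K * s)
      nlinarith
  have hE0 : E 0 = 0 := by simp [hE, h0]
  have hEt : E t ≤ 0 := by
    have := hanti ⟨le_rfl, hT⟩ ht ht.1
    simp only [hE0, mul_zero] at this
    exact nonpos_of_mul_nonpos_right this (Real.exp_pos _)
  have hcont : Continuous (ζ t) :=
    hc.comp_continuous (f := fun θ => (t, θ)) (by fun_prop) fun θ => ⟨ht, mem_univ _⟩
  have hz : ζ t =ᵐ[torusMeasure] fun _ => 0 := by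
    have hEt' : ∫ θ, ζ t θ ^ 2 ∂torusMeasure = 0 := by
      rw [integral_torus_eq]
      exact le_antisymm hEt (intervalIntegral.integral_nonneg neg_pi_lt_pi.le
        fun x _ => sq_nonneg _)
    rw [integral_eq_zero_iff_of_nonneg (fun x => sq_nonneg _)] at hEt'
    · filter_upwards [hEt'] with x hx
      simpa using hx
    · exact ((intervalIntegrable_iff_integrableOn_Ioc_of_le neg_pi_lt_pi.le).1
        ((hcont.pow 2).intervalIntegrable _ _))
  exact congrFun (eq_of_ae_eq hcont continuous_const (hper t ht) (fun _ => rfl) hz) θ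

/-- Uniqueness of limits identifies the principal value in `IsVelocity` with the absolutely
convergent integral. -/
lemma IsVelocity.hasDerivAt {v : ℝ → ℝ} (hf : ContDiff ℝ 1 f) (hp : Function.Periodic f (2 * π))
    (h : IsVelocity f v) (θ : ℝ) : HasDerivAt v (hilbert f θ) θ := by
  obtain ⟨C, hC⟩ := exists_lipschitz_of_periodic hf hp
  obtain ⟨y, hy, hd⟩ := h.2 θ
  rwa [tendsto_nhds_unique hy (hasHilbertTransformAt_hilbert hf.continuous hC θ)] at hd

lemma hilbert_sub {g : ℝ → ℝ} (hf : ContDiff ℝ 1 f) (hp : Function.Periodic f (2 * π))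
    (hg : ContDiff ℝ 1 g) (hq : Function.Periodic g (2 * π)) (θ : ℝ) :
    hilbert (fun x => f x - g x) θ = hilbert f θ - hilbert g θ := by
  obtain ⟨C, hC⟩ := exists_lipschitz_of_periodic hf hp
  obtain ⟨C', hC'⟩ := exists_lipschitz_of_periodic hg hq
  unfold hilbert
  rw [← mul_sub, ← intervalIntegral.integral_sub
    (intervalIntegrable_hilbert_kernel hf.continuous hC θ)
    (intervalIntegrable_hilbert_kernel hg.continuous hC' θ)]
  congr 1
  refine intervalIntegral.integral_congr fun s _ => ?_
  ring

/-- Uniqueness for one component; `σ = ±1` is the sign of the velocity. -/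
theorem unique_solution {σ : ℝ} (hσ : |σ| ≤ 1) {T : ℝ} {ξ η : ℝ → ℝ → ℝ}
    (hξp : ∀ t ∈ Icc 0 T, Function.Periodic (ξ t) (2 * π))
    (hηp : ∀ t ∈ Icc 0 T, Function.Periodic (η t) (2 * π))
    (hξc : ContinuousOn (fun z : ℝ × ℝ => ξ z.1 z.2) (Icc 0 T ×ˢ univ))
    (hηc : ContinuousOn (fun z : ℝ × ℝ => η z.1 z.2) (Icc 0 T ×ˢ univ))
    (hξ : ContDiffOn ℝ 1 (fun z : ℝ × ℝ => ξ z.1 z.2) (Ioc 0 T ×ˢ univ))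
    (hη : ContDiffOn ℝ 1 (fun z : ℝ × ℝ => η z.1 z.2) (Ioc 0 T ×ˢ univ))
    (eξ : ∀ t ∈ Ioc 0 T, ∃ v, IsVelocity (ξ t) v ∧ ∀ θ, HasDerivWithinAt (fun s => ξ s θ)
        (lieBracket (fun x => 1 / 2 * ξ t x + σ * v x) (fun x => Real.sin (2 * x)) θ) (Icc 0 T) t)
    (eη : ∀ t ∈ Ioc 0 T, ∃ v, IsVelocity (η t) v ∧ ∀ θ, HasDerivWithinAt (fun s => η s θ)
        (lieBracket (fun x => 1 / 2 * η t x + σ * v x) (fun x => Real.sin (2 * x)) θ) (Icc 0 T) t)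
    (h0 : ξ 0 =ᵐ[torusMeasure] η 0) {t : ℝ} (ht : t ∈ Icc 0 T) (θ : ℝ) : ξ t θ = η t θ := by
  have hT : 0 ≤ T := ht.1.trans ht.2
  have hsub : Ioo 0 T ×ˢ (univ : Set ℝ) ⊆ Ioc 0 T ×ˢ univ :=
    prod_mono Ioo_subset_Ioc_self subset_rfl
  have hslice : ∀ (F : ℝ → ℝ → ℝ), ContinuousOn (fun z : ℝ × ℝ => F z.1 z.2) (Icc 0 T ×ˢ univ) →
      ∀ s ∈ Icc 0 T, Continuous (F s) := fun F hF s hs =>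
    hF.comp_continuous (f := fun θ => (s, θ)) (by fun_prop) fun θ => ⟨hs, mem_univ _⟩
  have hsm : ∀ (F : ℝ → ℝ → ℝ), ContDiffOn ℝ 1 (fun z : ℝ × ℝ => F z.1 z.2) (Ioc 0 T ×ˢ univ) →
      ∀ s ∈ Ioc 0 T, ContDiff ℝ 1 (F s) := fun F hF s hs =>
    contDiffOn_univ.1 (hF.comp (f := fun θ : ℝ => (s, θ)) (by fun_prop)
      fun θ _ => ⟨hs, mem_univ _⟩)
  -- The initial data are prescribed only almost everywhere; continuity and periodicity upgrade this
  -- to every point.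
  have hinit : ξ 0 = η 0 := eq_of_ae_eq (hslice ξ hξc 0 ⟨le_rfl, hT⟩)
    (hslice η hηc 0 ⟨le_rfl, hT⟩) (hξp 0 ⟨le_rfl, hT⟩) (hηp 0 ⟨le_rfl, hT⟩) h0
  refine sub_eq_zero.1 (eq_zero_of_solution (ζ := fun t θ => ξ t θ - η t θ) hσ
    (fun s hs x => ?_) (hξc.sub hηc) ((hξ.mono hsub).sub (hη.mono hsub)) (fun s hs => ?_)
    (fun θ => by rw [hinit, sub_self]) ht θ)
  · simp only
    rw [hξp s hs, hηp s hs]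
  · have hs' : s ∈ Ioc 0 T := Ioo_subset_Ioc_self hs
    have hs'' : s ∈ Icc 0 T := Ioo_subset_Icc_self hs
    obtain ⟨v, hv, dv⟩ := eξ s hs'
    obtain ⟨w, hw, dw⟩ := eη s hs'
    have hv' := hv.hasDerivAt (hsm ξ hξ s hs') (hξp s hs'')
    have hw' := hw.hasDerivAt (hsm η hη s hs') (hηp s hs'')
    refine ⟨fun x => v x - w x, by simp only [hv.1, hw.1, sub_self], fun x => ?_, fun x => ?_⟩
    · rw [hilbert_sub (hsm ξ hξ s hs') (hξp s hs'') (hsm η hη s hs') (hηp s hs'')]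
      exact (hv' x).sub (hw' x)
    · have hn : Icc 0 T ∈ 𝓝 s := Icc_mem_nhds hs.1 hs.2
      have h1 := ((dv x).hasDerivAt hn).sub ((dw x).hasDerivAt hn)
      have h2 : deriv (fun s => ξ s x - η s x) s = _ := h1.deriv
      rw [h2]
      have dξ : HasDerivAt (ξ s) (deriv (ξ s) x) x :=
        (((hsm ξ hξ s hs').differentiable (by norm_num)) x).hasDerivAt
      have dη : HasDerivAt (η s) (deriv (η s) x) x :=
        (((hsm η hη s hs').differentiable (by norm_num)) x).hasDerivAt
      rw [lieBracket_half_add dξ (hv' x), lieBracket_half_add dη (hw' x)]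
      refine Eq.trans ?_ (lieBracket_half_add (dξ.sub dη) ((hv' x).sub (hw' x)) σ).symm
      simp only [Pi.sub_apply]
      ring

end Uniqueness

end LinMHD

theorem mainTheorem2 (m : ℕ) (hm : 3 < m) (η₀p η₀m : LinMHD.Sobolev m) (T : ℝ) (hT : 0 < T) :
    ∃ ηp ηm : ℝ → ℝ → ℝ,
      LinMHD.IsClassicalSolution T ηp ηm ∧
      LinMHD.Represents (ηp 0) η₀p ∧ LinMHD.Represents (ηm 0) η₀m ∧
      LinMHD.InTimeSobolev 0 m T ηp ∧ LinMHD.InTimeSobolev 0 m T ηm ∧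
      LinMHD.InTimeSobolev 2 (m - 2) T ηp ∧ LinMHD.InTimeSobolev 2 (m - 2) T ηm ∧
      ∀ ξp ξm : ℝ → ℝ → ℝ,
        LinMHD.IsClassicalSolution T ξp ξm →
        LinMHD.Represents (ξp 0) η₀p → LinMHD.Represents (ξm 0) η₀m →
        ∀ t ∈ Set.Icc 0 T, ∀ θ : ℝ, ξp t θ = ηp t θ ∧ ξm t θ = ηm t θ := by
  -- The condition `m > 3` becomes `n ≥ 2`, the regularity needed to differentiate point evaluation
  -- in `θ`.
  obtain ⟨n, rfl⟩ : ∃ n, m = n + 2 := ⟨m - 2, by omega⟩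
  rw [Nat.add_sub_cancel]
  have hσ : |(1 : ℝ)| ≤ 1 := by simp
  have hσ' : |(-1 : ℝ)| ≤ 1 := by simp
  obtain ⟨ηp, pp, cp, ep, rp, sp, sp'⟩ := LinMHD.exists_solution hσ (n := n) (by omega) η₀p T
  obtain ⟨ηm, pm, cm, em, rm, sm, sm'⟩ := LinMHD.exists_solution hσ' (n := n) (by omega) η₀m T
  have hp : ∀ (η v : ℝ → ℝ),
      (fun x => 1 / 2 * η x + 1 * v x) = fun x => 1 / 2 * η x + v x := by
    intro η v; funext x; ring
  have hn : ∀ (η v : ℝ → ℝ),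
      (fun x => 1 / 2 * η x + -1 * v x) = fun x => 1 / 2 * η x - v x := by
    intro η v; funext x; ring
  have hsol : LinMHD.IsClassicalSolution T ηp ηm := by
    refine ⟨fun t _ => pp t, fun t _ => pm t, cp.continuous.continuousOn,
      cm.continuous.continuousOn, cp.contDiffOn, cm.contDiffOn, fun t _ => ?_, fun t _ => ?_⟩
    · obtain ⟨v, hv, hd⟩ := ep t
      simp only [hp] at hd
      exact ⟨v, hv, fun θ => (hd θ).hasDerivWithinAt⟩
    · obtain ⟨v, hv, hd⟩ := em t
      simp only [hn] at hd
      exact ⟨v, hv, fun θ => (hd θ).hasDerivWithinAt⟩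
  refine ⟨ηp, ηm, hsol, rp, rm, sp, sm, sp', sm', fun ξp ξm hξ rξp rξm t ht θ => ⟨?_, ?_⟩⟩
  · refine LinMHD.unique_solution hσ hξ.periodic_p hsol.periodic_p hξ.continuousOn_p
      hsol.continuousOn_p hξ.contDiffOn_p hsol.contDiffOn_p ?_ ?_ (rξp.2.trans rp.2.symm) ht θ
    · simpa only [hp] using hξ.equation_p
    · simpa only [hp] using hsol.equation_p
  · refine LinMHD.unique_solution hσ' hξ.periodic_m hsol.periodic_m hξ.continuousOn_m
      hsol.continuousOn_m hξ.contDiffOn_m hsol.contDiffOn_m ?_ ?_ (rξm.2.trans rm.2.symm) ht θ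
    · simpa only [hn] using hξ.equation_m
    · simpa only [hn] using hsol.equation_m
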